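/- **Setting.** Spins are $j\in\{0,\tfrac12,1,\dots\}$, $d_j=2j+1$; $\chi^j$ is the spin-$j$ character of $SU(2)$, the unitary subgroup of $SL(2,\mathbb C)$, and $dh$ is its normalized Haar measure. For $p\in\mathbb R$ and a spin $k$, $D^{p,k}$ is the unitary principal series representation of $SL(2,\mathbb C)$, $(D^{p,k}(g)F)(z)=F(zg)$ on functions of row vectors $z\in\mathbb C^2\setminus\{0\}$ with $F(\lambda z)=\lambda^{-1+ip+k}\bar\lambda^{-1+ip-k}F(z)$, realized on $L^2(\mathbb C)$ by $\varphi(\zeta)=F(\zeta,1)$, and $\chi^{p,k}$ is its character, a distribution: an integral $\int w(x)\,\chi^{p,k}(G(x))\,dx$ denotes the trace of the operator $\int w(x)\,D^{p,k}(G(x))\,dx$. Fix $\gamma>0$. *Dupuis–Livine map.* For the degree $p(j)=\gamma j$ let $K_j(g,h)=d_j^2\int_{SU(2)}dk\,\chi^{\gamma j,j}(gk)\,\chi^j(kh)$ for $g\in SL(2,\mathbb C)$, $h\in SU(2)$, and $(f\psi)(g)=\sum_j\int_{SU(2)}dh\,K_j(g,h)\,\psi(h)$. A function $\psi$ on $SL(2,\mathbb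 C)$ is projected of degree $\gamma j$ if $\psi=f(\psi|_{SU(2)})$, with absolutely convergent integrals and sum. For a finite set of links, $((\otimes_l f)\psi)(g)=\sum_{(j_l)}\int\prod_l dh_l\,\prod_l K_{j_l}(g_l,h_l)\,\psi(h)$. *Two-complex.* Let $\mathcal C$ be a finite combinatorial two-complex with bulk vertices $v$, oriented bulk edges $e$ and faces $f$, bounded by a graph with nodes $n$ and oriented links $l$. Bulk edges join bulk vertices or nodes; the boundary $\partial f$ of a face is a nonempty closed path of bulk edges and links, traversed with signs $\epsilon_{ef}=\pm1$; each link occurs in the boundary of exactly one face, exactly once; each node is an end of exactly one bulk edge; no two consecutive sides of a face are links. Choose one bulk half-edge at every bulk vertex. Attach a variable $g_{ev}\in SL(2,\mathbb C)$ to every half-edge $(e,v)$ at a bulk vertex, except that $g_{ev}=1$ at the chosen half-edges; put $g_{en}=1$ at the nodes, and let $h_{ef}\in SU(2)$ be a variable for each bulk side $e$ of each face $f$. For $g_l\in SL(2,\mathbb C)$ put $g_{ef}=g_{es_e}h_{ef}g_{et_e}^{-1}$ on bulk edges and $g_{ef}=g_l$ on the link $e=l$. For an assignment $j=(j_f)$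 of spins to the faces let $$A_j(g_l)=\int_{SL(2,\mathbb C)}\prod dg_{ev}\ \prod_f d_{j_f}\int_{SU(2)}\prod_{e}dh_{ef}\ \chi^{\gamma j_f,j_f}\Big(\prod_{e\in\partial f}g_{ef}^{\epsilon_{ef}}\Big)\prod_{e\in\partial f,\ e\ \mathrm{bulk}}\chi^{j_f}(h_{ef}),$$ with any Haar measure $dg_{ev}$, and $$\tilde Z_{\mathcal C}(g_l)=\sum_{(j_f)}A_j(g_l),\qquad Z_{\mathcal C}=\tilde Z_{\mathcal C}\big|_{SU(2)^{\{l\}}}.$$ **Theorem 1.** Assume that the amplitude converges absolutely: for all spins and all $g_l\in SL(2,\mathbb C)$ the integral over the $g_{ev}$ in $A_j(g_l)$ converges absolutely, and $\sum_j\int_{SU(2)^S}|A_j|\prod_{l\in S}dh_l<\infty$ for every set $S$ of links, where the entries in $S$ are $h_l$ and the other entries are arbitrary fixed elements $g_l\in SL(2,\mathbb C)$. Then $\tilde Z_{\mathcal C}$ is a projected function of degree $p(j)=\gamma j$ in each of its entries (for arbitrary fixed values in $SL(2,\mathbb C)$ of the other entries). Moreover, the integrals and the sum in $(\otimes_l f)Z_{\mathcal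 C}$ converge absolutely on $SL(2,\mathbb C)^{\{l\}}$, and $$(\otimes_l f)\,Z_{\mathcal C}=\tilde Z_{\mathcal C}.$$ -/

import Mathlib

open MeasureTheory
open scoped ComplexConjugate ENNReal

noncomputable section

namespace Spinfoam

/-! ### The groups and their Haar measures -/

/-- The group `SL(2,ℂ)`. -/
abbrev SL2C : Type := Matrix.SpecialLinearGroup (Fin 2) ℂ

instance : MeasurableSpace SL2C := borel SL2C

instance : BorelSpace SL2C := ⟨rfl⟩

/-- `SU(2)`, canonically embedded in `SL(2,ℂ)` as the subgroup of unitary matrices. -/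
def SU2 : Subgroup SL2C where
  carrier := {g | (g : Matrix (Fin 2) (Fin 2) ℂ) ∈ Matrix.unitaryGroup (Fin 2) ℂ}
  one_mem' := by
    change ((1 : SL2C) : Matrix (Fin 2) (Fin 2) ℂ) ∈ Matrix.unitaryGroup (Fin 2) ℂ
    rw [Matrix.SpecialLinearGroup.coe_one]
    exact one_mem _
  mul_mem' := by
    intro a b ha hb
    change ((a * b : SL2C) : Matrix (Fin 2) (Fin 2) ℂ) ∈ Matrix.unitaryGroup (Fin 2) ℂ
    rw [Matrix.SpecialLinearGroup.coe_mul]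
    exact mul_mem ha hb
  inv_mem' := by
    intro a ha
    change ((a⁻¹ : SL2C) : Matrix (Fin 2) (Fin 2) ℂ) ∈ Matrix.unitaryGroup (Fin 2) ℂ
    have h1 : (a : Matrix (Fin 2) (Fin 2) ℂ) * ((a⁻¹ : SL2C) : Matrix (Fin 2) (Fin 2) ℂ) = 1 := by
      rw [← Matrix.SpecialLinearGroup.coe_mul, mul_inv_cancel, Matrix.SpecialLinearGroup.coe_one]
    have h2 : star (a : Matrix (Fin 2) (Fin 2) ℂ) * (a : Matrix (Fin 2) (Fin 2) ℂ) = 1 :=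
      Matrix.mem_unitaryGroup_iff'.1 ha
    have h3 : ((a⁻¹ : SL2C) : Matrix (Fin 2) (Fin 2) ℂ) = star (a : Matrix (Fin 2) (Fin 2) ℂ) :=
      (left_inv_eq_right_inv h2 h1).symm
    rw [h3]
    exact Unitary.star_mem ha

instance : CompactSpace SU2 := by
  refine isCompact_iff_compactSpace.1 (?_ : IsCompact (SU2 : Set SL2C))
  have hemb : Topology.IsClosedEmbedding
      (fun g : SL2C => (g : Matrix (Fin 2) (Fin 2) ℂ)) :=
    Matrix.SpecialLinearGroup.isClosedEmbedding_val
  have hball : IsCompact (Set.univ.pi fun _ : Fin 2 => Set.univ.pi fun _ : Fin 2 =>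
      Metric.closedBall (0 : ℂ) 1) :=
    isCompact_univ_pi fun _ => isCompact_univ_pi fun _ => isCompact_closedBall _ _
  have hpre := hemb.isCompact_preimage hball
  refine hpre.of_isClosed_subset ?_ ?_
  · have hc : Continuous (fun g : SL2C => (g : Matrix (Fin 2) (Fin 2) ℂ)) := hemb.continuous
    have : IsClosed {g : SL2C | (g : Matrix (Fin 2) (Fin 2) ℂ)
        * star (g : Matrix (Fin 2) (Fin 2) ℂ) = 1} :=
      isClosed_eq (hc.mul hc.star) continuous_const
    convert this using 1
    ext g
    exact Matrix.mem_unitaryGroup_iff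
  · intro g hg i _ j _
    simpa using entry_norm_bound_of_unitary (hU := hg) i j

/-- The normalized Haar measure of `SU(2)`. -/
def haarSU2 : Measure SU2 := Measure.haarMeasure ⊤

/-! ### Representations and characters

Spins `j ∈ ℕ/2` are encoded by the natural number `n = 2j`; thus `d_j = n + 1`. -/

/-- The substitution `P(z) ↦ P(z M)` of polynomials in a row vector `z` of two variables. -/
def linearSubst (M : Matrix (Fin 2) (Fin 2) ℂ) :
    MvPolynomial (Fin 2) ℂ →ₐ[ℂ] MvPolynomial (Fin 2) ℂ :=
  MvPolynomial.aeval fun i => ∑ k : Fin 2, MvPolynomial.C (M k i) * MvPolynomial.X k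

lemma linearSubst_one : linearSubst 1 = AlgHom.id ℂ _ := by
  refine MvPolynomial.algHom_ext fun i => ?_
  simp [linearSubst, Matrix.one_apply]

lemma linearSubst_mul (M M' : Matrix (Fin 2) (Fin 2) ℂ) :
    linearSubst (M * M') = (linearSubst M).comp (linearSubst M') := by
  refine MvPolynomial.algHom_ext fun i => ?_
  simp only [linearSubst, AlgHom.comp_apply, MvPolynomial.aeval_X, map_mul,
    MvPolynomial.aeval_C, MvPolynomial.algebraMap_eq, Matrix.mul_apply, Fin.sum_univ_two, map_add]
  ring

lemma linearSubst_mem (M : Matrix (Fin 2) (Fin 2) ℂ) (n : ℕ) (P : MvPolynomial (Fin 2) ℂ)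
    (hP : P ∈ MvPolynomial.homogeneousSubmodule (Fin 2) ℂ n) :
    linearSubst M P ∈ MvPolynomial.homogeneousSubmodule (Fin 2) ℂ n := by
  have hP' : P.IsHomogeneous n := hP
  have h1 := hP'.aeval (n := 1) (fun i : Fin 2 =>
    ∑ k : Fin 2, MvPolynomial.C (M k i) * MvPolynomial.X (R := ℂ) k) (fun i =>
      MvPolynomial.IsHomogeneous.sum _ _ _ fun k _ => by
        simpa using (MvPolynomial.isHomogeneous_C (Fin 2) (M k i)).mul
          (MvPolynomial.isHomogeneous_X ℂ k))
  rw [one_mul] at h1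
  exact h1

/-- The spin `n/2` representation of `SU(2)`: homogeneous polynomials `P` of degree `n` in two
variables, with `(h P)(z) = P(z h)`. -/
def spinRep (n : ℕ) : Representation ℂ SU2 (MvPolynomial.homogeneousSubmodule (Fin 2) ℂ n) where
  toFun h := (linearSubst ((h : SL2C) : Matrix (Fin 2) (Fin 2) ℂ)).toLinearMap.restrict
    (linearSubst_mem _ n)
  map_one' := by
    refine LinearMap.ext fun P => Subtype.ext ?_
    change linearSubst (((1 : SU2) : SL2C) : Matrix (Fin 2) (Fin 2) ℂ) P = P
    rw [Subgroup.coe_one, Matrix.SpecialLinearGroup.coe_one, linearSubst_one, AlgHom.id_apply]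
  map_mul' g h := by
    refine LinearMap.ext fun P => Subtype.ext ?_
    change linearSubst (((g * h : SU2) : SL2C) : Matrix (Fin 2) (Fin 2) ℂ) P =
      linearSubst ((g : SL2C) : Matrix (Fin 2) (Fin 2) ℂ)
        (linearSubst ((h : SL2C) : Matrix (Fin 2) (Fin 2) ℂ) P)
    rw [Subgroup.coe_mul, Matrix.SpecialLinearGroup.coe_mul, linearSubst_mul, AlgHom.comp_apply]

/-- The character `χ^j` of `SU(2)`, `j = n/2`. -/
def chiSU2 (n : ℕ) (h : SU2) : ℂ := (spinRep n).character h

/-- The Hilbert space `L²(ℂ)` carrying the principal series. -/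
abbrev L2C : Type := Lp ℂ 2 (volume : Measure ℂ)

/-- The unitary principal series representation `(p,k)`, `k = n/2`, of `SL(2,ℂ)`. It acts by
`(g F)(z) = F(z g)` on functions of row vectors `z ∈ ℂ² ∖ {0}` with
`F(λ z) = λ^(-1+ip+k) (conj λ)^(-1+ip-k) F(z)`, written here in terms of `φ(ζ) = F(ζ,1)`. -/
def principalSeries (p : ℝ) (n : ℕ) (g : SL2C) (φ : ℂ → ℂ) (ζ : ℂ) : ℂ :=
  let w : ℂ := g 0 1 * ζ + g 1 1
  ((‖w‖ : ℂ) ^ (-2 + 2 * Complex.I * (p : ℂ))) * (w / ‖w‖) ^ n * φ ((g 0 0 * ζ + g 1 0) / w)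

/-- The matrix element `⟨φ, D^{p,k}(g) ψ⟩`, `k = n/2`. -/
def matrixElement (p : ℝ) (n : ℕ) (g : SL2C) (φ ψ : L2C) : ℂ :=
  ∫ ζ : ℂ, conj (φ ζ) * principalSeries p n g ψ ζ

/-- The integral `∫ w(x) χ^{p,k}(G(x)) dμ(x)`, `k = n/2`, against the character of the principal
series. The representation is infinite dimensional, so its character is a distribution:
the integral is the trace `∑_b ⟨b, T b⟩` of the operator `T = ∫ w(x) D^{p,k}(G(x)) dμ(x)`,
with `b` running over an orthonormal basis of the Hilbert space. -/
def characterIntegral (p : ℝ) (n : ℕ) {X : Type*} [MeasurableSpace X] (μ : Measure X)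
    (w : X → ℂ) (G : X → SL2C) : ℂ :=
  ∑' b : ((exists_hilbertBasis ℂ L2C).choose : Set L2C),
    ∫ x, w x * matrixElement p n (G x) b b ∂μ

/-! ### The Dupuis–Livine map and projected functions

A degree is a function `p : ℕ → ℝ`, where `p n` is the value at the spin `n/2`. -/

/-- The spin `j = n/2` term of the kernel: `d_j² ∫ dk χ^{p(j),j}(g k) χ^j(k h)`. -/
def kernelTerm (p : ℕ → ℝ) (n : ℕ) (g : SL2C) (h : SU2) : ℂ :=
  ((n : ℂ) + 1) ^ 2 *
    characterIntegral (p n) n haarSU2 (fun k : SU2 => chiSU2 n (k * h)) (fun k => g * (k : SL2C))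

/-- Projected functions of degree `p`: `ψ(g) = ∫ dh K(g,h) ψ(h)`. The kernel `K = ∑_j K_j`
is a distribution, which acts as the (absolutely convergent) sum of its terms. -/
def IsProjected (p : ℕ → ℝ) (ψ : SL2C → ℂ) : Prop :=
  ∀ g : SL2C,
    (∀ n, Integrable (fun h : SU2 => kernelTerm p n g h * ψ (h : SL2C)) haarSU2) ∧
    HasSum (fun n : ℕ => ∫ h : SU2, kernelTerm p n g h * ψ (h : SL2C) ∂haarSU2) (ψ g)

section Tensor

variable {L : Type*} [Fintype L]

/-- The component of `⊗_l f` with spin `i l / 2` on the link `l`. -/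
def dupuisLivineTerm (p : ℕ → ℝ) (ψ : (L → SU2) → ℂ) (g : L → SL2C) (i : L → ℕ) : ℂ :=
  ∫ h : L → SU2, (∏ l, kernelTerm p (i l) (g l) (h l)) * ψ h ∂(Measure.pi fun _ : L => haarSU2)

/-- The integrals and the sum over spins in `((⊗_l f) ψ)(g)` converge absolutely. -/
def DupuisLivineConverges (p : ℕ → ℝ) (ψ : (L → SU2) → ℂ) (g : L → SL2C) : Prop :=
  (∀ i : L → ℕ, Integrable (fun h : L → SU2 => (∏ l, kernelTerm p (i l) (g l) (h l)) * ψ h)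
    (Measure.pi fun _ : L => haarSU2)) ∧
  Summable (dupuisLivineTerm p ψ g)

/-- The Dupuis–Livine map applied on every link, `(⊗_l f) ψ`. -/
def dupuisLivine (p : ℕ → ℝ) (ψ : (L → SU2) → ℂ) (g : L → SL2C) : ℂ :=
  ∑' i : L → ℕ, dupuisLivineTerm p ψ g i

end Tensor

/-! ### Two-complexes with boundary -/

/-- A combinatorial two-complex bounded by a graph: bulk vertices `V`, bulk (internal) edges `E`,
faces `F`, and a boundary graph with nodes `N` and links `L` (the boundary edges). -/
structure TwoComplex (V N E L F : Type*) where
  /-- source of a bulk edge -/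
  src : E → V ⊕ N
  /-- target of a bulk edge -/
  tgt : E → V ⊕ N
  /-- source of a boundary link -/
  linkSrc : L → N
  /-- target of a boundary link -/
  linkTgt : L → N
  /-- number of sides of a face -/
  len : F → ℕ
  len_pos : ∀ f, 0 < len f
  /-- the sides of a face in cyclic order; the Boolean is `true` if the orientations of the edge
  and of the face agree (`ε = 1`) and `false` otherwise (`ε = -1`) -/
  side : ∀ f, Fin (len f) → (E ⊕ L) × Bool
  /-- the boundary of a face is a closed path: each side ends where the next one begins -/
  closed : ∀ f i,
    (let s := side f i
     if s.2 then Sum.elim tgt (fun l => Sum.inr (linkTgt l)) s.1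
      else Sum.elim src (fun l => Sum.inr (linkSrc l)) s.1) =
    (let s := side f (finRotate (len f) i)
     if s.2 then Sum.elim src (fun l => Sum.inr (linkSrc l)) s.1
      else Sum.elim tgt (fun l => Sum.inr (linkTgt l)) s.1)
  /-- every boundary link bounds exactly one face, once -/
  link_unique : ∀ l : L, ∃! q : Σ f, Fin (len f), (side q.1 q.2).1 = Sum.inr l
  /-- every boundary node bounds exactly one bulk edge (at exactly one of its ends) -/
  node_unique : ∀ n : N, ∃! q : E × Bool, (if q.2 then tgt q.1 else src q.1) = Sum.inr n
  /-- a face leaves the boundary graph at both ends of each of its boundary links -/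
  not_link_link : ∀ f i,
    ¬ ((side f i).1.isRight = true ∧ (side f (finRotate (len f) i)).1.isRight = true)

namespace TwoComplex

variable {V N E L F : Type*} (C : TwoComplex V N E L F)

/-- The end point of a half-edge: `(e, false)` is the half of `e` at its source, `(e, true)` the
half at its target. -/
def endpoint (q : E × Bool) : V ⊕ N := if q.2 then C.tgt q.1 else C.src q.1

/-- One half-edge at each bulk vertex. The `SL(2,ℂ)` integration at that half-edge is redundant
and is dropped (its variable is set to `1`): otherwise the left translation invariance at `v`
would give the infinite volume of `SL(2,ℂ)`. -/
structure GaugeFixing where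
  /-- the chosen half-edge -/
  half : V → E × Bool
  endpoint_half : ∀ v, C.endpoint (half v) = Sum.inl v

variable {C}

/-- The half-edges carrying an integration variable `g_{ev}`: those at bulk vertices, except for
the chosen one at each vertex. There is no integration at boundary nodes. -/
def GaugeFixing.Free (φ : C.GaugeFixing) : Type _ :=
  {q : E × Bool // (∃ v, C.endpoint q = Sum.inl v) ∧ ∀ v, φ.half v ≠ q}

open Classical in
instance (φ : C.GaugeFixing) [Fintype E] : Fintype φ.Free :=
  inferInstanceAs (Fintype {q : E × Bool //
    (∃ v, C.endpoint q = Sum.inl v) ∧ ∀ v, φ.half v ≠ q})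

open Classical in
/-- The group element at a half-edge. -/
def GaugeFixing.value (φ : C.GaugeFixing) (x : φ.Free → SL2C) (q : E × Bool) : SL2C :=
  if hq : (∃ v, C.endpoint q = Sum.inl v) ∧ ∀ v, φ.half v ≠ q then x ⟨q, hq⟩ else 1

variable (C)

/-- The sides of the face `f` that are bulk edges. -/
abbrev BulkSide (f : F) : Type := {i : Fin (C.len f) // (C.side f i).1.isLeft = true}

variable {C}

/-- The group element `g_{ef}` of the side `i` of the face `f`, with bulk variables `x`, boundary
data `g` and `SU(2)` variables `h_{ef}`: `g_{e s_e} h_{ef} g_{e t_e}⁻¹` for a bulk edge `e` and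
`g_l` for a boundary link `l`. -/
def sideElement (φ : C.GaugeFixing) (x : φ.Free → SL2C) (g : L → SL2C) (f : F)
    (h : C.BulkSide f → SU2) (i : Fin (C.len f)) : SL2C :=
  match hs : (C.side f i).1 with
  | Sum.inl e => φ.value x (e, false) * (h ⟨i, by simp [hs]⟩ : SL2C) * (φ.value x (e, true))⁻¹
  | Sum.inr l => g l

/-- The ordered product `∏_{e ∈ ∂f} g_{ef}^{ε_{ef}}`. -/
def faceHolonomy (φ : C.GaugeFixing) (x : φ.Free → SL2C) (g : L → SL2C) (f : F)
    (h : C.BulkSide f → SU2) : SL2C :=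
  (List.ofFn fun i : Fin (C.len f) =>
    if (C.side f i).2 then sideElement φ x g f h i else (sideElement φ x g f h i)⁻¹).prod

/-- The factor of the face `f` with spin `j = n/2`:
`d_j ∫ dh_{ef} χ^{γj,j}(∏_{e ∈ ∂f} g_{ef}^{ε_{ef}}) ∏_{e ∈ ∂f} χ^j(h_{ef})`. -/
def faceFactor (γ : ℝ) (φ : C.GaugeFixing) (x : φ.Free → SL2C) (g : L → SL2C) (f : F)
    (n : ℕ) : ℂ :=
  ((n : ℂ) + 1) *
    characterIntegral (γ * ((n : ℝ) / 2)) n (Measure.pi fun _ : C.BulkSide f => haarSU2)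
      (fun h => ∏ i, chiSU2 n (h i)) (faceHolonomy φ x g f)

section Amplitude

variable [Fintype E] [Fintype F]

/-- The term of the amplitude with spin `j f / 2` on the face `f`, as a function of `SL(2,ℂ)`
boundary data; `ν` is the Haar measure of `SL(2,ℂ)`. -/
def spinTerm (γ : ℝ) (ν : Measure SL2C) (φ : C.GaugeFixing) (j : F → ℕ) (g : L → SL2C) : ℂ :=
  ∫ x : φ.Free → SL2C, ∏ f, faceFactor γ φ x g f (j f) ∂(Measure.pi fun _ : φ.Free => ν)

/-- The amplitude `Z̃_C(g_l)` with `SL(2,ℂ)` boundary data. -/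
def amplitudeSL2C (γ : ℝ) (ν : Measure SL2C) (φ : C.GaugeFixing) (g : L → SL2C) : ℂ :=
  ∑' j : F → ℕ, spinTerm γ ν φ j g

/-- The amplitude `Z_C(h_l)`: the same expression with `SU(2)` boundary data. -/
def amplitude (γ : ℝ) (ν : Measure SL2C) (φ : C.GaugeFixing) (h : L → SU2) : ℂ :=
  amplitudeSL2C γ ν φ fun l => (h l : SL2C)

open Classical in
/-- The expression that defines the amplitude is absolutely convergent: the `SL(2,ℂ)` integrals
converge for all spins, and the sum over the spins converges, for all boundary data and also
after any set `S` of boundary entries is integrated over `SU(2)`. -/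
structure Converges [Fintype L] (γ : ℝ) (ν : Measure SL2C) (φ : C.GaugeFixing) : Prop where
  integrable : ∀ (j : F → ℕ) (g : L → SL2C),
    Integrable (fun x : φ.Free → SL2C => ∏ f, faceFactor γ φ x g f (j f))
      (Measure.pi fun _ : φ.Free => ν)
  summable : ∀ (g : L → SL2C) (S : Set L),
    ∑' j : F → ℕ, ∫⁻ h : L → SU2,
      ‖spinTerm γ ν φ j (fun l => if l ∈ S then (h l : SL2C) else g l)‖ₑ
        ∂(Measure.pi fun _ : L => haarSU2) < ⊤

end Amplitude

end TwoComplex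

end Spinfoam

end

open MeasureTheory
open scoped ComplexConjugate ENNReal

noncomputable section

namespace Spinfoam

/-! ### The group `SU(2)` -/

/-! Let P be the orthogonal projection onto the minimal SU(2)-type, of spin j, of D^{γj,j}. Spin j
occurs there with multiplicity one, so P is the isotypic projection d_j ∫ χ^j(k) D(k) dk
(`integral_chiSU2_ps`). This identity is used twice.

On the kernel side, a translation of k gives K_j(g,h) = d_j tr(D(g) P D(h⁻¹)), a finite sum of
products of matrix coefficients ⟨e_a, D(·) e_b⟩ between vectors of the minimal type
(`kernelTerm_eq`). Schur orthogonality on SU(2) then shows that K_j recovers such a coefficient on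
all of SL(2,ℂ) from its values on SU(2), and annihilates the coefficients of every other spin
(`integral_kernelTerm_mul`).

On the amplitude side, integrating out h_{ef} turns each bulk side into d_j⁻¹ D(a) P D(b), so a face
factor is the trace of a cyclic product of operators (`faceFactor_eq`). The half-edge elements at
nodes are 1, so the operator D(g_l^{±1}) of a link has a P on both sides. The face factor is
therefore a matrix coefficient of the minimal type in g_l (`faceFactor_update_mem`); negative
orientation is covered because inversion preserves the space of these coefficients
(`inv_mem_ktSpace`). That space is finite dimensional, so the integral over the g_{ev} stays in it
(`spinTerm_update_mem`).

Hence, for fixed face spins, the kernel on a link acts as the identity if its spin is that of the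
face of the link, and as zero otherwise. For all links together, membership in a finite-dimensional
space in each variable separately gives a sum of products (`mem_span_prod_of_forall_update`,
`integral_prod_kernelTerm_mul`). Absolute convergence lets the bounded kernel act under the sum over
face spins, and that sum is regrouped by the induced link spins (`hasSum_of_fiberwise`). -/

instance : SecondCountableTopology SL2C := by
  have : SecondCountableTopology (Matrix (Fin 2) (Fin 2) ℂ) :=
    inferInstanceAs (SecondCountableTopology (Fin 2 → Fin 2 → ℂ))
  exact Topology.IsEmbedding.secondCountableTopology
    (Matrix.SpecialLinearGroup.isClosedEmbedding_val (n := Fin 2) (R := ℂ)).isEmbedding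

instance : haarSU2.IsHaarMeasure := by unfold haarSU2; infer_instance

instance : IsProbabilityMeasure haarSU2 :=
  ⟨by simpa [haarSU2] using
    Measure.haarMeasure_self (G := SU2) (K₀ := (⊤ : TopologicalSpace.PositiveCompacts SU2))⟩

/-- On a compact group a left invariant probability measure is the Haar probability measure. -/
lemma eq_haarSU2 (μ : Measure SU2) [IsProbabilityMeasure μ] [μ.IsMulLeftInvariant] :
    μ = haarSU2 := by
  have h := Measure.isMulInvariant_eq_smul_of_compactSpace μ haarSU2
  have h1 := congrArg (fun m : Measure SU2 => m Set.univ) h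
  simp only [measure_univ, Measure.smul_apply] at h1
  rw [h]
  have h2 : Measure.haarScalarFactor μ haarSU2 = 1 := by
    have : (1 : ℝ≥0∞) = (Measure.haarScalarFactor μ haarSU2 : ℝ≥0∞) := by
      simpa [ENNReal.smul_def] using h1
    exact_mod_cast this.symm
  rw [h2, one_smul]

instance : haarSU2.IsMulRightInvariant := ⟨fun g => by
  have : IsProbabilityMeasure (Measure.map (· * g) haarSU2) :=
    Measure.isProbabilityMeasure_map (measurable_mul_const g).aemeasurable
  exact eq_haarSU2 _⟩

instance : haarSU2.IsInvInvariant := ⟨by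
  have : IsProbabilityMeasure haarSU2.inv :=
    Measure.isProbabilityMeasure_map measurable_inv.aemeasurable
  exact eq_haarSU2 _⟩

lemma continuous_entry (i j : Fin 2) : Continuous fun g : SL2C => g i j :=
  (continuous_apply_apply i j).comp
    (Matrix.SpecialLinearGroup.isClosedEmbedding_val (n := Fin 2) (R := ℂ)).continuous

lemma SL2C.det_eq (g : SL2C) : g 0 0 * g 1 1 - g 0 1 * g 1 0 = 1 := by
  have := g.det_coe
  rwa [Matrix.det_fin_two] at this

lemma SL2C.ext_entries {g h : SL2C} (h00 : g 0 0 = h 0 0) (h01 : g 0 1 = h 0 1)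
    (h10 : g 1 0 = h 1 0) (h11 : g 1 1 = h 1 1) : g = h := by
  ext i j
  fin_cases i <;> fin_cases j <;> assumption

lemma SL2C.mul_entry (g h : SL2C) (i j : Fin 2) :
    (g * h) i j = g i 0 * h 0 j + g i 1 * h 1 j := by
  rw [Matrix.SpecialLinearGroup.coe_mul, Matrix.mul_apply, Fin.sum_univ_two]

lemma SL2C.inv_00 (g : SL2C) : g⁻¹ 0 0 = g 1 1 := by
  rw [Matrix.SpecialLinearGroup.SL2_inv_expl]; rfl

lemma SL2C.inv_01 (g : SL2C) : g⁻¹ 0 1 = -g 0 1 := by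
  rw [Matrix.SpecialLinearGroup.SL2_inv_expl]; rfl

lemma SL2C.inv_10 (g : SL2C) : g⁻¹ 1 0 = -g 1 0 := by
  rw [Matrix.SpecialLinearGroup.SL2_inv_expl]; rfl

lemma SL2C.inv_11 (g : SL2C) : g⁻¹ 1 1 = g 0 0 := by
  rw [Matrix.SpecialLinearGroup.SL2_inv_expl]; rfl

lemma SU2.inv_entry (k : SU2) (i j : Fin 2) :
    (k : SL2C)⁻¹ i j = conj ((k : SL2C) j i) := by
  have hk : star ((k : SL2C) : Matrix (Fin 2) (Fin 2) ℂ) * ((k : SL2C) : Matrix (Fin 2) (Fin 2) ℂ)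
      = 1 := Matrix.mem_unitaryGroup_iff'.1 k.2
  have h1 : ((k : SL2C) : Matrix (Fin 2) (Fin 2) ℂ) *
      (((k : SL2C)⁻¹ : SL2C) : Matrix (Fin 2) (Fin 2) ℂ) = 1 := by
    rw [← Matrix.SpecialLinearGroup.coe_mul, mul_inv_cancel, Matrix.SpecialLinearGroup.coe_one]
  have h3 := (left_inv_eq_right_inv hk h1).symm
  exact congrFun (congrFun h3 i) j

lemma SU2.entry_11 (k : SU2) : (k : SL2C) 1 1 = conj ((k : SL2C) 0 0) := by
  rw [← SU2.inv_entry, SL2C.inv_00]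

lemma SU2.entry_10 (k : SU2) : (k : SL2C) 1 0 = -conj ((k : SL2C) 0 1) := by
  rw [← SU2.inv_entry, SL2C.inv_10, neg_neg]

lemma SU2.norm_sq (k : SU2) : ‖(k : SL2C) 0 0‖ ^ 2 + ‖(k : SL2C) 0 1‖ ^ 2 = 1 := by
  have h := SL2C.det_eq (k : SL2C)
  rw [SU2.entry_11, SU2.entry_10, mul_neg, sub_neg_eq_add, Complex.mul_conj', Complex.mul_conj']
    at h
  exact_mod_cast h

/-- The element of `SU(2)` with first row `(α, β)`. -/
def mkSU2 (α β : ℂ) (h : ‖α‖ ^ 2 + ‖β‖ ^ 2 = 1) : SU2 :=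
  ⟨⟨!![α, β; -conj β, conj α], by
    rw [Matrix.det_fin_two_of, mul_neg, sub_neg_eq_add, Complex.mul_conj', Complex.mul_conj']
    exact_mod_cast h⟩, by
    change !![α, β; -conj β, conj α] ∈ Matrix.unitaryGroup (Fin 2) ℂ
    have h' : α * conj α + β * conj β = 1 := by
      rw [Complex.mul_conj', Complex.mul_conj']
      exact_mod_cast h
    rw [Matrix.mem_unitaryGroup_iff]
    ext i j
    fin_cases i <;> fin_cases j <;>
      simp [Matrix.mul_apply, Fin.sum_univ_two, Matrix.star_apply]
    · exact h'
    · ring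
    · ring
    · linear_combination h'⟩

@[simp] lemma mkSU2_00 (α β : ℂ) (h) : (mkSU2 α β h : SL2C) 0 0 = α := rfl
@[simp] lemma mkSU2_01 (α β : ℂ) (h) : (mkSU2 α β h : SL2C) 0 1 = β := rfl
@[simp] lemma mkSU2_10 (α β : ℂ) (h) : (mkSU2 α β h : SL2C) 1 0 = -conj β := rfl
@[simp] lemma mkSU2_11 (α β : ℂ) (h) : (mkSU2 α β h : SL2C) 1 1 = conj α := rfl

/-- The diagonal matrix `diag(t, t⁻¹)`. -/
def diagSL (t : ℂˣ) : SL2C :=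
  ⟨!![(t : ℂ), 0; 0, ((t⁻¹ : ℂˣ) : ℂ)], by simp [Matrix.det_fin_two_of]⟩

@[simp] lemma diagSL_00 (t : ℂˣ) : diagSL t 0 0 = t := rfl
@[simp] lemma diagSL_01 (t : ℂˣ) : diagSL t 0 1 = 0 := rfl
@[simp] lemma diagSL_10 (t : ℂˣ) : diagSL t 1 0 = 0 := rfl
@[simp] lemma diagSL_11 (t : ℂˣ) : diagSL t 1 1 = ((t⁻¹ : ℂˣ) : ℂ) := rfl

lemma diagSL_mul (s t : ℂˣ) : diagSL (s * t) = diagSL s * diagSL t := by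
  apply SL2C.ext_entries <;> simp [SL2C.mul_entry, mul_comm]

lemma diagSL_inv (t : ℂˣ) : diagSL t⁻¹ = (diagSL t)⁻¹ := by
  apply SL2C.ext_entries <;>
    simp [SL2C.inv_00, SL2C.inv_01, SL2C.inv_10, SL2C.inv_11]

/-- The maximal torus of `SU(2)`. -/
def torus (s : Circle) : SU2 :=
  ⟨diagSL s.toUnits, by
    have h := (mkSU2 s 0 (by simp [Circle.norm_coe])).2
    convert h using 1
    apply SL2C.ext_entries <;> simp [← Circle.coe_inv_eq_conj]⟩

@[simp] lemma coe_torus (s : Circle) : (torus s : SL2C) = diagSL s.toUnits := rfl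

/-- The Weyl element of `SU(2)`. -/
def weyl : SU2 := mkSU2 0 1 (by simp)

/-- For distinct weights there is a torus element separating them. -/
lemma exists_circle_zpow_ne {m : ℤ} (hm : m ≠ 0) : ∃ s : Circle, (s : ℂ) ^ m ≠ 1 := by
  -- The m-th power of this element is e^{iπ} = -1.
  refine ⟨Circle.exp (Real.pi / m), ?_⟩
  have hm' : (m : ℂ) ≠ 0 := by exact_mod_cast hm
  rw [Circle.coe_exp, ← Complex.exp_int_mul,
    show (m : ℂ) * (((Real.pi / m : ℝ) : ℂ) * Complex.I) = Real.pi * Complex.I by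
      push_cast; field_simp, Complex.exp_pi_mul_I]
  norm_num

/-- Unitary triangularization of a `2 × 2` matrix by an element of `SU(2)`. -/
lemma exists_triangular (A : Matrix (Fin 2) (Fin 2) ℂ) : ∃ k : SU2,
    ((((k : SL2C)⁻¹ : SL2C) : Matrix (Fin 2) (Fin 2) ℂ) * A *
      ((k : SL2C) : Matrix (Fin 2) (Fin 2) ℂ)) 1 0
      = 0 := by
  obtain ⟨c, hc⟩ := Module.End.exists_eigenvalue (Matrix.toLin' A)
  obtain ⟨v, hv, hv0⟩ := hc.exists_hasEigenvector
  have hA : A.mulVec v = c • v := by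
    rw [← Matrix.toLin'_apply]; exact Module.End.mem_eigenspace_iff.1 hv
  have h0 : A 0 0 * v 0 + A 0 1 * v 1 = c * v 0 := by
    simpa [Matrix.mulVec, dotProduct, Fin.sum_univ_two] using congrFun hA 0
  have h1 : A 1 0 * v 0 + A 1 1 * v 1 = c * v 1 := by
    simpa [Matrix.mulVec, dotProduct, Fin.sum_univ_two] using congrFun hA 1
  have hpos : 0 < ‖v 0‖ ^ 2 + ‖v 1‖ ^ 2 := by
    by_contra hn
    apply hv0
    have e0 : ‖v 0‖ = 0 := by nlinarith [sq_nonneg ‖v 0‖, sq_nonneg ‖v 1‖]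
    have e1 : ‖v 1‖ = 0 := by nlinarith [sq_nonneg ‖v 0‖, sq_nonneg ‖v 1‖]
    ext i
    fin_cases i
    · simpa using e0
    · simpa using e1
  set r : ℝ := √(‖v 0‖ ^ 2 + ‖v 1‖ ^ 2) with hr
  have hr0 : 0 < r := Real.sqrt_pos.2 hpos
  have hr2 : r ^ 2 = ‖v 0‖ ^ 2 + ‖v 1‖ ^ 2 := Real.sq_sqrt hpos.le
  -- The first column of k is the normalized eigenvector v / r; the shape of SU(2) fixes the second
  -- column.
  refine ⟨mkSU2 (v 0 / r) (-conj (v 1) / r) ?_, ?_⟩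
  · rw [norm_div, norm_div, norm_neg, RCLike.norm_conj, Complex.norm_real, Real.norm_of_nonneg hr0.le,
      div_pow, div_pow, ← add_div, hr2, div_self hpos.ne']
  · set k := mkSU2 (v 0 / r) (-conj (v 1) / r) _
    simp only [Matrix.mul_apply, Fin.sum_univ_two]
    change ((k : SL2C)⁻¹ 1 0 * A 0 0 + (k : SL2C)⁻¹ 1 1 * A 1 0) * (k : SL2C) 0 0
      + ((k : SL2C)⁻¹ 1 0 * A 0 1 + (k : SL2C)⁻¹ 1 1 * A 1 1) * (k : SL2C) 1 0 = 0
    rw [SL2C.inv_10, SL2C.inv_11]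
    simp only [k, mkSU2_00, mkSU2_10, map_div₀, map_neg, Complex.conj_conj, Complex.conj_ofReal]
    linear_combination (-(v 1) / (r : ℂ) / r) * h0 + (v 0 / (r : ℂ) / r) * h1

/-- Every element of `SU(2)` is conjugate to an element of the torus. -/
lemma exists_eq_conj_torus (h : SU2) : ∃ (k : SU2) (s : Circle), h = k * torus s * k⁻¹ := by
  obtain ⟨k, hk⟩ := exists_triangular (h : SL2C)
  rw [← Matrix.SpecialLinearGroup.coe_mul, ← Matrix.SpecialLinearGroup.coe_mul] at hk
  set q : SU2 := k⁻¹ * h * k with hq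
  have hq10 : (q : SL2C) 1 0 = 0 := hk
  have hq01 : (q : SL2C) 0 1 = 0 := by
    rw [SU2.entry_10, neg_eq_zero] at hq10
    simpa using hq10
  have hn : ‖(q : SL2C) 0 0‖ = 1 := by
    have := SU2.norm_sq q
    rw [hq01, norm_zero] at this
    nlinarith [norm_nonneg ((q : SL2C) 0 0)]
  obtain ⟨s, hs⟩ : ∃ s : Circle, (s : ℂ) = (q : SL2C) 0 0 :=
    ⟨⟨(q : SL2C) 0 0, by simpa [Submonoid.unitSphere] using hn⟩, rfl⟩
  have hqs : q = torus s := by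
    apply Subtype.ext
    apply SL2C.ext_entries
    · simp [hs]
    · simp [hq01]
    · simp [hq10]
    · simp [SU2.entry_11, ← hs, ← Circle.coe_inv_eq_conj]
  refine ⟨k, s, ?_⟩
  rw [← hqs, hq]
  group

/-- The Cartan decomposition of `SL(2,ℂ)`. -/
lemma exists_cartan (g : SL2C) : ∃ (k₁ k₂ : SU2) (t : ℂˣ),
    g = (k₁ : SL2C) * diagSL t * (k₂ : SL2C) := by
  -- Triangularizing g*g makes the two columns of m = g k orthogonal. Normalizing the first column
  -- leaves diag(r, r⁻¹), because det m = 1 fixes the second column.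
  obtain ⟨k, hk⟩ := exists_triangular
    (star (g : Matrix (Fin 2) (Fin 2) ℂ) * (g : Matrix (Fin 2) (Fin 2) ℂ))
  set m : SL2C := g * (k : SL2C) with hm
  have hk' : conj (m 0 1) * m 0 0 + conj (m 1 1) * m 1 0 = 0 := by
    have h1 : (((k : SL2C)⁻¹ : SL2C) : Matrix (Fin 2) (Fin 2) ℂ)
        = star ((k : SL2C) : Matrix (Fin 2) (Fin 2) ℂ) := by
      ext i j; exact SU2.inv_entry k i j
    have h2 : (((k : SL2C)⁻¹ : SL2C) : Matrix (Fin 2) (Fin 2) ℂ) *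
        (star (g : Matrix (Fin 2) (Fin 2) ℂ) * (g : Matrix (Fin 2) (Fin 2) ℂ)) *
          ((k : SL2C) : Matrix _ _ ℂ)
        = star (m : Matrix (Fin 2) (Fin 2) ℂ) * (m : Matrix (Fin 2) (Fin 2) ℂ) := by
      rw [h1, hm, Matrix.SpecialLinearGroup.coe_mul, star_mul]
      simp only [mul_assoc]
    rw [h2, Matrix.mul_apply, Fin.sum_univ_two] at hk
    exact hk
  have hdet := SL2C.det_eq m
  have hpos : 0 < ‖m 0 0‖ ^ 2 + ‖m 1 0‖ ^ 2 := by
    by_contra hn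
    have e0 : ‖m 0 0‖ = 0 := by nlinarith [sq_nonneg ‖m 0 0‖, sq_nonneg ‖m 1 0‖]
    have e1 : ‖m 1 0‖ = 0 := by nlinarith [sq_nonneg ‖m 0 0‖, sq_nonneg ‖m 1 0‖]
    rw [norm_eq_zero] at e0 e1
    rw [e0, e1] at hdet
    simp at hdet
  set r : ℝ := √(‖m 0 0‖ ^ 2 + ‖m 1 0‖ ^ 2) with hr
  have hr0 : 0 < r := Real.sqrt_pos.2 hpos
  have hr2 : r ^ 2 = ‖m 0 0‖ ^ 2 + ‖m 1 0‖ ^ 2 := Real.sq_sqrt hpos.le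
  have hrC : (r : ℂ) ≠ 0 := by exact_mod_cast hr0.ne'
  have hr2C : m 0 0 * conj (m 0 0) + m 1 0 * conj (m 1 0) = (r : ℂ) ^ 2 := by
    rw [Complex.mul_conj', Complex.mul_conj']
    exact_mod_cast hr2.symm
  have horth : m 0 1 * conj (m 0 0) + m 1 1 * conj (m 1 0) = 0 := by
    have := congrArg conj hk'
    simpa using this
  let k₁ : SU2 := mkSU2 (m 0 0 / r) (-conj (m 1 0) / r) (by
    rw [norm_div, norm_div, norm_neg, RCLike.norm_conj, Complex.norm_real, Real.norm_of_nonneg hr0.le,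
      div_pow, div_pow, ← add_div, hr2, div_self hpos.ne'])
  have key : m = (k₁ : SL2C) * diagSL (Units.mk0 (r : ℂ) hrC) := by
    apply SL2C.ext_entries <;>
      simp [SL2C.mul_entry, k₁, hrC]
    · field_simp
      linear_combination -(m 0 1) * hr2C + m 0 0 * horth - conj (m 1 0) * hdet
    · field_simp
      linear_combination -(m 1 1) * hr2C + m 1 0 * horth + conj (m 0 0) * hdet
  refine ⟨k₁, k⁻¹, Units.mk0 (r : ℂ) hrC, ?_⟩
  rw [← key, hm]
  simp

/-! ### Matrices of the spin representations -/

/-- The exponent of the monomial `X₀ⁿ⁻ᵇ X₁ᵇ`. -/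
def spinExponent (n : ℕ) (b : Fin (n + 1)) : Fin 2 →₀ ℕ :=
  Finsupp.single 0 (n - b) + Finsupp.single 1 (b : ℕ)

lemma spinExponent_zero (n : ℕ) (b : Fin (n + 1)) : spinExponent n b 0 = n - b := by
  simp [spinExponent]

lemma spinExponent_one (n : ℕ) (b : Fin (n + 1)) : spinExponent n b 1 = b := by
  simp [spinExponent]

lemma spinExponent_degree (n : ℕ) (b : Fin (n + 1)) : (spinExponent n b).degree = n := by
  rw [Finsupp.degree_eq_sum, Fin.sum_univ_two, spinExponent_zero, spinExponent_one]
  omega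

lemma spinExponent_injective (n : ℕ) : Function.Injective (spinExponent n) := by
  intro a b h
  have := DFunLike.congr_fun h 1
  rw [spinExponent_one, spinExponent_one] at this
  exact Fin.ext this

lemma exists_spinExponent {n : ℕ} {d : Fin 2 →₀ ℕ} (hd : d.degree = n) :
    ∃ b, spinExponent n b = d := by
  rw [Finsupp.degree_eq_sum, Fin.sum_univ_two] at hd
  refine ⟨⟨d 1, by omega⟩, ?_⟩
  ext i
  fin_cases i
  · change spinExponent n _ 0 = d 0
    rw [spinExponent_zero]
    change n - d 1 = d 0
    omega
  · change spinExponent n _ 1 = d 1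
    rw [spinExponent_one]

/-- The monomial basis of the spin `n/2` representation space. -/
def spinBasis (n : ℕ) :
    Module.Basis (Fin (n + 1)) ℂ (MvPolynomial.homogeneousSubmodule (Fin 2) ℂ n) :=
  Module.Basis.ofEquivFun
    { toFun := fun P b => MvPolynomial.coeff (spinExponent n b) P.1
      invFun := fun c => ⟨∑ b, MvPolynomial.monomial (spinExponent n b) (c b),
        Submodule.sum_mem _ fun b _ =>
          MvPolynomial.isHomogeneous_monomial _ (spinExponent_degree n b)⟩
      map_add' := fun P Q => by ext b; simp
      map_smul' := fun c P => by ext b; simp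
      left_inv := fun P => by
        apply Subtype.ext
        ext d
        rw [MvPolynomial.coeff_sum]
        simp only [MvPolynomial.coeff_monomial]
        by_cases hd : d.degree = n
        · obtain ⟨b, rfl⟩ := exists_spinExponent hd
          rw [Finset.sum_eq_single b]
          · simp
          · intro b' _ hb'
            rw [if_neg fun h => hb' (spinExponent_injective n h)]
          · simp
        · rw [Finset.sum_eq_zero]
          · by_contra hc
            exact hd ((MvPolynomial.mem_homogeneousSubmodule n P.1).1 P.2
              (fun h => hc h.symm) |> fun h => by
                rw [← h, Finsupp.degree_eq_weight_one]; rfl)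
          · intro b _
            rw [if_neg]
            rintro rfl
            exact hd (spinExponent_degree n b)
      right_inv := fun c => by
        ext b
        simp only [MvPolynomial.coeff_sum, MvPolynomial.coeff_monomial]
        rw [Finset.sum_eq_single b]
        · simp
        · intro b' _ hb'
          rw [if_neg fun h => hb' (spinExponent_injective n h)]
        · simp }

lemma coe_spinBasis (n : ℕ) (b : Fin (n + 1)) :
    (spinBasis n b : MvPolynomial (Fin 2) ℂ) = MvPolynomial.monomial (spinExponent n b) 1 := by
  rw [spinBasis, Module.Basis.coe_ofEquivFun]
  change ∑ b', MvPolynomial.monomial (spinExponent n b') ((Pi.single b 1 : _ → ℂ) b') = _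
  rw [Finset.sum_eq_single b]
  · simp
  · intro b' _ hb'
    simp [hb']
  · simp

/-- The matrix of the spin `n/2` representation in the basis `X₀ⁿ⁻ᵇ X₁ᵇ`. -/
def spinMatrix (n : ℕ) (k : SU2) : Matrix (Fin (n + 1)) (Fin (n + 1)) ℂ :=
  LinearMap.toMatrix (spinBasis n) (spinBasis n) (spinRep n k)

lemma spinMatrix_one (n : ℕ) : spinMatrix n 1 = 1 := by
  rw [spinMatrix, map_one]
  exact LinearMap.toMatrix_one _

lemma spinMatrix_mul (n : ℕ) (k h : SU2) :
    spinMatrix n (k * h) = spinMatrix n k * spinMatrix n h := by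
  rw [spinMatrix, map_mul]
  exact LinearMap.toMatrix_mul _ _ _

lemma chiSU2_eq_trace (n : ℕ) (k : SU2) : chiSU2 n k = (spinMatrix n k).trace :=
  LinearMap.trace_eq_matrix_trace ℂ (spinBasis n) _

lemma chiSU2_eq_sum (n : ℕ) (k : SU2) : chiSU2 n k = ∑ a, spinMatrix n k a a :=
  chiSU2_eq_trace n k

/-- The columns of the spin matrices, in terms of values of polynomials. -/
lemma spinMatrix_eval (n : ℕ) (k : SU2) (b : Fin (n + 1)) (x y : ℂ) :
    ∑ a, spinMatrix n k a b * (x ^ (n - a : ℕ) * y ^ (a : ℕ)) =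
      (x * (k : SL2C) 0 0 + y * (k : SL2C) 1 0) ^ (n - b : ℕ) *
        (x * (k : SL2C) 0 1 + y * (k : SL2C) 1 1) ^ (b : ℕ) := by
  have hev : ∀ a, MvPolynomial.eval ![x, y] (spinBasis n a : MvPolynomial (Fin 2) ℂ) =
      x ^ (n - a : ℕ) * y ^ (a : ℕ) := by
    intro a
    rw [coe_spinBasis, MvPolynomial.eval_monomial, Finsupp.prod_fintype _ _ (by simp),
      Fin.prod_univ_two, spinExponent_zero, spinExponent_one]
    simp
  have h1 : spinRep n k (spinBasis n b) = ∑ a, spinMatrix n k a b • spinBasis n a := by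
    have := (spinBasis n).sum_repr (spinRep n k (spinBasis n b))
    rw [← this]
    simp [spinMatrix, LinearMap.toMatrix_apply]
  have h2 := congrArg (fun P : MvPolynomial.homogeneousSubmodule (Fin 2) ℂ n =>
    MvPolynomial.eval ![x, y] (P : MvPolynomial (Fin 2) ℂ)) h1
  simp only [Submodule.coe_sum, Submodule.coe_smul, map_sum, MvPolynomial.smul_eval, hev] at h2
  rw [← h2]
  change MvPolynomial.eval ![x, y] (linearSubst ((k : SL2C) : Matrix (Fin 2) (Fin 2) ℂ)
    (spinBasis n b : MvPolynomial (Fin 2) ℂ)) = _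
  rw [coe_spinBasis, linearSubst, MvPolynomial.aeval_monomial, Finsupp.prod_fintype _ _ (by simp),
    Fin.prod_univ_two, spinExponent_zero, spinExponent_one]
  simp only [map_one, one_mul, map_mul, map_pow, Fin.sum_univ_two, map_add, MvPolynomial.eval_C,
    MvPolynomial.eval_X, Matrix.cons_val_zero, Matrix.cons_val_one]
  ring

/-- Coefficients of a polynomial are determined by its values at natural numbers. -/
lemma coeff_unique {n : ℕ} {c d : Fin (n + 1) → ℂ}
    (h : ∀ y : ℕ, ∑ a, c a * (y : ℂ) ^ (a : ℕ) = ∑ a, d a * (y : ℂ) ^ (a : ℕ)) : c = d := by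
  -- The n + 1 values at 0, …, n already determine the coefficients, by Vandermonde.
  have hV : (Matrix.vandermonde fun i : Fin (n + 1) => ((i : ℕ) : ℂ)).det ≠ 0 := by
    rw [Matrix.det_vandermonde_ne_zero_iff]
    intro i j hij
    exact Fin.ext (Nat.cast_injective (R := ℂ) hij)
  apply Matrix.mulVec_injective_of_isUnit ((Matrix.isUnit_iff_isUnit_det _).2 hV.isUnit)
  ext i
  simpa [Matrix.mulVec, dotProduct, Matrix.vandermonde_apply, mul_comm] using h i

/-- Inverting the Vandermonde system of `spinMatrix_eval` at the points (1, i) writes each entry as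
a polynomial in the entries of k. -/
lemma continuous_spinMatrix (n : ℕ) (a b : Fin (n + 1)) :
    Continuous fun k : SU2 => spinMatrix n k a b := by
  set A : Matrix (Fin (n + 1)) (Fin (n + 1)) ℂ :=
    Matrix.vandermonde fun i : Fin (n + 1) => ((i : ℕ) : ℂ) with hA
  have hV : A.det ≠ 0 := by
    rw [hA, Matrix.det_vandermonde_ne_zero_iff]
    intro i j hij
    exact Fin.ext (Nat.cast_injective (R := ℂ) hij)
  have h1 : ∀ k : SU2, spinMatrix n k a b = ∑ i, A⁻¹ a i *
      (((k : SL2C) 0 0 + (i : ℕ) * (k : SL2C) 1 0) ^ (n - b : ℕ) *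
        ((k : SL2C) 0 1 + (i : ℕ) * (k : SL2C) 1 1) ^ (b : ℕ)) := by
    intro k
    have h2 : A * spinMatrix n k = Matrix.of fun (i b : Fin (n + 1)) =>
      (((k : SL2C) 0 0 + (i : ℕ) * (k : SL2C) 1 0) ^ (n - b : ℕ) *
        ((k : SL2C) 0 1 + (i : ℕ) * (k : SL2C) 1 1) ^ (b : ℕ)) := by
      ext i b
      have := spinMatrix_eval n k b 1 ((i : ℕ) : ℂ)
      simp only [one_pow, one_mul] at this
      rw [Matrix.of_apply, ← this, Matrix.mul_apply]
      simp [hA, Matrix.vandermonde_apply, mul_comm]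
    have h3 : spinMatrix n k = A⁻¹ * (A * spinMatrix n k) := by
      rw [Matrix.nonsing_inv_mul_cancel_left _ _ hV.isUnit]
    rw [h3, h2, Matrix.mul_apply]
    rfl
  simp only [h1]
  have hc : ∀ i j, Continuous fun k : SU2 => (k : SL2C) i j :=
    fun i j => (continuous_entry i j).comp continuous_subtype_val
  fun_prop

lemma continuous_chiSU2 (n : ℕ) : Continuous (chiSU2 n) := by
  rw [funext (chiSU2_eq_sum n)]
  exact continuous_finsetSum _ fun a _ => continuous_spinMatrix n a a

lemma spinMatrix_row_zero (n : ℕ) (k : SU2) (b : Fin (n + 1)) :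
    spinMatrix n k 0 b = (k : SL2C) 0 0 ^ (n - b : ℕ) * (k : SL2C) 0 1 ^ (b : ℕ) := by
  have h := spinMatrix_eval n k b 1 0
  rw [Finset.sum_eq_single 0] at h
  · simpa using h
  · intro a _ ha
    have : (a : ℕ) ≠ 0 := fun h => ha (Fin.ext h)
    simp [this]
  · simp

lemma spinMatrix_col_zero (n : ℕ) (k : SU2) (a : Fin (n + 1)) :
    spinMatrix n k a 0 = (n.choose a : ℂ) * (k : SL2C) 0 0 ^ (n - a : ℕ) *
      (k : SL2C) 1 0 ^ (a : ℕ) := by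
  refine congrFun (coeff_unique (c := fun a => spinMatrix n k a 0)
    (d := fun a => (n.choose a : ℂ) * (k : SL2C) 0 0 ^ (n - a : ℕ) * (k : SL2C) 1 0 ^ (a : ℕ))
    fun y => ?_) a
  have h := spinMatrix_eval n k 0 1 y
  simp only [one_pow, one_mul, Fin.val_zero, pow_zero, mul_one, Nat.sub_zero] at h
  rw [h, add_comm, add_pow, Finset.sum_range]
  refine Finset.sum_congr rfl fun a _ => ?_
  rw [mul_pow]
  ring

lemma spinMatrix_torus (n : ℕ) (s : Circle) :
    spinMatrix n (torus s) =
      Matrix.diagonal fun b : Fin (n + 1) => (s : ℂ) ^ ((n : ℤ) - 2 * (b : ℕ)) := by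
  ext a b
  refine congrFun (coeff_unique (c := fun a => spinMatrix n (torus s) a b)
    (d := fun a => Matrix.diagonal (fun b : Fin (n + 1) => (s : ℂ) ^ ((n : ℤ) - 2 * (b : ℕ))) a b)
    fun y => ?_) a
  have h := spinMatrix_eval n (torus s) b 1 y
  simp only [one_pow, one_mul] at h
  rw [h, Finset.sum_eq_single b]
  · have hs : (s : ℂ) ≠ 0 := s.coe_ne_zero
    have hb : (b : ℕ) ≤ n := Nat.lt_succ_iff.1 b.2
    simp only [coe_torus, diagSL_00, diagSL_01, diagSL_10, diagSL_11, Matrix.diagonal_apply_eq,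
      Circle.toUnits_apply, Units.val_mk0, Units.val_inv_eq_inv_val, mul_zero, add_zero, zero_add, mul_pow,
      inv_pow]
    have e : (s : ℂ) ^ ((n : ℤ) - 2 * (b : ℕ)) = (s : ℂ) ^ (n - b : ℕ) * ((s : ℂ) ^ (b : ℕ))⁻¹ := by
      rw [← zpow_natCast, ← zpow_natCast, ← zpow_neg, ← zpow_add₀ hs]
      congr 1
      omega
    rw [e]
    ring
  · intro a _ hab
    simp [hab]
  · simp

/-- The complex conjugate of an element of `SU(2)`. -/
def conjSU2 (k : SU2) : SU2 := weyl⁻¹ * k * weyl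

lemma conjSU2_entry (k : SU2) (i j : Fin 2) :
    (conjSU2 k : SL2C) i j = conj ((k : SL2C) i j) := by
  fin_cases i <;> fin_cases j <;>
    simp [conjSU2, SL2C.mul_entry, SL2C.inv_00, SL2C.inv_01, SL2C.inv_10, SL2C.inv_11, weyl,
      SU2.entry_11 k, SU2.entry_10 k]

/-- The entries of the spin matrix are determined by `spinMatrix_eval` at the real points (1, y),
and complex conjugation there only conjugates the entries of k. -/
lemma spinMatrix_conj (n : ℕ) (k : SU2) (a b : Fin (n + 1)) :
    conj (spinMatrix n k a b) = spinMatrix n (conjSU2 k) a b := by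
  refine congrFun (coeff_unique (c := fun a => conj (spinMatrix n k a b))
    (d := fun a => spinMatrix n (conjSU2 k) a b) fun y => ?_) a
  have h := congrArg conj (spinMatrix_eval n k b 1 y)
  have h' := spinMatrix_eval n (conjSU2 k) b 1 y
  simp only [one_pow, one_mul] at h h'
  rw [h']
  simpa [conjSU2_entry] using h

lemma chiSU2_conj_inv (n : ℕ) (k h : SU2) : chiSU2 n (k * h * k⁻¹) = chiSU2 n h := by
  rw [chiSU2_eq_trace, chiSU2_eq_trace, spinMatrix_mul, Matrix.trace_mul_comm, ← spinMatrix_mul]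
  congr 2
  group

lemma chiSU2_torus (n : ℕ) (s : Circle) :
    chiSU2 n (torus s) = ∑ b : Fin (n + 1), (s : ℂ) ^ ((n : ℤ) - 2 * (b : ℕ)) := by
  rw [chiSU2_eq_trace, spinMatrix_torus, Matrix.trace_diagonal]

lemma chiSU2_torus_inv (n : ℕ) (s : Circle) : chiSU2 n (torus s)⁻¹ = chiSU2 n (torus s) := by
  have h : (torus s)⁻¹ = torus s⁻¹ := by
    apply Subtype.ext
    change (diagSL s.toUnits)⁻¹ = diagSL (Circle.toUnits s⁻¹)
    rw [map_inv, diagSL_inv]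
  rw [h, chiSU2_torus, chiSU2_torus, ← Equiv.sum_comp Fin.revPerm]
  refine Finset.sum_congr rfl fun b _ => ?_
  rw [Circle.coe_inv, inv_zpow', Fin.revPerm_apply, Fin.val_rev]
  congr 1
  omega

/-- By conjugation the claim reduces to the torus, where the weights n - 2b are symmetric about 0.
-/
lemma chiSU2_inv (n : ℕ) (k : SU2) : chiSU2 n k⁻¹ = chiSU2 n k := by
  obtain ⟨q, s, rfl⟩ := exists_eq_conj_torus k
  have : (q * torus s * q⁻¹)⁻¹ = q * (torus s)⁻¹ * q⁻¹ := by group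
  rw [this, chiSU2_conj_inv, chiSU2_conj_inv, chiSU2_torus_inv]

/-! ### Schur orthogonality -/

/-- The torus is diagonal in both representations, so an intertwiner couples only equal weights. -/
lemma weight_vanish {n n' : ℕ} {S : Matrix (Fin (n + 1)) (Fin (n' + 1)) ℂ}
    (hS : ∀ k, spinMatrix n k * S = S * spinMatrix n' k) {a : Fin (n + 1)} {b : Fin (n' + 1)}
    (hab : (n : ℤ) - 2 * (a : ℕ) ≠ (n' : ℤ) - 2 * (b : ℕ)) : S a b = 0 := by
  obtain ⟨s, hs⟩ := exists_circle_zpow_ne (sub_ne_zero.2 hab)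
  have h := congrFun (congrFun (hS (torus s)) a) b
  rw [spinMatrix_torus, spinMatrix_torus, Matrix.diagonal_mul, Matrix.mul_diagonal] at h
  by_contra hne
  apply hs
  have h0 : (s : ℂ) ≠ 0 := s.coe_ne_zero
  rw [zpow_sub₀ h0, div_eq_one_iff_eq (zpow_ne_zero _ h0)]
  rw [mul_comm] at h
  exact mul_left_cancel₀ hne h

/-- An element of `SU(2)` without zero entries. -/
def genericSU2 : SU2 := mkSU2 (3 / 5) (4 / 5) (by norm_num)

lemma spinMatrix_generic_row (n : ℕ) (b : Fin (n + 1)) : spinMatrix n genericSU2 0 b ≠ 0 := by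
  rw [spinMatrix_row_zero]
  simp [genericSU2]

lemma spinMatrix_generic_col (n : ℕ) (a : Fin (n + 1)) : spinMatrix n genericSU2 a 0 ≠ 0 := by
  rw [spinMatrix_col_zero]
  have : n.choose a ≠ 0 := (Nat.choose_pos (Nat.lt_succ_iff.1 a.2)).ne'
  simp [genericSU2, this]

/-- The weights of one spin are distinct, which makes S diagonal. Column 0 of the relation at
`genericSU2`, whose spin matrix has no zero in that column, then equates all diagonal entries. This
takes the place of an irreducibility argument. -/
lemma schur_self {n : ℕ} {S : Matrix (Fin (n + 1)) (Fin (n + 1)) ℂ}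
    (hS : ∀ k, spinMatrix n k * S = S * spinMatrix n k) : S = Matrix.diagonal fun _ => S 0 0 := by
  have hoff : ∀ a b, a ≠ b → S a b = 0 := fun a b hab => weight_vanish hS (by
    intro h; apply hab; ext; omega)
  ext a b
  by_cases hab : a = b
  · subst hab
    rw [Matrix.diagonal_apply_eq]
    have h := congrFun (congrFun (hS genericSU2) a) 0
    rw [Matrix.mul_apply, Matrix.mul_apply, Finset.sum_eq_single 0, Finset.sum_eq_single a] at h
    · rw [mul_comm] at h
      exact (mul_right_cancel₀ (spinMatrix_generic_col n a) h).symm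
    · intro b _ hb; rw [hoff a b (Ne.symm hb), zero_mul]
    · simp
    · intro b _ hb; rw [hoff b 0 hb, mul_zero]
    · simp
  · rw [hoff a b hab, Matrix.diagonal_apply_ne _ hab]

/-- The larger spin has an extreme weight that the smaller one lacks. If n < n', weights kill column
0 of S, and the (0,0) entry of the relation at `genericSU2` kills row 0; the (0,b) entries then kill
the rest, since each weight occurs once per spin. If n > n', rows and columns change roles. -/
lemma schur_ne {n n' : ℕ} (hn : n ≠ n') {S : Matrix (Fin (n + 1)) (Fin (n' + 1)) ℂ}
    (hS : ∀ k, spinMatrix n k * S = S * spinMatrix n' k) : S = 0 := by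
  rcases lt_or_gt_of_ne hn with hlt | hgt
  · have hrow : ∀ b, S 0 b = 0 := by
      intro b
      by_cases hb : (n : ℤ) = (n' : ℤ) - 2 * (b : ℕ)
      · have h := congrFun (congrFun (hS genericSU2) 0) 0
        rw [Matrix.mul_apply, Matrix.mul_apply, Finset.sum_eq_zero, Finset.sum_eq_single b] at h
        · exact (mul_eq_zero.1 h.symm).resolve_right (spinMatrix_generic_col n' b)
        · intro b' _ hb'
          rw [weight_vanish hS (a := 0) (b := b'), zero_mul]
          intro h'
          apply hb'
          ext
          simp at h'
          omega
        · simp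
        · intro a _
          rw [weight_vanish hS (a := a) (b := 0), mul_zero]
          intro h'
          simp at h'
          omega
      · exact weight_vanish hS (by simpa using hb)
    ext a b
    by_cases hab : (n : ℤ) - 2 * (a : ℕ) = (n' : ℤ) - 2 * (b : ℕ)
    · have h := congrFun (congrFun (hS genericSU2) 0) b
      rw [Matrix.mul_apply, Matrix.mul_apply, Finset.sum_eq_single a, Finset.sum_eq_zero] at h
      · exact (mul_eq_zero.1 h).resolve_left (spinMatrix_generic_row n a)
      · intro c _; rw [hrow c, zero_mul]
      · intro a' _ ha'
        rw [weight_vanish hS (a := a') (b := b), mul_zero]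
        intro h'
        apply ha'
        ext
        omega
      · simp
    · exact weight_vanish hS hab
  · have hcol : ∀ a, S a 0 = 0 := by
      intro a
      by_cases ha : (n : ℤ) - 2 * (a : ℕ) = (n' : ℤ)
      · have h := congrFun (congrFun (hS genericSU2) 0) 0
        rw [Matrix.mul_apply, Matrix.mul_apply, Finset.sum_eq_single a, Finset.sum_eq_zero] at h
        · exact (mul_eq_zero.1 h).resolve_left (spinMatrix_generic_row n a)
        · intro b _
          rw [weight_vanish hS (a := 0) (b := b), zero_mul]
          intro h'
          simp at h'
          omega
        · intro a' _ ha'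
          rw [weight_vanish hS (a := a') (b := 0), mul_zero]
          intro h'
          apply ha'
          ext
          simp at h'
          omega
        · simp
      · exact weight_vanish hS (by simpa using ha)
    ext a b
    by_cases hab : (n : ℤ) - 2 * (a : ℕ) = (n' : ℤ) - 2 * (b : ℕ)
    · have h := congrFun (congrFun (hS genericSU2) a) 0
      rw [Matrix.mul_apply, Matrix.mul_apply, Finset.sum_eq_zero, Finset.sum_eq_single b] at h
      · exact (mul_eq_zero.1 h.symm).resolve_right (spinMatrix_generic_col n' b)
      · intro b' _ hb'
        rw [weight_vanish hS (a := a) (b := b'), zero_mul]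
        intro h'
        apply hb'
        ext
        omega
      · simp
      · intro c _; rw [hcol c, mul_zero]
    · exact weight_vanish hS hab

lemma integrable_continuous_SU2 {f : SU2 → ℂ} (hf : Continuous f) : Integrable f haarSU2 :=
  hf.integrable_of_hasCompactSupport (HasCompactSupport.of_compactSpace f)

/-- The average of the intertwiner built from a matrix unit. -/
def schurAverage (n n' : ℕ) (c : Fin (n + 1)) (d : Fin (n' + 1)) :
    Matrix (Fin (n + 1)) (Fin (n' + 1)) ℂ :=
  Matrix.of fun a b => ∫ h : SU2, spinMatrix n h a c * spinMatrix n' h⁻¹ d b ∂haarSU2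

lemma integrable_schur (n n' : ℕ) (a c : Fin (n + 1)) (d b : Fin (n' + 1)) :
    Integrable (fun h : SU2 => spinMatrix n h a c * spinMatrix n' h⁻¹ d b) haarSU2 :=
  integrable_continuous_SU2 ((continuous_spinMatrix n a c).mul
    ((continuous_spinMatrix n' d b).comp continuous_inv))

/-- Invariance of Haar measure under h ↦ k h moves the factor k from one side of the average to the
other. -/
lemma schurAverage_comm (n n' : ℕ) (c : Fin (n + 1)) (d : Fin (n' + 1)) (k : SU2) :
    spinMatrix n k * schurAverage n n' c d = schurAverage n n' c d * spinMatrix n' k := by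
  ext a b
  have hL : (spinMatrix n k * schurAverage n n' c d) a b =
      ∫ h : SU2, spinMatrix n (k * h) a c * spinMatrix n' h⁻¹ d b ∂haarSU2 := by
    rw [Matrix.mul_apply]
    simp only [schurAverage, Matrix.of_apply]
    simp_rw [← integral_const_mul]
    rw [← integral_finsetSum _ fun e _ => (integrable_schur n n' e c d b).const_mul _]
    congr 1
    ext h
    rw [spinMatrix_mul, Matrix.mul_apply, Finset.sum_mul]
    exact Finset.sum_congr rfl fun e _ => by ring
  have hR : (schurAverage n n' c d * spinMatrix n' k) a b =
      ∫ h : SU2, spinMatrix n h a c * spinMatrix n' (h⁻¹ * k) d b ∂haarSU2 := by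
    rw [Matrix.mul_apply]
    simp only [schurAverage, Matrix.of_apply]
    simp_rw [← integral_mul_const]
    rw [← integral_finsetSum _ fun e _ => (integrable_schur n n' a c d e).mul_const _]
    congr 1
    ext h
    rw [spinMatrix_mul, Matrix.mul_apply, Finset.mul_sum]
    exact Finset.sum_congr rfl fun e _ => by ring
  rw [hL, hR]
  rw [← integral_mul_left_eq_self
    (fun h : SU2 => spinMatrix n h a c * spinMatrix n' (h⁻¹ * k) d b) k]
  simp

theorem schur_orthogonality_ne {n n' : ℕ} (hn : n ≠ n') (a c : Fin (n + 1)) (d b : Fin (n' + 1)) :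
    ∫ h : SU2, spinMatrix n h a c * spinMatrix n' h⁻¹ d b ∂haarSU2 = 0 :=
  congrFun (congrFun (schur_ne hn (schurAverage_comm n n' c d)) a) b

/-- The average is scalar by `schur_self`, and its trace is δ_{cd} since D(h⁻¹) D(h) = 1. The
relation is stated with h⁻¹ instead of complex conjugates because the monomial basis is not
orthonormal. -/
theorem schur_orthogonality (n : ℕ) (a c d b : Fin (n + 1)) :
    ∫ h : SU2, spinMatrix n h a c * spinMatrix n h⁻¹ d b ∂haarSU2 =
      if a = b ∧ c = d then ((n : ℂ) + 1)⁻¹ else 0 := by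
  have hS := schur_self (schurAverage_comm n n c d)
  have htr : ((n : ℂ) + 1) * schurAverage n n c d 0 0 = if c = d then 1 else 0 := by
    have h1 : (schurAverage n n c d).trace = ((n : ℂ) + 1) * schurAverage n n c d 0 0 := by
      conv_lhs => rw [hS]
      simp [Matrix.trace_diagonal]
    rw [← h1, Matrix.trace]
    simp only [Matrix.diag_apply, schurAverage, Matrix.of_apply]
    rw [← integral_finsetSum _ fun e _ => integrable_schur n n e c d e]
    have : ∀ h : SU2, ∑ e, spinMatrix n h e c * spinMatrix n h⁻¹ d e =
        if c = d then 1 else 0 := by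
      intro h
      have h2 : (spinMatrix n h⁻¹ * spinMatrix n h) d c = (1 : Matrix _ _ ℂ) d c := by
        rw [← spinMatrix_mul, inv_mul_cancel, spinMatrix_one]
      rw [Matrix.mul_apply, Matrix.one_apply] at h2
      simp only [eq_comm (a := c)]
      rw [← h2]
      exact Finset.sum_congr rfl fun e _ => mul_comm _ _
    simp [this]
  have hn : (n : ℂ) + 1 ≠ 0 := by exact_mod_cast Nat.succ_ne_zero n
  change schurAverage n n c d a b = _
  rw [hS]
  by_cases hab : a = b
  · subst hab
    rw [Matrix.diagonal_apply_eq, eq_comm, ← mul_right_inj' hn, htr]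
    by_cases hcd : c = d <;> simp [hcd, hn]
  · simp [Matrix.diagonal_apply_ne, hab]

/-! ### Möbius transformations of the plane -/

/-- The denominator `g₀₁ ζ + g₁₁` of the Möbius transformation `ζ ↦ (ζ,1) g`. -/
def mobDenom (g : SL2C) (ζ : ℂ) : ℂ := g 0 1 * ζ + g 1 1

/-- The Möbius transformation of the plane induced by `z ↦ z g`. -/
def mob (g : SL2C) (ζ : ℂ) : ℂ := (g 0 0 * ζ + g 1 0) / mobDenom g ζ

lemma measurable_mobDenom (g : SL2C) : Measurable (mobDenom g) := by
  unfold mobDenom; fun_prop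

lemma measurable_mob (g : SL2C) : Measurable (mob g) := by
  unfold mob mobDenom; fun_prop

lemma volume_mobDenom_eq_zero (g : SL2C) : volume {ζ | mobDenom g ζ = 0} = 0 := by
  apply Set.Subsingleton.measure_zero
  -- A nonzero affine function vanishes at most once; if g₀₁ were 0, a zero would force g₁₁ = 0,
  -- against det g = 1.
  intro x hx y hy
  simp only [Set.mem_ofPred_eq, mobDenom] at hx hy
  have hdet := SL2C.det_eq g
  have h01 : g 0 1 ≠ 0 := by
    intro h
    rw [h] at hx hdet
    simp only [zero_mul, zero_add] at hx
    rw [hx] at hdet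
    simp at hdet
  apply mul_left_cancel₀ h01
  linear_combination hx - hy

lemma ae_mobDenom_ne (g : SL2C) : ∀ᵐ ζ : ℂ, mobDenom g ζ ≠ 0 := by
  rw [ae_iff]
  simpa using volume_mobDenom_eq_zero g

lemma mobDenom_mul (g h : SL2C) {ζ : ℂ} (hζ : mobDenom g ζ ≠ 0) :
    mobDenom (g * h) ζ = mobDenom g ζ * mobDenom h (mob g ζ) := by
  have h1 : mobDenom g ζ * mob g ζ = g 0 0 * ζ + g 1 0 := mul_div_cancel₀ _ hζ
  rw [mobDenom.eq_1 (g * h), mobDenom.eq_1 h, SL2C.mul_entry, SL2C.mul_entry, mul_add,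
    mul_left_comm, h1]
  unfold mobDenom
  ring

lemma mob_mul (g h : SL2C) {ζ : ℂ} (hζ : mobDenom g ζ ≠ 0) :
    mob (g * h) ζ = mob h (mob g ζ) := by
  rw [mob, mobDenom_mul g h hζ, mob.eq_1 h, ← mul_div_mul_left (h 0 0 * mob g ζ + h 1 0) _ hζ]
  congr 1
  have h1 : mobDenom g ζ * mob g ζ = g 0 0 * ζ + g 1 0 := mul_div_cancel₀ _ hζ
  rw [SL2C.mul_entry, SL2C.mul_entry, mul_add, mul_left_comm, h1]
  unfold mobDenom
  ring

lemma mob_one (ζ : ℂ) : mob 1 ζ = ζ := by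
  simp [mob, mobDenom]

lemma mobDenom_one (ζ : ℂ) : mobDenom 1 ζ = 1 := by
  simp [mobDenom]

lemma hasDerivAt_mob (g : SL2C) {ζ : ℂ} (hζ : mobDenom g ζ ≠ 0) :
    HasDerivAt (mob g) ((mobDenom g ζ ^ 2)⁻¹) ζ := by
  have h1 : HasDerivAt (fun ζ => g 0 0 * ζ + g 1 0) (g 0 0) ζ := by
    simpa using ((hasDerivAt_id ζ).const_mul (g 0 0)).add_const (g 1 0)
  have h2 : HasDerivAt (mobDenom g) (g 0 1) ζ := by
    have := ((hasDerivAt_id ζ).const_mul (g 0 1)).add_const (g 1 1)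
    rwa [mul_one] at this
  have h3 : HasDerivAt (mob g) _ ζ := h1.div h2 hζ
  have h4 : g 0 0 * mobDenom g ζ - (g 0 0 * ζ + g 1 0) * g 0 1 = 1 := by
    unfold mobDenom
    linear_combination SL2C.det_eq g
  rwa [h4, one_div] at h3

/-- Away from the pole, the transformation of g⁻¹ is a left inverse. -/
lemma injOn_mob (g : SL2C) : Set.InjOn (mob g) {ζ | mobDenom g ζ ≠ 0} := by
  intro x hx y hy hxy
  have hx' := mob_mul g g⁻¹ hx
  have hy' := mob_mul g g⁻¹ hy
  rw [mul_inv_cancel, mob_one] at hx' hy'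
  rw [hx', hy', hxy]

lemma compl_image_mob (g : SL2C) :
    (mob g '' {ζ | mobDenom g ζ ≠ 0})ᶜ ⊆ {ζ | mobDenom g⁻¹ ζ = 0} := by
  intro x hx
  by_contra hne
  apply hx
  have h1 := mobDenom_mul g⁻¹ g hne
  rw [inv_mul_cancel, mobDenom_one] at h1
  refine ⟨mob g⁻¹ x, ?_, ?_⟩
  · intro h
    rw [h, mul_zero] at h1
    exact one_ne_zero h1
  · rw [← mob_mul g⁻¹ g hne, inv_mul_cancel, mob_one]

/-- Change of variables for Möbius transformations. -/
lemma lintegral_mob (g : SL2C) (f : ℂ → ℝ≥0∞) :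
    ∫⁻ ζ, ENNReal.ofReal (‖mobDenom g ζ‖ ^ 4)⁻¹ * f (mob g ζ) = ∫⁻ ζ, f ζ := by
  have hs : MeasurableSet {ζ | mobDenom g ζ ≠ 0} :=
    (measurable_mobDenom g) (measurableSet_singleton 0).compl
  have hae : ({ζ | mobDenom g ζ ≠ 0} : Set ℂ) =ᵐ[volume] Set.univ := by
    rw [Filter.eventuallyEq_univ]
    exact ae_mobDenom_ne g
  have hae' : (mob g '' {ζ | mobDenom g ζ ≠ 0} : Set ℂ) =ᵐ[volume] Set.univ := by
    rw [Filter.eventuallyEq_univ, mem_ae_iff]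
    exact measure_mono_null (compl_image_mob g) (volume_mobDenom_eq_zero g⁻¹)
  have h := lintegral_image_eq_lintegral_abs_det_fderiv_mul volume hs
    (f := mob g) (f' := fun ζ => (ContinuousLinearMap.toSpanSingleton ℂ
      ((mobDenom g ζ ^ 2)⁻¹)).restrictScalars ℝ)
    (fun x hx => ((hasDerivAt_mob g hx).hasFDerivAt.restrictScalars ℝ).hasFDerivWithinAt)
    (injOn_mob g) f
  rw [setLIntegral_congr hae', setLIntegral_congr hae, setLIntegral_univ, setLIntegral_univ] at h
  rw [h]
  congr 1
  ext ζ
  congr 2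
  rw [ContinuousLinearMap.det]
  change _ = |LinearMap.det (LinearMap.restrictScalars ℝ
    (ContinuousLinearMap.toSpanSingleton ℂ ((mobDenom g ζ ^ 2)⁻¹)).toLinearMap)|
  -- Multiplication by c on ℂ has real determinant |c|², here with c = w⁻² and w the denominator.
  rw [LinearMap.det_restrictScalars]
  have : LinearMap.det (ContinuousLinearMap.toSpanSingleton ℂ
      ((mobDenom g ζ ^ 2)⁻¹)).toLinearMap = (mobDenom g ζ ^ 2)⁻¹ := by
    simp
  rw [this, Algebra.norm_complex_eq]
  simp [Complex.normSq_eq_norm_sq, ← pow_mul]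

/-- Null sets pull back to null sets, so the formula for the principal series is well defined on
classes in L². -/
lemma quasiMeasurePreserving_mob (g : SL2C) :
    Measure.QuasiMeasurePreserving (mob g) volume volume := by
  refine ⟨measurable_mob g, ?_⟩
  refine Measure.AbsolutelyContinuous.mk fun s hs hs0 => ?_
  rw [Measure.map_apply (measurable_mob g) hs]
  have h := lintegral_mob g (s.indicator 1)
  rw [lintegral_indicator_one hs, hs0] at h
  have hm : Measurable fun ζ => ENNReal.ofReal (‖mobDenom g ζ‖ ^ 4)⁻¹ *
      s.indicator (1 : ℂ → ℝ≥0∞) (mob g ζ) :=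
    ((((measurable_mobDenom g).norm.pow_const 4).inv).ennreal_ofReal).mul
      ((measurable_one.indicator hs).comp (measurable_mob g))
  rw [lintegral_eq_zero_iff hm] at h
  have h2 : ∀ᵐ ζ : ℂ, ζ ∉ mob g ⁻¹' s := by
    filter_upwards [h, ae_mobDenom_ne g] with ζ h1 h2 h3
    have h4 : mob g ζ ∈ s := h3
    simp only [Set.indicator_of_mem h4, Pi.one_apply, mul_one, Pi.zero_apply,
      ENNReal.ofReal_eq_zero] at h1
    have : 0 < (‖mobDenom g ζ‖ ^ 4)⁻¹ := by positivity
    linarith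
  rw [ae_iff] at h2
  convert h2 using 2
  ext ζ
  simp

/-! ### The principal series as a unitary representation -/

/-- The multiplier of the principal series. -/
def psFactor (p : ℝ) (n : ℕ) (w : ℂ) : ℂ :=
  ((‖w‖ : ℂ) ^ (-2 + 2 * Complex.I * (p : ℂ))) * (w / ‖w‖) ^ n

lemma principalSeries_eq (p : ℝ) (n : ℕ) (g : SL2C) (φ : ℂ → ℂ) (ζ : ℂ) :
    principalSeries p n g φ ζ = psFactor p n (mobDenom g ζ) * φ (mob g ζ) := rfl

lemma psFactor_mul (p : ℝ) (n : ℕ) (w w' : ℂ) :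
    psFactor p n (w * w') = psFactor p n w * psFactor p n w' := by
  unfold psFactor
  rw [norm_mul, Complex.ofReal_mul,
    Complex.mul_cpow_ofReal_nonneg (norm_nonneg _) (norm_nonneg _), mul_div_mul_comm, mul_pow]
  ring

lemma psFactor_one (p : ℝ) (n : ℕ) : psFactor p n 1 = 1 := by
  simp [psFactor]

lemma psFactor_zero (p : ℝ) (n : ℕ) : psFactor p n 0 = 0 := by
  have : (-2 + 2 * Complex.I * (p : ℂ)) ≠ 0 := by
    intro h
    have := congrArg Complex.re h
    simp at this
  simp [psFactor, Complex.zero_cpow this]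

lemma norm_psFactor (p : ℝ) (n : ℕ) (w : ℂ) : ‖psFactor p n w‖ = (‖w‖ ^ 2)⁻¹ := by
  by_cases hw : w = 0
  · simp [hw, psFactor_zero]
  have hpos : 0 < ‖w‖ := norm_pos_iff.2 hw
  have : (-2 + 2 * Complex.I * (p : ℂ)).re = -2 := by simp
  rw [psFactor, norm_mul, Complex.norm_cpow_eq_rpow_re_of_pos hpos, this, norm_pow, norm_div,
    Complex.norm_real, Real.norm_of_nonneg hpos.le, div_self hpos.ne', one_pow, mul_one,
    Real.rpow_neg hpos.le]
  norm_cast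

lemma measurable_psFactor (p : ℝ) (n : ℕ) : Measurable (psFactor p n) := by
  unfold psFactor
  fun_prop

lemma principalSeries_mul (p : ℝ) (n : ℕ) (g h : SL2C) (φ : ℂ → ℂ) {ζ : ℂ}
    (hζ : mobDenom g ζ ≠ 0) :
    principalSeries p n g (principalSeries p n h φ) ζ = principalSeries p n (g * h) φ ζ := by
  simp only [principalSeries_eq]
  rw [mobDenom_mul g h hζ, mob_mul g h hζ, psFactor_mul, mul_assoc]

lemma principalSeries_congr_ae (p : ℝ) (n : ℕ) (g : SL2C) {φ ψ : ℂ → ℂ} (h : φ =ᵐ[volume] ψ) :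
    principalSeries p n g φ =ᵐ[volume] principalSeries p n g ψ := by
  filter_upwards [(quasiMeasurePreserving_mob g).ae h] with ζ hζ
  rw [principalSeries_eq, principalSeries_eq, hζ]

lemma measurable_principalSeries (p : ℝ) (n : ℕ) {φ : ℂ → ℂ} (hφ : Measurable φ) {X : Type*}
    [MeasurableSpace X] {G : X → SL2C} {Z : X → ℂ} (hG : Measurable G) (hZ : Measurable Z) :
    Measurable fun x => principalSeries p n (G x) φ (Z x) := by
  have he : ∀ i j, Measurable fun x => G x i j :=
    fun i j => (continuous_entry i j).measurable.comp hG
  have hd : Measurable fun x => mobDenom (G x) (Z x) := ((he 0 1).mul hZ).add (he 1 1)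
  have hm : Measurable fun x => mob (G x) (Z x) := (((he 0 0).mul hZ).add (he 1 0)).div hd
  simp only [principalSeries_eq]
  exact ((measurable_psFactor p n).comp hd).mul (hφ.comp hm)

/-- The multiplier has modulus |w|⁻², whose square is exactly the Jacobian |w|⁻⁴ of `lintegral_mob`;
p and n affect only its phase. -/
lemma eLpNorm_principalSeries (p : ℝ) (n : ℕ) (g : SL2C) (φ : ℂ → ℂ) :
    eLpNorm (principalSeries p n g φ) 2 volume = eLpNorm φ 2 volume := by
  rw [eLpNorm_eq_lintegral_rpow_enorm_toReal (by norm_num) (by norm_num),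
    eLpNorm_eq_lintegral_rpow_enorm_toReal (by norm_num) (by norm_num)]
  congr 1
  rw [← lintegral_mob g fun ζ => ‖φ ζ‖ₑ ^ (2 : ℝ≥0∞).toReal]
  congr 1
  ext ζ
  rw [principalSeries_eq, enorm_mul, ENNReal.mul_rpow_of_nonneg _ _ (by norm_num)]
  congr 1
  rw [← ofReal_norm, norm_psFactor]
  norm_num
  rw [← ENNReal.ofReal_pow (by positivity)]
  congr 1
  rw [inv_pow, ← pow_mul]

lemma memLp_principalSeries (p : ℝ) (n : ℕ) (g : SL2C) {φ : ℂ → ℂ} (hφ : MemLp φ 2 volume) :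
    MemLp (principalSeries p n g φ) 2 volume := by
  refine ⟨?_, ?_⟩
  · exact ((measurable_psFactor p n).comp (measurable_mobDenom g)).aestronglyMeasurable.mul
      (hφ.1.comp_quasiMeasurePreserving (quasiMeasurePreserving_mob g))
  · rw [eLpNorm_principalSeries]
    exact hφ.2

/-- The operators of the principal series. -/
def psIsometry (p : ℝ) (n : ℕ) (g : SL2C) : L2C →ₗᵢ[ℂ] L2C where
  toFun φ := (memLp_principalSeries p n g (Lp.memLp φ)).toLp _
  map_add' φ ψ := by
    rw [← MemLp.toLp_add]
    apply MemLp.toLp_congr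
    refine (principalSeries_congr_ae p n g (Lp.coeFn_add φ ψ)).trans ?_
    filter_upwards with ζ
    simp only [principalSeries_eq, Pi.add_apply]
    ring
  map_smul' c φ := by
    rw [RingHom.id_apply, ← MemLp.toLp_const_smul]
    apply MemLp.toLp_congr
    refine (principalSeries_congr_ae p n g (Lp.coeFn_smul c φ)).trans ?_
    filter_upwards with ζ
    simp only [principalSeries_eq, Pi.smul_apply, smul_eq_mul]
    ring
  norm_map' φ := by
    change ‖(memLp_principalSeries p n g (Lp.memLp φ)).toLp _‖ = _
    rw [Lp.norm_toLp, eLpNorm_principalSeries, Lp.norm_def]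

lemma coeFn_psIsometry (p : ℝ) (n : ℕ) (g : SL2C) (φ : L2C) :
    psIsometry p n g φ =ᵐ[volume] principalSeries p n g φ :=
  MemLp.coeFn_toLp (memLp_principalSeries p n g (Lp.memLp φ))

/-- The principal series as a homomorphism to the bounded operators on `L²(ℂ)`. -/
def ps (p : ℝ) (n : ℕ) : SL2C →* (L2C →L[ℂ] L2C) where
  toFun g := (psIsometry p n g).toContinuousLinearMap
  map_one' := by
    ext1 φ
    apply Lp.ext
    refine (coeFn_psIsometry p n 1 φ).trans ?_
    filter_upwards with ζ
    rw [principalSeries_eq, mobDenom_one, mob_one, psFactor_one, one_mul]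
    rfl
  map_mul' g h := by
    ext1 φ
    apply Lp.ext
    refine (coeFn_psIsometry p n (g * h) φ).trans ?_
    refine Filter.EventuallyEq.symm ((coeFn_psIsometry p n g (psIsometry p n h φ)).trans ?_)
    refine (principalSeries_congr_ae p n g (coeFn_psIsometry p n h φ)).trans ?_
    filter_upwards [ae_mobDenom_ne g] with ζ hζ
    exact principalSeries_mul p n g h φ hζ

lemma coeFn_ps (p : ℝ) (n : ℕ) (g : SL2C) (φ : L2C) :
    ps p n g φ =ᵐ[volume] principalSeries p n g φ :=
  coeFn_psIsometry p n g φ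

lemma norm_ps_apply (p : ℝ) (n : ℕ) (g : SL2C) (φ : L2C) : ‖ps p n g φ‖ = ‖φ‖ :=
  (psIsometry p n g).norm_map φ

lemma ps_mul_apply (p : ℝ) (n : ℕ) (g h : SL2C) (φ : L2C) :
    ps p n (g * h) φ = ps p n g (ps p n h φ) := by
  rw [map_mul]; rfl

lemma inner_ps_ps (p : ℝ) (n : ℕ) (g : SL2C) (φ ψ : L2C) :
    inner ℂ (ps p n g φ) (ps p n g ψ) = inner ℂ φ ψ :=
  (psIsometry p n g).inner_map_map φ ψ

lemma inner_ps_right (p : ℝ) (n : ℕ) (g : SL2C) (φ ψ : L2C) :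
    inner ℂ φ (ps p n g ψ) = inner ℂ (ps p n g⁻¹ φ) ψ := by
  rw [← inner_ps_ps p n g⁻¹ φ, ← ps_mul_apply, inv_mul_cancel, map_one]
  rfl

lemma inner_ps_left (p : ℝ) (n : ℕ) (g : SL2C) (φ ψ : L2C) :
    inner ℂ (ps p n g φ) ψ = inner ℂ φ (ps p n g⁻¹ ψ) := by
  rw [inner_ps_right, inv_inv]

lemma matrixElement_eq_inner (p : ℝ) (n : ℕ) (g : SL2C) (φ ψ : L2C) :
    matrixElement p n g φ ψ = inner ℂ φ (ps p n g ψ) := by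
  rw [L2.inner_def, matrixElement]
  apply integral_congr_ae
  filter_upwards [coeFn_ps p n g ψ] with ζ hζ
  rw [hζ, RCLike.inner_apply, mul_comm]

/-- Measurability in g is read off the explicit integral over ℂ, whose integrand is jointly
measurable; strong continuity of the representation is not needed. -/
lemma measurable_inner_ps (p : ℝ) (n : ℕ) (φ ψ : L2C) :
    Measurable fun g : SL2C => inner ℂ φ (ps p n g ψ) := by
  simp only [← matrixElement_eq_inner]
  have hm : Measurable fun q : SL2C × ℂ => conj (φ q.2) * principalSeries p n q.1 ψ q.2 :=
    (Complex.continuous_conj.measurable.comp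
      ((Lp.stronglyMeasurable φ).measurable.comp measurable_snd)).mul
      (measurable_principalSeries p n (Lp.stronglyMeasurable ψ).measurable measurable_fst
        measurable_snd)
  exact (hm.stronglyMeasurable.integral_prod_right (ν := (volume : Measure ℂ))).measurable

lemma norm_inner_ps_le (p : ℝ) (n : ℕ) (g : SL2C) (φ ψ : L2C) :
    ‖(inner ℂ φ (ps p n g ψ) : ℂ)‖ ≤ ‖φ‖ * ‖ψ‖ :=
  (norm_inner_le_norm _ _).trans_eq (by rw [norm_ps_apply])

/-! ### The minimal `SU(2)`-type of the principal series -/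

/-- The norm of the row vector `(ζ, 1)`. -/
def rowNorm (ζ : ℂ) : ℝ := √(1 + ‖ζ‖ ^ 2)

lemma rowNorm_pos (ζ : ℂ) : 0 < rowNorm ζ := Real.sqrt_pos.2 (by positivity)

lemma rowNorm_sq (ζ : ℂ) : rowNorm ζ ^ 2 = 1 + ‖ζ‖ ^ 2 := Real.sq_sqrt (by positivity)

lemma rowNorm_ne_zero (ζ : ℂ) : (rowNorm ζ : ℂ) ≠ 0 := by exact_mod_cast (rowNorm_pos ζ).ne'

lemma norm_le_rowNorm (ζ : ℂ) : ‖ζ‖ ≤ rowNorm ζ := Real.le_sqrt_of_sq_le (by linarith)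

lemma one_le_rowNorm (ζ : ℂ) : 1 ≤ rowNorm ζ :=
  Real.le_sqrt_of_sq_le (by nlinarith [sq_nonneg ‖ζ‖])

lemma continuous_rowNorm : Continuous rowNorm := by unfold rowNorm; fun_prop

/-- The row (ζ,1)k equals w · (`mob k ζ`, 1), with w the denominator, and a unitary k preserves the
norm of (ζ,1). -/
lemma rowNorm_mob (k : SU2) {ζ : ℂ} (hζ : mobDenom k ζ ≠ 0) :
    rowNorm (mob k ζ) = rowNorm ζ / ‖mobDenom k ζ‖ := by
  have hw : 0 < ‖mobDenom k ζ‖ := norm_pos_iff.2 hζ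
  have hkey : ‖(k : SL2C) 0 0 * ζ + (k : SL2C) 1 0‖ ^ 2 + ‖mobDenom k ζ‖ ^ 2 = 1 + ‖ζ‖ ^ 2 := by
    have h2 := SL2C.det_eq (k : SL2C)
    rw [SU2.entry_11, SU2.entry_10] at h2
    have : ((‖(k : SL2C) 0 0 * ζ + (k : SL2C) 1 0‖ ^ 2 + ‖mobDenom k ζ‖ ^ 2 : ℝ) : ℂ) =
        ((1 + ‖ζ‖ ^ 2 : ℝ) : ℂ) := by
      push_cast
      rw [← Complex.mul_conj', ← Complex.mul_conj', ← Complex.mul_conj', mobDenom, SU2.entry_11,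
        SU2.entry_10]
      simp only [map_add, map_mul, map_neg, Complex.conj_conj]
      linear_combination (1 + ζ * conj ζ) * h2
    exact_mod_cast this
  rw [rowNorm, rowNorm, ← Real.sqrt_sq hw.le, ← Real.sqrt_div (by positivity), mob, norm_div]
  congr 1
  rw [← hkey]
  field_simp
  ring

/-- The function `F(ζ,1)` for `F(z) = ‖z‖^(-2 + 2 i p - n) z₀ⁿ⁻ᵇ z₁ᵇ`. -/
def ktFun (p : ℝ) (n : ℕ) (b : Fin (n + 1)) (ζ : ℂ) : ℂ :=
  psFactor p n (rowNorm ζ) * (ζ ^ (n - b : ℕ) / (rowNorm ζ : ℂ) ^ n)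

/-- The factor depending on ‖z‖ is SU(2)-invariant, so F transforms exactly as its polynomial part
z₀ⁿ⁻ᵇ z₁ᵇ does in the spin n/2 representation. -/
lemma principalSeries_ktFun (p : ℝ) (n : ℕ) (k : SU2) (b : Fin (n + 1)) {ζ : ℂ}
    (hζ : mobDenom k ζ ≠ 0) :
    principalSeries p n k (ktFun p n b) ζ = ∑ a, spinMatrix n k a b * ktFun p n a ζ := by
  have hw : (‖mobDenom k ζ‖ : ℂ) ≠ 0 := by exact_mod_cast (norm_pos_iff.2 hζ).ne'
  have hb : (b : ℕ) ≤ n := Nat.lt_succ_iff.1 b.2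
  have h1 := spinMatrix_eval n k b ζ 1
  simp only [one_pow, mul_one, one_mul] at h1
  have h2 : ∑ a, spinMatrix n k a b * ktFun p n a ζ =
      psFactor p n (rowNorm ζ) / (rowNorm ζ : ℂ) ^ n *
        ∑ a, spinMatrix n k a b * ζ ^ (n - a : ℕ) := by
    rw [Finset.mul_sum]
    refine Finset.sum_congr rfl fun a _ => ?_
    unfold ktFun
    ring
  rw [h2, h1, principalSeries_eq, ktFun, ← mul_assoc, ← psFactor_mul, rowNorm_mob k hζ,
    Complex.ofReal_div]
  have h3 : psFactor p n (mobDenom k ζ * ((rowNorm ζ : ℂ) / (‖mobDenom k ζ‖ : ℂ))) =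
      psFactor p n (rowNorm ζ) * (mobDenom k ζ / (‖mobDenom k ζ‖ : ℂ)) ^ n := by
    rw [mul_div_left_comm, psFactor_mul]
    congr 1
    have h4 : ‖mobDenom k ζ / (‖mobDenom k ζ‖ : ℂ)‖ = 1 := by
      rw [norm_div, Complex.norm_real, norm_norm, div_self (norm_ne_zero_iff.2 hζ)]
    rw [psFactor, h4]
    simp
  rw [h3, mob]
  have h5 : ζ * (k : SL2C) 0 1 + (k : SL2C) 1 1 = mobDenom k ζ := by
    unfold mobDenom; ring
  rw [h5, mul_comm ζ]
  have h6 : mobDenom k ζ ^ n = mobDenom k ζ ^ (n - b : ℕ) * mobDenom k ζ ^ (b : ℕ) := by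
    rw [← pow_add, Nat.sub_add_cancel hb]
  rw [div_pow, div_pow, div_pow, h6]
  field_simp

lemma measurable_ktFun (p : ℝ) (n : ℕ) (b : Fin (n + 1)) : Measurable (ktFun p n b) := by
  have h : Measurable fun ζ => (rowNorm ζ : ℂ) :=
    Complex.measurable_ofReal.comp continuous_rowNorm.measurable
  unfold ktFun
  exact ((measurable_psFactor p n).comp h).mul ((measurable_id.pow_const _).div (h.pow_const n))

/-- The bound is square integrable over the plane, which puts `ktFun` in L². -/
lemma norm_ktFun_le (p : ℝ) (n : ℕ) (b : Fin (n + 1)) (ζ : ℂ) :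
    ‖ktFun p n b ζ‖ ≤ (1 + ‖ζ‖ ^ 2)⁻¹ := by
  have hN := rowNorm_pos ζ
  rw [ktFun, norm_mul, norm_psFactor, norm_div, norm_pow, norm_pow, Complex.norm_real,
    Real.norm_of_nonneg hN.le, rowNorm_sq]
  apply mul_le_of_le_one_right (by positivity)
  rw [div_le_one (by positivity)]
  calc ‖ζ‖ ^ (n - b : ℕ) ≤ rowNorm ζ ^ (n - b : ℕ) := by
        gcongr
        exact norm_le_rowNorm ζ
    _ ≤ rowNorm ζ ^ n := pow_le_pow_right₀ (one_le_rowNorm ζ) (Nat.sub_le _ _)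

lemma memLp_ktFun (p : ℝ) (n : ℕ) (b : Fin (n + 1)) : MemLp (ktFun p n b) 2 volume := by
  have hm := (measurable_ktFun p n b).aestronglyMeasurable (μ := (volume : Measure ℂ))
  rw [memLp_two_iff_integrable_sq_norm hm]
  have h := integrable_rpow_neg_one_add_norm_sq (E := ℂ) (μ := volume) (r := 4)
    (by rw [Complex.finrank_real_complex]; norm_num)
  refine h.mono (hm.norm.pow 2) ?_
  filter_upwards with ζ
  rw [norm_pow, norm_norm]
  have e : (1 + ‖ζ‖ ^ 2 : ℝ) ^ (-4 / 2 : ℝ) = ((1 + ‖ζ‖ ^ 2)⁻¹) ^ 2 := by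
    rw [show (-4 / 2 : ℝ) = -(2 : ℕ) by norm_num, Real.rpow_neg (by positivity), Real.rpow_natCast,
      inv_pow]
  rw [e, Real.norm_of_nonneg (by positivity)]
  gcongr
  exact norm_ktFun_le p n b ζ

/-- The vectors spanning the minimal `SU(2)`-type. -/
def ktVec (p : ℝ) (n : ℕ) (b : Fin (n + 1)) : L2C := (memLp_ktFun p n b).toLp _

lemma coeFn_ktVec (p : ℝ) (n : ℕ) (b : Fin (n + 1)) : ktVec p n b =ᵐ[volume] ktFun p n b :=
  MemLp.coeFn_toLp _

lemma ktVec_ne_zero (p : ℝ) (n : ℕ) (b : Fin (n + 1)) : ktVec p n b ≠ 0 := by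
  intro h
  have h1 := coeFn_ktVec p n b
  rw [h] at h1
  have h2 : ∀ᵐ ζ : ℂ, False := by
    filter_upwards [h1, Lp.coeFn_zero ℂ 2 (volume : Measure ℂ),
      measure_eq_zero_iff_ae_notMem.1 (measure_singleton (μ := (volume : Measure ℂ)) (0 : ℂ))]
      with ζ h3 h4 h5
    rw [h4] at h3
    have h6 : ‖psFactor p n (rowNorm ζ)‖ ≠ 0 := by
      rw [norm_psFactor, Complex.norm_real, Real.norm_of_nonneg (rowNorm_pos ζ).le]
      have := rowNorm_pos ζ
      positivity
    have h7 : ζ ≠ 0 := by simpa using h5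
    exact mul_ne_zero (norm_ne_zero_iff.1 h6)
      (div_ne_zero (pow_ne_zero _ h7) (pow_ne_zero _ (rowNorm_ne_zero ζ))) h3.symm
  exact h2.exists.elim fun _ h => h

lemma ps_ktVec (p : ℝ) (n : ℕ) (k : SU2) (b : Fin (n + 1)) :
    ps p n k (ktVec p n b) = ∑ a, spinMatrix n k a b • ktVec p n a := by
  apply Lp.ext
  refine (coeFn_ps p n k _).trans ?_
  refine (principalSeries_congr_ae p n k (coeFn_ktVec p n b)).trans ?_
  have h1 : (∑ a, spinMatrix n k a b • ktVec p n a : L2C) =ᵐ[volume]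
      fun ζ => ∑ a, spinMatrix n k a b * ktFun p n a ζ := by
    have h2 : ∀ᵐ ζ : ℂ, ∀ a, (spinMatrix n k a b • ktVec p n a : L2C) ζ =
        spinMatrix n k a b * ktFun p n a ζ := by
      rw [ae_all_iff]
      intro a
      filter_upwards [Lp.coeFn_smul (spinMatrix n k a b) (ktVec p n a), coeFn_ktVec p n a]
        with ζ h3 h4
      rw [h3, Pi.smul_apply, h4, smul_eq_mul]
    refine (Lp.coeFn_finsetSum Finset.univ _).trans ?_
    filter_upwards [h2] with ζ h3
    rw [Finset.sum_apply]
    exact Finset.sum_congr rfl fun a _ => h3 a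
  refine Filter.EventuallyEq.trans ?_ h1.symm
  filter_upwards [ae_mobDenom_ne (k : SL2C)] with ζ hζ
  exact principalSeries_ktFun p n k b hζ

lemma ps_torus_ktVec (p : ℝ) (n : ℕ) (s : Circle) (b : Fin (n + 1)) :
    ps p n (torus s) (ktVec p n b) = ((s : ℂ) ^ ((n : ℤ) - 2 * (b : ℕ))) • ktVec p n b := by
  rw [ps_ktVec, spinMatrix_torus, Finset.sum_eq_single b]
  · simp
  · intro a _ hab
    simp [hab]
  · simp

/-- Operators commuting with the torus are diagonal in the weight basis. -/
lemma inner_ktVec_eq_zero (p : ℝ) (n : ℕ) (T : L2C →L[ℂ] L2C)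
    (hT : ∀ (s : Circle) (φ : L2C), T (ps p n (torus s) φ) = ps p n (torus s) (T φ))
    {a b : Fin (n + 1)} (hab : a ≠ b) : inner ℂ (ktVec p n a) (T (ktVec p n b)) = 0 := by
  have hne : (((n : ℤ) - 2 * (b : ℕ)) - ((n : ℤ) - 2 * (a : ℕ))) ≠ 0 := by
    intro h
    apply hab
    ext
    omega
  obtain ⟨s, hs⟩ := exists_circle_zpow_ne hne
  have h1 := inner_ps_ps p n (torus s) (ktVec p n a) (T (ktVec p n b))
  rw [← hT, ps_torus_ktVec, ps_torus_ktVec, map_smul, inner_smul_left, inner_smul_right,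
    ← mul_assoc] at h1
  by_contra h0
  apply hs
  have h2 := mul_right_cancel₀ h0 (h1.trans (one_mul _).symm)
  rw [map_zpow₀, ← Circle.coe_inv_eq_conj, Circle.coe_inv, inv_zpow, mul_comm] at h2
  rw [zpow_sub₀ s.coe_ne_zero, div_eq_mul_inv]
  exact h2

/-- The orthonormal weight basis of the minimal `SU(2)`-type. -/
def ktONB (p : ℝ) (n : ℕ) (b : Fin (n + 1)) : L2C :=
  ((‖ktVec p n b‖⁻¹ : ℝ) : ℂ) • ktVec p n b

lemma norm_ktVec_ne_zero (p : ℝ) (n : ℕ) (b : Fin (n + 1)) : ((‖ktVec p n b‖ : ℝ) : ℂ) ≠ 0 := by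
  exact_mod_cast norm_ne_zero_iff.2 (ktVec_ne_zero p n b)

lemma ktVec_eq_smul (p : ℝ) (n : ℕ) (b : Fin (n + 1)) :
    ktVec p n b = ((‖ktVec p n b‖ : ℝ) : ℂ) • ktONB p n b := by
  rw [ktONB, smul_smul, Complex.ofReal_inv, mul_inv_cancel₀ (norm_ktVec_ne_zero p n b), one_smul]

lemma inner_ktONB_eq_zero (p : ℝ) (n : ℕ) (T : L2C →L[ℂ] L2C)
    (hT : ∀ (s : Circle) (φ : L2C), T (ps p n (torus s) φ) = ps p n (torus s) (T φ))
    {a b : Fin (n + 1)} (hab : a ≠ b) : inner ℂ (ktONB p n a) (T (ktONB p n b)) = 0 := by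
  rw [ktONB, ktONB, map_smul, inner_smul_left, inner_smul_right, inner_ktVec_eq_zero p n T hT hab]
  simp

lemma orthonormal_ktONB (p : ℝ) (n : ℕ) : Orthonormal ℂ (ktONB p n) := by
  refine ⟨fun b => ?_, fun a b hab => ?_⟩
  · rw [ktONB, norm_smul, Complex.norm_real, norm_inv, norm_norm,
      inv_mul_cancel₀ (norm_ne_zero_iff.2 (ktVec_ne_zero p n b))]
  · exact inner_ktONB_eq_zero p n (ContinuousLinearMap.id ℂ L2C) (fun _ _ => rfl) hab

/-- The compression of the principal series to its minimal `SU(2)`-type. -/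
def psMatrix (p : ℝ) (n : ℕ) (g : SL2C) : Matrix (Fin (n + 1)) (Fin (n + 1)) ℂ :=
  Matrix.of fun a b => inner ℂ (ktONB p n a) (ps p n g (ktONB p n b))

lemma psMatrix_apply (p : ℝ) (n : ℕ) (g : SL2C) (a b : Fin (n + 1)) :
    psMatrix p n g a b = inner ℂ (ktONB p n a) (ps p n g (ktONB p n b)) := rfl

lemma ps_ktONB' (p : ℝ) (n : ℕ) (k : SU2) (b : Fin (n + 1)) :
    ps p n k (ktONB p n b) = ∑ a, (((‖ktVec p n b‖ : ℝ) : ℂ)⁻¹ * spinMatrix n k a b *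
      ((‖ktVec p n a‖ : ℝ) : ℂ)) • ktONB p n a := by
  rw [ktONB, map_smul, ps_ktVec, Finset.smul_sum]
  refine Finset.sum_congr rfl fun a _ => ?_
  conv_lhs => rw [ktVec_eq_smul p n a]
  rw [smul_smul, smul_smul, Complex.ofReal_inv, mul_assoc]

/-- Normalizing the monomial vectors conjugates the spin matrix by a diagonal matrix, so traces and
orthogonality relations carry over. -/
lemma psMatrix_SU2 (p : ℝ) (n : ℕ) (k : SU2) (a b : Fin (n + 1)) :
    psMatrix p n k a b = ((‖ktVec p n b‖ : ℝ) : ℂ)⁻¹ * spinMatrix n k a b *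
      ((‖ktVec p n a‖ : ℝ) : ℂ) := by
  rw [psMatrix_apply, ps_ktONB', inner_sum, Finset.sum_eq_single a]
  · rw [inner_smul_right, inner_self_eq_norm_sq_to_K, (orthonormal_ktONB p n).1 a]
    simp
  · intro c _ hc
    rw [inner_smul_right, (orthonormal_ktONB p n).2 (Ne.symm hc), mul_zero]
  · simp

lemma ps_ktONB (p : ℝ) (n : ℕ) (k : SU2) (b : Fin (n + 1)) :
    ps p n k (ktONB p n b) = ∑ a, psMatrix p n k a b • ktONB p n a := by
  rw [ps_ktONB']
  simp only [psMatrix_SU2]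

lemma psMatrix_inv (p : ℝ) (n : ℕ) (g : SL2C) : psMatrix p n g⁻¹ = (psMatrix p n g).conjTranspose := by
  ext a b
  rw [Matrix.conjTranspose_apply, psMatrix_apply, psMatrix_apply, ← inner_ps_left]
  exact (inner_conj_symm _ _).symm

/-- A compression is not multiplicative in general. Here it is, because k maps the minimal type to
itself. -/
lemma psMatrix_mul_SU2 (p : ℝ) (n : ℕ) (g : SL2C) (k : SU2) :
    psMatrix p n (g * k) = psMatrix p n g * psMatrix p n k := by
  ext a b
  rw [psMatrix_apply, ps_mul_apply, ps_ktONB, map_sum, inner_sum, Matrix.mul_apply]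
  refine Finset.sum_congr rfl fun c _ => ?_
  rw [map_smul, inner_smul_right, mul_comm, psMatrix_apply p n g]

/-- This is the adjoint of `psMatrix_mul_SU2`, through unitarity. -/
lemma psMatrix_SU2_mul (p : ℝ) (n : ℕ) (k : SU2) (g : SL2C) :
    psMatrix p n (k * g) = psMatrix p n k * psMatrix p n g := by
  have h := psMatrix_mul_SU2 p n g⁻¹ k⁻¹
  have h2 : g⁻¹ * ((k⁻¹ : SU2) : SL2C) = ((k : SL2C) * g)⁻¹ := by simp
  rw [h2, psMatrix_inv, psMatrix_inv, Subgroup.coe_inv, psMatrix_inv,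
    ← Matrix.conjTranspose_mul] at h
  exact Matrix.conjTranspose_injective h

lemma psMatrix_one (p : ℝ) (n : ℕ) : psMatrix p n 1 = 1 := by
  ext a b
  rw [psMatrix_apply, map_one, Matrix.one_apply]
  exact orthonormal_iff_ite.1 (orthonormal_ktONB p n) a b

lemma chiSU2_eq_sum_psMatrix (p : ℝ) (n : ℕ) (k : SU2) : chiSU2 n k = ∑ a, psMatrix p n k a a := by
  rw [chiSU2_eq_sum]
  refine Finset.sum_congr rfl fun a _ => ?_
  rw [psMatrix_SU2, mul_right_comm, inv_mul_cancel₀ (norm_ktVec_ne_zero p n a), one_mul]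

lemma psMatrix_conjSU2 (p : ℝ) (n : ℕ) (k : SU2) (a b : Fin (n + 1)) :
    psMatrix p n (conjSU2 k) a b = conj (psMatrix p n k a b) := by
  rw [psMatrix_SU2, psMatrix_SU2, ← spinMatrix_conj]
  simp only [map_mul, map_inv₀, Complex.conj_ofReal]

lemma continuous_psMatrix_SU2 (p : ℝ) (n : ℕ) (a b : Fin (n + 1)) :
    Continuous fun k : SU2 => psMatrix p n k a b := by
  simp only [psMatrix_SU2]
  exact (continuous_const.mul (continuous_spinMatrix n a b)).mul continuous_const

theorem psMatrix_orthogonality_ne (p p' : ℝ) {n n' : ℕ} (hn : n ≠ n') (a c : Fin (n + 1))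
    (d b : Fin (n' + 1)) :
    ∫ h : SU2, psMatrix p n h a c * psMatrix p' n' (h⁻¹ : SU2) d b ∂haarSU2 = 0 := by
  simp only [psMatrix_SU2]
  rw [← mul_zero (((‖ktVec p n c‖ : ℝ) : ℂ)⁻¹ * ((‖ktVec p n a‖ : ℝ) : ℂ) *
    (((‖ktVec p' n' b‖ : ℝ) : ℂ)⁻¹ * ((‖ktVec p' n' d‖ : ℝ) : ℂ))),
    ← schur_orthogonality_ne hn a c d b, ← integral_const_mul]
  congr 1
  ext h
  ring

theorem psMatrix_orthogonality (p : ℝ) (n : ℕ) (a c d b : Fin (n + 1)) :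
    ∫ h : SU2, psMatrix p n h a c * psMatrix p n (h⁻¹ : SU2) d b ∂haarSU2 =
      if a = b ∧ c = d then ((n : ℂ) + 1)⁻¹ else 0 := by
  simp only [psMatrix_SU2]
  have h1 : ∀ h : SU2, (((‖ktVec p n c‖ : ℝ) : ℂ)⁻¹ * spinMatrix n h a c *
      ((‖ktVec p n a‖ : ℝ) : ℂ)) * (((‖ktVec p n b‖ : ℝ) : ℂ)⁻¹ * spinMatrix n h⁻¹ d b *
      ((‖ktVec p n d‖ : ℝ) : ℂ)) = (((‖ktVec p n c‖ : ℝ) : ℂ)⁻¹ * ((‖ktVec p n a‖ : ℝ) : ℂ) *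
      (((‖ktVec p n b‖ : ℝ) : ℂ)⁻¹ * ((‖ktVec p n d‖ : ℝ) : ℂ))) *
      (spinMatrix n h a c * spinMatrix n h⁻¹ d b) := fun h => by ring
  simp only [h1]
  rw [integral_const_mul, schur_orthogonality]
  by_cases hc : a = b ∧ c = d
  · obtain ⟨rfl, rfl⟩ := hc
    have h2 := norm_ktVec_ne_zero p n a
    have h3 := norm_ktVec_ne_zero p n c
    simp only [and_self, if_true]
    field_simp
  · simp [hc]

lemma integral_chiSU2_psMatrix (p : ℝ) (n : ℕ) (a b : Fin (n + 1)) :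
    ((n : ℂ) + 1) * ∫ k : SU2, chiSU2 n k * psMatrix p n k a b ∂haarSU2 =
      if a = b then 1 else 0 := by
  have hn : (n : ℂ) + 1 ≠ 0 := by exact_mod_cast Nat.succ_ne_zero n
  have h1 : ∀ k : SU2, chiSU2 n k * psMatrix p n k a b =
      ∑ c, psMatrix p n k a b * psMatrix p n (k⁻¹ : SU2) c c := by
    intro k
    rw [← chiSU2_inv, chiSU2_eq_sum_psMatrix p, mul_comm, Finset.mul_sum]
  simp only [h1]
  rw [integral_finsetSum]
  · simp only [psMatrix_orthogonality]
    by_cases hab : a = b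
    · subst hab
      rw [Finset.sum_eq_single a]
      · simp [hn]
      · intro c _ hc
        simp [Ne.symm hc]
      · simp
    · rw [Finset.sum_eq_zero]
      · simp [hab]
      · intro c _
        rw [if_neg]
        rintro ⟨rfl, rfl⟩
        exact hab rfl
  · intro c _
    exact integrable_continuous_SU2 ((continuous_psMatrix_SU2 p n a b).mul
      ((continuous_psMatrix_SU2 p n c c).comp continuous_inv))

/-! ### The projection onto the minimal `SU(2)`-type -/

lemma exists_bound_continuous_SU2 {w : SU2 → ℂ} (hw : Continuous w) : ∃ B, ∀ k, ‖w k‖ ≤ B := by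
  obtain ⟨B, hB⟩ := isCompact_univ.exists_bound_of_continuousOn hw.continuousOn
  exact ⟨B, fun k => hB k (Set.mem_univ k)⟩

lemma integrable_continuous_mul_SU2 {w Φ : SU2 → ℂ} (hw : Continuous w)
    (hΦ : Integrable Φ haarSU2) : Integrable (fun k => w k * Φ k) haarSU2 := by
  obtain ⟨B, hB⟩ := exists_bound_continuous_SU2 hw
  exact hΦ.bdd_mul hw.aestronglyMeasurable (Filter.Eventually.of_forall hB)

lemma lintegral_mul_principalSeries_le (p : ℝ) (n : ℕ) (g : SL2C) (φ ψ : L2C) :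
    ∫⁻ ζ, ‖conj (ψ ζ) * principalSeries p n g φ ζ‖ₑ ≤
      eLpNorm ψ 2 volume * eLpNorm φ 2 volume := by
  have h := ENNReal.lintegral_mul_le_Lp_mul_Lq (volume : Measure ℂ) Real.HolderConjugate.two_two
    (f := fun ζ => ‖ψ ζ‖ₑ) (g := fun ζ => ‖principalSeries p n g φ ζ‖ₑ)
    (Lp.memLp ψ).1.enorm (memLp_principalSeries p n g (Lp.memLp φ)).1.enorm
  rw [← eLpNorm_principalSeries p n g φ,
    eLpNorm_eq_lintegral_rpow_enorm_toReal (by norm_num) (by norm_num),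
    eLpNorm_eq_lintegral_rpow_enorm_toReal (by norm_num) (by norm_num)]
  refine le_trans (le_of_eq ?_) (h.trans (le_of_eq (by norm_num)))
  congr 1
  ext ζ
  rw [enorm_mul, RCLike.enorm_conj]
  rfl

/-- Joint integrability of the matrix element integrand. -/
lemma integrable_prod_principalSeries (p : ℝ) (n : ℕ) (φ ψ : L2C) {w : SU2 → ℂ}
    (hw : Continuous w) :
    Integrable (fun q : SU2 × ℂ => w q.1 * (conj (ψ q.2) * principalSeries p n q.1 φ q.2))
      (haarSU2.prod volume) := by
  have hm1 : Measurable fun q : SU2 × ℂ => principalSeries p n q.1 φ q.2 :=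
    measurable_principalSeries p n (Lp.stronglyMeasurable φ).measurable
      (measurable_subtype_coe.comp measurable_fst) measurable_snd
  have hm2 : Measurable fun q : SU2 × ℂ => conj (ψ q.2) :=
    Complex.continuous_conj.measurable.comp
      ((Lp.stronglyMeasurable ψ).measurable.comp measurable_snd)
  have hm3 : Measurable fun q : SU2 × ℂ => w q.1 := hw.measurable.comp measurable_fst
  have hm := hm3.mul (hm2.mul hm1)
  refine ⟨hm.aestronglyMeasurable, ?_⟩
  obtain ⟨B, hB⟩ := exists_bound_continuous_SU2 hw
  have hle : ∀ k : SU2, ∫⁻ ζ : ℂ, ‖w k * (conj (ψ ζ) * principalSeries p n k φ ζ)‖ₑ ≤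
      ENNReal.ofReal B * (eLpNorm ψ 2 volume * eLpNorm φ 2 volume) := by
    intro k
    have hwB : ‖w k‖ₑ ≤ ENNReal.ofReal B := by
      rw [← ofReal_norm]
      exact ENNReal.ofReal_le_ofReal (hB k)
    calc ∫⁻ ζ : ℂ, ‖w k * (conj (ψ ζ) * principalSeries p n k φ ζ)‖ₑ
        = ‖w k‖ₑ * ∫⁻ ζ : ℂ, ‖conj (ψ ζ) * principalSeries p n k φ ζ‖ₑ := by
          rw [← lintegral_const_mul' _ _ enorm_ne_top]
          exact lintegral_congr fun ζ => enorm_mul _ _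
      _ ≤ _ := mul_le_mul' hwB (lintegral_mul_principalSeries_le p n k φ ψ)
  rw [hasFiniteIntegral_iff_enorm]
  refine (lintegral_prod_le _).trans_lt ?_
  refine (lintegral_mono hle).trans_lt ?_
  rw [lintegral_const, measure_univ, mul_one]
  exact ENNReal.mul_lt_top ENNReal.ofReal_lt_top
    (ENNReal.mul_lt_top (Lp.memLp ψ).2 (Lp.memLp φ).2)

/-- An element of `SU(2)` whose second row is proportional to `(ζ, 1)`. -/
def rowSection (ζ : ℂ) : SU2 :=
  mkSU2 ((rowNorm ζ : ℂ)⁻¹) (-conj ζ * (rowNorm ζ : ℂ)⁻¹) (by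
    have h := rowNorm_pos ζ
    have h2 := rowNorm_sq ζ
    rw [norm_mul, norm_inv, norm_neg, RCLike.norm_conj, Complex.norm_real,
      Real.norm_of_nonneg h.le]
    field_simp
    linarith)

/-- Since (0,1) · `rowSection ζ` = (ζ,1)/N with N = ‖(ζ,1)‖, evaluation at any ζ reduces to
evaluation at 0 after a translation in SU(2). -/
lemma principalSeries_rowSection (p : ℝ) (n : ℕ) (k : SU2) (φ : ℂ → ℂ) (ζ : ℂ) :
    principalSeries p n ((rowSection ζ)⁻¹ * k : SU2) φ ζ =
      psFactor p n (rowNorm ζ) * principalSeries p n k φ 0 := by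
  have hN := rowNorm_ne_zero ζ
  have hN2 : (rowNorm ζ : ℂ) ^ 2 = 1 + ζ * conj ζ := by
    rw [Complex.mul_conj']
    exact_mod_cast rowNorm_sq ζ
  have h1 : mobDenom (rowSection ζ : SL2C)⁻¹ ζ = rowNorm ζ := by
    rw [mobDenom, SL2C.inv_01, SL2C.inv_11]
    simp only [rowSection, mkSU2_00, mkSU2_01]
    field_simp
    linear_combination -hN2
  have h2 : mob (rowSection ζ : SL2C)⁻¹ ζ = 0 := by
    rw [mob, SL2C.inv_00, SL2C.inv_10]
    simp only [rowSection, mkSU2_10, mkSU2_11]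
    simp only [map_inv₀, map_mul, map_neg, Complex.conj_conj, Complex.conj_ofReal]
    ring
  rw [Subgroup.coe_mul, Subgroup.coe_inv, ← principalSeries_mul _ _ _ _ _ (by rw [h1]; exact hN),
    principalSeries_eq, h1, h2]

/-- The torus preserves the line of (0,1), so homogeneity of F gives k ↦ F((0,1)k) a fixed weight -n
under left translation. This equivariance is the source of multiplicity one. -/
lemma principalSeries_torus_mul (p : ℝ) (n : ℕ) (s : Circle) (k : SU2) (φ : ℂ → ℂ) :
    principalSeries p n (torus s * k : SU2) φ 0 = (s : ℂ) ^ (-n : ℤ) * principalSeries p n k φ 0 := by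
  have h1 : mobDenom (torus s) 0 = (s : ℂ)⁻¹ := by
    simp [mobDenom]
  have h2 : mob (torus s) 0 = 0 := by simp [mob]
  rw [Subgroup.coe_mul, ← principalSeries_mul _ _ _ _ _ (by rw [h1]; simp), principalSeries_eq,
    h1, h2]
  congr 1
  simp [psFactor, Circle.norm_coe]

/-- A value at the single point 0 is not controlled by the L² norm. Fubini gives integrability over
SU(2) at some ζ, and `rowSection` translates ζ to 0. The last weight vector serves as test function
because it vanishes nowhere. -/
lemma integrable_principalSeries_zero (p : ℝ) (n : ℕ) (φ : L2C) :
    Integrable (fun k : SU2 => principalSeries p n k φ 0) haarSU2 := by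
  have h := (integrable_prod_principalSeries p n φ (ktVec p n (Fin.last n))
    (w := fun _ => 1) continuous_const).prod_left_ae
  obtain ⟨ζ, h1, h2⟩ := (h.and (coeFn_ktVec p n (Fin.last n))).exists
  have hne : psFactor p n (rowNorm ζ) ≠ 0 := by
    rw [← norm_ne_zero_iff, norm_psFactor, Complex.norm_real,
      Real.norm_of_nonneg (rowNorm_pos ζ).le]
    have := rowNorm_pos ζ
    positivity
  have hne2 : ktFun p n (Fin.last n) ζ ≠ 0 := by
    unfold ktFun
    simp [hne, (rowNorm_pos ζ).ne']
  simp only [one_mul, h2] at h1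
  have h3 := (h1.const_mul (conj (ktFun p n (Fin.last n) ζ))⁻¹).comp_mul_left (rowSection ζ)⁻¹
  have h4 := h3.const_mul (psFactor p n (rowNorm ζ))⁻¹
  refine h4.congr (Filter.Eventually.of_forall fun k => ?_)
  have hne3 : conj (ktFun p n (Fin.last n) ζ) ≠ 0 := by simpa using hne2
  simp only []
  rw [principalSeries_rowSection]
  field_simp

/-- Averaging over the torus isolates one diagonal matrix element in the character. -/
lemma integral_chiSU2_mul_of_torus (n : ℕ) (k₁ : SU2) {Φ : SU2 → ℂ} (hΦ : Integrable Φ haarSU2)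
    (hΦt : ∀ (s : Circle) (k : SU2), Φ (torus s * k) = (s : ℂ) ^ (-n : ℤ) * Φ k) :
    ∫ k, chiSU2 n (k * k₁) * Φ k ∂haarSU2 =
      ∑ c, spinMatrix n k₁ c 0 * ∫ k, spinMatrix n k 0 c * Φ k ∂haarSU2 := by
  have hint : ∀ a b, Integrable (fun k => spinMatrix n (k * k₁) a b * Φ k) haarSU2 := fun a b =>
    integrable_continuous_mul_SU2
      ((continuous_spinMatrix n a b).comp (continuous_mul_const k₁)) hΦ
  have h1 : ∫ k, chiSU2 n (k * k₁) * Φ k ∂haarSU2 =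
      ∑ b, ∫ k, spinMatrix n (k * k₁) b b * Φ k ∂haarSU2 := by
    rw [← integral_finsetSum _ fun b _ => hint b b]
    congr 1
    ext k
    rw [chiSU2_eq_sum, Finset.sum_mul]
  rw [h1, Finset.sum_eq_single 0]
  · have h2 : ∀ k, spinMatrix n (k * k₁) 0 0 * Φ k =
        ∑ c, spinMatrix n k₁ c 0 * (spinMatrix n k 0 c * Φ k) := by
      intro k
      rw [spinMatrix_mul, Matrix.mul_apply, Finset.sum_mul]
      exact Finset.sum_congr rfl fun c _ => by ring
    simp only [h2]
    rw [integral_finsetSum]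
    · simp only [integral_const_mul]
    · intro c _
      exact (integrable_continuous_mul_SU2 (continuous_spinMatrix n 0 c) hΦ).const_mul _
  · intro b _ hb
    -- Translation by the torus element s multiplies the b-th term by s^{n-2b} s^{-n} = s^{-2b}, so
    -- only b = 0 survives.
    have hb' : (-2 * (b : ℕ) : ℤ) ≠ 0 := by
      have : (b : ℕ) ≠ 0 := fun h => hb (Fin.ext h)
      omega
    obtain ⟨s, hs⟩ := exists_circle_zpow_ne hb'
    have h2 := integral_mul_left_eq_self (μ := haarSU2)
      (fun k => spinMatrix n (k * k₁) b b * Φ k) (torus s)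
    have h3 : ∀ k, spinMatrix n (torus s * k * k₁) b b * Φ (torus s * k) =
        (s : ℂ) ^ (-2 * (b : ℕ) : ℤ) * (spinMatrix n (k * k₁) b b * Φ k) := by
      intro k
      rw [mul_assoc, spinMatrix_mul, spinMatrix_torus, Matrix.diagonal_mul, hΦt,
        mul_mul_mul_comm, ← zpow_add₀ s.coe_ne_zero]
      congr 2
      omega
    simp only [h3] at h2
    rw [integral_const_mul] at h2
    by_contra h0
    exact hs (mul_right_cancel₀ h0 (h2.trans (one_mul _).symm))
  · simp

/-- The integral of `χ^j(k) D(k) φ` lies in the minimal `SU(2)`-type. -/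
lemma exists_integral_chiSU2_eq (p : ℝ) (n : ℕ) (φ : L2C) : ∃ c : Fin (n + 1) → ℂ, ∀ ψ : L2C,
    ∫ k : SU2, chiSU2 n k * inner ℂ ψ (ps p n k φ) ∂haarSU2 =
      ∑ b, c b * inner ℂ ψ (ktVec p n b) := by
  set Φ : SU2 → ℂ := fun k => principalSeries p n k φ 0 with hΦdef
  have hΦ : Integrable Φ haarSU2 := integrable_principalSeries_zero p n φ
  set I : Fin (n + 1) → ℂ := fun c => ∫ k, spinMatrix n k 0 c * Φ k ∂haarSU2 with hI
  refine ⟨fun b => (n.choose (Fin.rev b) : ℂ) * (-1) ^ (Fin.rev b : ℕ) * I (Fin.rev b),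
    fun ψ => ?_⟩
  have h1 : ∀ k : SU2, chiSU2 n k * inner ℂ ψ (ps p n k φ) =
      ∫ ζ, chiSU2 n k * (conj (ψ ζ) * principalSeries p n k φ ζ) := by
    intro k
    rw [← matrixElement_eq_inner, matrixElement, integral_const_mul]
  simp only [h1]
  rw [integral_integral_swap (integrable_prod_principalSeries p n φ ψ (continuous_chiSU2 n))]
  have h2 : ∀ ζ : ℂ, ∫ k : SU2, chiSU2 n k * (conj (ψ ζ) * principalSeries p n k φ ζ) ∂haarSU2 =
      ∑ b, ((n.choose (Fin.rev b) : ℂ) * (-1) ^ (Fin.rev b : ℕ) * I (Fin.rev b)) *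
        (conj (ψ ζ) * ktFun p n b ζ) := by
    intro ζ
    -- After this translation ζ enters only through a scalar and the argument of χ, and `Φ` no
    -- longer depends on it.
    rw [← integral_mul_left_eq_self _ (rowSection ζ)⁻¹]
    have h3 : ∀ k : SU2, chiSU2 n ((rowSection ζ)⁻¹ * k) *
        (conj (ψ ζ) * principalSeries p n ((rowSection ζ)⁻¹ * k : SU2) φ ζ) =
        (conj (ψ ζ) * psFactor p n (rowNorm ζ)) * (chiSU2 n (k * (rowSection ζ)⁻¹) * Φ k) := by
      intro k
      rw [principalSeries_rowSection]
      have : chiSU2 n ((rowSection ζ)⁻¹ * k) = chiSU2 n (k * (rowSection ζ)⁻¹) := by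
        rw [chiSU2_eq_trace, chiSU2_eq_trace, spinMatrix_mul, spinMatrix_mul,
          Matrix.trace_mul_comm]
      rw [this]
      ring
    simp only [h3]
    rw [integral_const_mul, integral_chiSU2_mul_of_torus n _ hΦ
      (fun s k => principalSeries_torus_mul p n s k φ), Finset.mul_sum,
      ← Equiv.sum_comp Fin.revPerm]
    refine Finset.sum_congr rfl fun b _ => ?_
    -- Entry c of column 0 for (`rowSection ζ`)⁻¹ contains ζᶜ, whereas `ktFun` with index b contains
    -- ζⁿ⁻ᵇ; hence c = n - b.
    have hrev : (n - b : ℕ) = (Fin.rev b : ℕ) := by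
      rw [Fin.val_rev]; omega
    have hle : (Fin.rev b : ℕ) ≤ n := Nat.lt_succ_iff.1 (Fin.rev b).2
    rw [Fin.revPerm_apply, spinMatrix_col_zero, Subgroup.coe_inv, SL2C.inv_00, SL2C.inv_10, ktFun,
      hrev]
    have e1 : (rowSection ζ : SL2C) 1 1 = (rowNorm ζ : ℂ)⁻¹ := by simp [rowSection]
    have e2 : -(rowSection ζ : SL2C) 1 0 = (-1) * ζ * (rowNorm ζ : ℂ)⁻¹ := by
      simp [rowSection]
    have e3 : (rowNorm ζ : ℂ) ^ n =
        (rowNorm ζ : ℂ) ^ (n - (Fin.rev b : ℕ)) * (rowNorm ζ : ℂ) ^ (Fin.rev b : ℕ) := by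
      rw [← pow_add, Nat.sub_add_cancel hle]
    rw [e1, e2, e3, mul_pow, mul_pow, inv_pow, inv_pow, div_eq_mul_inv, mul_inv]
    ring
  simp only [h2]
  have h4 : ∀ b, inner ℂ ψ (ktVec p n b) = ∫ ζ, conj (ψ ζ) * ktFun p n b ζ := by
    intro b
    rw [L2.inner_def]
    apply integral_congr_ae
    filter_upwards [coeFn_ktVec p n b] with ζ hζ
    rw [hζ, RCLike.inner_apply, mul_comm]
  have h5 : ∀ b, Integrable fun ζ => conj (ψ ζ) * ktFun p n b ζ := by
    intro b
    refine (L2.integrable_inner (𝕜 := ℂ) ψ (ktVec p n b)).congr ?_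
    filter_upwards [coeFn_ktVec p n b] with ζ hζ
    rw [hζ, RCLike.inner_apply, mul_comm]
  rw [integral_finsetSum _ fun b _ => (h5 b).const_mul _]
  simp only [integral_const_mul, h4]

/-- The orthogonal projection onto the minimal `SU(2)`-type. -/
def ktProj (p : ℝ) (n : ℕ) : L2C →L[ℂ] L2C :=
  ∑ b, (innerSL ℂ (ktONB p n b)).smulRight (ktONB p n b)

lemma ktProj_apply (p : ℝ) (n : ℕ) (φ : L2C) :
    ktProj p n φ = ∑ b, (inner ℂ (ktONB p n b) φ : ℂ) • ktONB p n b := by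
  simp [ktProj]

lemma inner_ktProj (p : ℝ) (n : ℕ) (φ ψ : L2C) :
    inner ℂ ψ (ktProj p n φ) = ∑ b, inner ℂ ψ (ktONB p n b) * inner ℂ (ktONB p n b) φ := by
  rw [ktProj_apply, inner_sum]
  exact Finset.sum_congr rfl fun b _ => by rw [inner_smul_right, mul_comm]

/-- The projection onto the minimal `SU(2)`-type is the isotypic projection of spin `n/2`. -/
theorem integral_chiSU2_ps (p : ℝ) (n : ℕ) (φ ψ : L2C) :
    ((n : ℂ) + 1) * ∫ k : SU2, chiSU2 n k * inner ℂ ψ (ps p n k φ) ∂haarSU2 =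
      inner ℂ ψ (ktProj p n φ) := by
  obtain ⟨c, hc⟩ := exists_integral_chiSU2_eq p n φ
  have h1 : ∀ a, ((n : ℂ) + 1) *
      ∫ k : SU2, chiSU2 n k * inner ℂ (ktONB p n a) (ps p n k φ) ∂haarSU2 =
        inner ℂ (ktONB p n a) φ := by
    intro a
    have h2 : ∀ k : SU2, chiSU2 n k * inner ℂ (ktONB p n a) (ps p n k φ) =
        ∑ b, (chiSU2 n k * psMatrix p n k a b) * inner ℂ (ktONB p n b) φ := by
      intro k
      rw [inner_ps_right, ← Subgroup.coe_inv, ps_ktONB, sum_inner, Finset.mul_sum]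
      refine Finset.sum_congr rfl fun b _ => ?_
      rw [inner_smul_left, Subgroup.coe_inv, psMatrix_inv, Matrix.conjTranspose_apply,
        RCLike.star_def, Complex.conj_conj, mul_assoc]
    simp only [h2]
    rw [integral_finsetSum, Finset.mul_sum]
    · simp only [integral_mul_const, ← mul_assoc, integral_chiSU2_psMatrix]
      simp
    · intro b _
      exact (integrable_continuous_SU2 ((continuous_chiSU2 n).mul
        (continuous_psMatrix_SU2 p n a b))).mul_const _
  -- Pairing with the orthonormal weight vectors determines the unknown coefficients `c`.
  have h3 : ∀ a, inner ℂ (ktONB p n a) φ = ((n : ℂ) + 1) * (c a * ((‖ktVec p n a‖ : ℝ) : ℂ)) := by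
    intro a
    rw [← h1 a, hc, Finset.sum_eq_single a]
    · rw [ktVec_eq_smul, inner_smul_right, inner_self_eq_norm_sq_to_K,
        (orthonormal_ktONB p n).1 a, ← ktVec_eq_smul]
      simp
    · intro b _ hb
      rw [ktVec_eq_smul, inner_smul_right, (orthonormal_ktONB p n).2 (Ne.symm hb)]
      simp
    · simp
  rw [hc, inner_ktProj, Finset.mul_sum]
  refine Finset.sum_congr rfl fun b _ => ?_
  rw [h3, ktVec_eq_smul, inner_smul_right, ← ktVec_eq_smul]
  ring

/-! ### Traces -/

/-- The trace over the Hilbert basis used for the characters. -/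
def opTrace (T : L2C →L[ℂ] L2C) : ℂ :=
  ∑' b : ((exists_hilbertBasis ℂ L2C).choose : Set L2C), inner ℂ (b : L2C) (T b)

/-- The trace of an operator that factors through the minimal `SU(2)`-type. -/
lemma opTrace_mul_ktProj_mul (p : ℝ) (n : ℕ) (A B : L2C →L[ℂ] L2C) :
    opTrace (A * ktProj p n * B) = ∑ i, inner ℂ (ktONB p n i) (B (A (ktONB p n i))) := by
  obtain ⟨b, hb⟩ := (exists_hilbertBasis ℂ L2C).choose_spec
  have h1 : ∀ x : ((exists_hilbertBasis ℂ L2C).choose : Set L2C),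
      inner ℂ (x : L2C) ((A * ktProj p n * B) x) =
      ∑ i, inner ℂ (ContinuousLinearMap.adjoint B (ktONB p n i)) (b x) *
        inner ℂ (b x) (A (ktONB p n i)) := by
    intro x
    have hx : (x : L2C) = b x := by rw [hb]
    change inner ℂ (x : L2C) (A (ktProj p n (B x))) = _
    rw [ktProj_apply, map_sum, inner_sum, hx]
    refine Finset.sum_congr rfl fun i _ => ?_
    rw [map_smul, inner_smul_right, ContinuousLinearMap.adjoint_inner_left]
  -- Parseval, applied to each of the finitely many rank-one pieces of the projection; summability
  -- comes with it.
  have h2 := hasSum_sum fun (i : Fin (n + 1)) (_ : i ∈ Finset.univ) => b.hasSum_inner_mul_inner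
    (ContinuousLinearMap.adjoint B (ktONB p n i)) (A (ktONB p n i))
  rw [opTrace, funext h1, h2.tsum_eq]
  exact Finset.sum_congr rfl fun i _ => by rw [ContinuousLinearMap.adjoint_inner_left]

lemma ktProj_ktONB (p : ℝ) (n : ℕ) (i : Fin (n + 1)) : ktProj p n (ktONB p n i) = ktONB p n i := by
  rw [ktProj_apply]
  have := orthonormal_iff_ite.1 (orthonormal_ktONB p n)
  simp [this]

lemma ktProj_mul_self (p : ℝ) (n : ℕ) : ktProj p n * ktProj p n = ktProj p n := by
  ext1 φ
  change ktProj p n (ktProj p n φ) = ktProj p n φ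
  conv_lhs => rw [ktProj_apply p n φ]
  rw [map_sum, ktProj_apply]
  exact Finset.sum_congr rfl fun i _ => by rw [map_smul, ktProj_ktONB]

/-! ### The kernel of the Dupuis–Livine map -/

/-- One of the two factors d_j is absorbed by the projection, which leaves d_j tr(D(g) P D(h⁻¹)). -/
lemma kernelTerm_eq (p : ℕ → ℝ) (n : ℕ) (g : SL2C) (h : SU2) :
    kernelTerm p n g h = ((n : ℂ) + 1) *
      ∑ i, ∑ c, psMatrix (p n) n (h⁻¹ : SU2) i c * psMatrix (p n) n g c i := by
  have h1 : ∀ b : L2C, ((n : ℂ) + 1) * ∫ k : SU2, chiSU2 n (k * h) *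
      matrixElement (p n) n (g * (k : SL2C)) b b ∂haarSU2 =
      inner ℂ b ((ps (p n) n g * ktProj (p n) n * ps (p n) n (h⁻¹ : SU2)) b) := by
    intro b
    -- Replacing k by k h⁻¹ frees the character of h and leaves D(g) D(k) D(h⁻¹).
    rw [← integral_mul_right_eq_self _ h⁻¹]
    have h2 : ∀ k : SU2, chiSU2 n (k * h⁻¹ * h) *
        matrixElement (p n) n (g * ((k * h⁻¹ : SU2) : SL2C)) b b =
        chiSU2 n k * inner ℂ (ps (p n) n g⁻¹ b) (ps (p n) n k (ps (p n) n (h⁻¹ : SU2) b)) := by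
      intro k
      rw [inv_mul_cancel_right, matrixElement_eq_inner, ps_mul_apply, inner_ps_right,
        Subgroup.coe_mul, ps_mul_apply]
    simp only [h2]
    rw [integral_chiSU2_ps, inner_ps_left, inv_inv]
    rfl
  rw [kernelTerm, characterIntegral, pow_two, mul_assoc, ← tsum_mul_left]
  simp only [h1]
  congr 1
  rw [← opTrace, opTrace_mul_ktProj_mul]
  refine Finset.sum_congr rfl fun i _ => ?_
  rw [← ps_mul_apply, ← psMatrix_apply, psMatrix_SU2_mul, Matrix.mul_apply]

lemma continuous_kernelTerm (p : ℕ → ℝ) (n : ℕ) (g : SL2C) :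
    Continuous fun h : SU2 => kernelTerm p n g h := by
  simp only [kernelTerm_eq]
  refine continuous_const.mul (continuous_finsetSum _ fun i _ => continuous_finsetSum _ fun c _ =>
    Continuous.mul ?_ continuous_const)
  exact (continuous_psMatrix_SU2 (p n) n i c).comp continuous_inv

/-! ### Matrix coefficients of the minimal `SU(2)`-type -/

/-- The space of matrix coefficients of the minimal `SU(2)`-type. -/
def ktSpace (p : ℝ) (n : ℕ) : Submodule ℂ (SL2C → ℂ) :=
  Submodule.span ℂ (Set.range fun ab : Fin (n + 1) × Fin (n + 1) =>
    fun g : SL2C => psMatrix p n g ab.1 ab.2)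

instance (p : ℝ) (n : ℕ) : FiniteDimensional ℂ (ktSpace p n) :=
  FiniteDimensional.span_of_finite ℂ (Set.finite_range _)

lemma psMatrix_mem_ktSpace (p : ℝ) (n : ℕ) (a b : Fin (n + 1)) :
    (fun g => psMatrix p n g a b) ∈ ktSpace p n :=
  Submodule.subset_span ⟨(a, b), rfl⟩

lemma continuous_of_mem_ktSpace {p : ℝ} {n : ℕ} {f : SL2C → ℂ} (hf : f ∈ ktSpace p n) :
    Continuous fun h : SU2 => f h := by
  induction hf using Submodule.span_induction with
  | mem x hx =>
    obtain ⟨ab, rfl⟩ := hx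
    exact continuous_psMatrix_SU2 p n ab.1 ab.2
  | zero => exact continuous_const
  | add x y _ _ hx hy => exact hx.add hy
  | smul c x _ hx => exact continuous_const.mul hx

/-- The Dupuis–Livine kernel reproduces matrix coefficients of the minimal `SU(2)`-type. -/
lemma integral_kernelTerm_mul (p : ℕ → ℝ) (n n' : ℕ) {f : SL2C → ℂ} (hf : f ∈ ktSpace (p n) n)
    (g : SL2C) : ∫ h : SU2, kernelTerm p n' g h * f h ∂haarSU2 = if n' = n then f g else 0 := by
  induction hf using Submodule.span_induction with
  | mem x hx =>
    obtain ⟨⟨a, b⟩, rfl⟩ := hx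
    have h1 : ∀ h : SU2, kernelTerm p n' g h * psMatrix (p n) n h a b =
        ∑ i, ∑ c, (((n' : ℂ) + 1) * psMatrix (p n') n' g c i) *
          (psMatrix (p n) n h a b * psMatrix (p n') n' (h⁻¹ : SU2) i c) := by
      intro h
      rw [kernelTerm_eq, Finset.mul_sum, Finset.sum_mul]
      refine Finset.sum_congr rfl fun i _ => ?_
      rw [Finset.mul_sum, Finset.sum_mul]
      exact Finset.sum_congr rfl fun c _ => by ring
    have hint : ∀ i c, Integrable (fun h : SU2 => (((n' : ℂ) + 1) * psMatrix (p n') n' g c i) *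
          (psMatrix (p n) n h a b * psMatrix (p n') n' (h⁻¹ : SU2) i c)) haarSU2 := fun i c =>
      (integrable_continuous_SU2 ((continuous_psMatrix_SU2 (p n) n a b).mul
        ((continuous_psMatrix_SU2 (p n') n' i c).comp continuous_inv))).const_mul _
    simp only [h1]
    rw [integral_finsetSum _ fun i _ => integrable_finsetSum _ fun c _ => hint i c]
    simp_rw [integral_finsetSum _ fun c _ => hint _ c, integral_const_mul]
    by_cases hn : n' = n
    · subst hn
      have hn' : (n' : ℂ) + 1 ≠ 0 := by exact_mod_cast Nat.succ_ne_zero n'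
      simp only [psMatrix_orthogonality, if_true]
      rw [Finset.sum_eq_single b, Finset.sum_eq_single a]
      · simp [mul_right_comm, hn']
      · intro c _ hc
        simp [Ne.symm hc]
      · simp
      · intro i _ hi
        simp [Ne.symm hi]
      · simp
    · simp only [psMatrix_orthogonality_ne _ _ (Ne.symm hn), mul_zero, Finset.sum_const_zero,
        if_neg hn]
  | zero => simp
  | add x y hx' hy' hx hy =>
    simp only [Pi.add_apply, mul_add]
    rw [integral_add, hx, hy]
    · split_ifs <;> simp
    · exact integrable_continuous_SU2 ((continuous_kernelTerm p n' g).mul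
        (continuous_of_mem_ktSpace hx'))
    · exact integrable_continuous_SU2 ((continuous_kernelTerm p n' g).mul
        (continuous_of_mem_ktSpace hy'))
  | smul c x _ hx =>
    simp only [Pi.smul_apply, smul_eq_mul, mul_left_comm _ c]
    rw [integral_const_mul, hx]
    split_ifs <;> simp

lemma psMatrix_SU2_inv_eq (p : ℝ) (n : ℕ) (k : SU2) :
    psMatrix p n (k⁻¹ : SU2) = (psMatrix p n (conjSU2 k)).transpose := by
  ext a b
  rw [Subgroup.coe_inv, psMatrix_inv, Matrix.conjTranspose_apply, Matrix.transpose_apply,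
    psMatrix_conjSU2]
  rfl

/-- The Weyl element is a real matrix, hence its own complex conjugate. -/
lemma psMatrix_weyl_inv (p : ℝ) (n : ℕ) :
    psMatrix p n (weyl⁻¹ : SU2) = (psMatrix p n weyl).transpose := by
  rw [psMatrix_SU2_inv_eq]
  congr 2
  rw [conjSU2, inv_mul_cancel, one_mul]

/-- A diagonal element commutes with the torus, so its compression is diagonal in the weight basis.
-/
lemma psMatrix_diagSL_transpose (p : ℝ) (n : ℕ) (t : ℂˣ) :
    (psMatrix p n (diagSL t)).transpose = psMatrix p n (diagSL t) := by
  have h : ∀ a b, a ≠ b → psMatrix p n (diagSL t) a b = 0 := fun a b hab => by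
    rw [psMatrix_apply]
    refine inner_ktONB_eq_zero p n (ps p n (diagSL t)) (fun s φ => ?_) hab
    rw [← ps_mul_apply, ← ps_mul_apply, coe_torus, ← diagSL_mul, ← diagSL_mul, mul_comm]
  ext a b
  rw [Matrix.transpose_apply]
  by_cases hab : a = b
  · rw [hab]
  · rw [h a b hab, h b a (Ne.symm hab)]

/-- The compression to the minimal `SU(2)`-type intertwines inversion with transposition. -/
lemma psMatrix_inv_eq_transpose (p : ℝ) (n : ℕ) (g : SL2C) :
    psMatrix p n g⁻¹ =
      psMatrix p n (weyl⁻¹ : SU2) * (psMatrix p n g).transpose * psMatrix p n weyl := by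
  set W := psMatrix p n weyl with hW
  set W' := psMatrix p n (weyl⁻¹ : SU2) with hW'
  have hWW : W * W' = 1 := by
    rw [hW, hW', ← psMatrix_mul_SU2, Subgroup.coe_inv, mul_inv_cancel, psMatrix_one]
  have hU : ∀ k : SU2, psMatrix p n (k⁻¹ : SU2) = W' * (psMatrix p n k).transpose * W := by
    intro k
    rw [psMatrix_SU2_inv_eq, conjSU2, Subgroup.coe_mul, psMatrix_mul_SU2, Subgroup.coe_mul,
      psMatrix_mul_SU2, Matrix.transpose_mul, Matrix.transpose_mul, psMatrix_weyl_inv,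
      Matrix.transpose_transpose, hW', psMatrix_weyl_inv, mul_assoc]
  -- Conjugation by the Weyl element inverts diagonal matrices.
  have hD : ∀ t : ℂˣ, psMatrix p n (diagSL t)⁻¹ =
      W' * (psMatrix p n (diagSL t)).transpose * W := by
    intro t
    have e : (diagSL t)⁻¹ = ((weyl⁻¹ : SU2) : SL2C) * diagSL t * (weyl : SL2C) := by
      rw [Subgroup.coe_inv]
      apply SL2C.ext_entries <;>
        simp [SL2C.mul_entry, SL2C.inv_00, SL2C.inv_01, SL2C.inv_10, SL2C.inv_11, weyl]
    rw [psMatrix_diagSL_transpose, e, psMatrix_mul_SU2, psMatrix_SU2_mul]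
  -- Inversion and transposition both reverse the order of k₁ diag(t) k₂, and the compression is
  -- multiplicative on this product, so the two cases combine.
  obtain ⟨k₁, k₂, t, rfl⟩ := exists_cartan g
  have e : ((k₁ : SL2C) * diagSL t * (k₂ : SL2C))⁻¹ =
      ((k₂⁻¹ : SU2) : SL2C) * (diagSL t)⁻¹ * ((k₁⁻¹ : SU2) : SL2C) := by
    simp [mul_assoc]
  rw [e, psMatrix_mul_SU2, psMatrix_SU2_mul, hU, hU, hD, psMatrix_mul_SU2, psMatrix_SU2_mul,
    Matrix.transpose_mul, Matrix.transpose_mul]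
  simp only [mul_assoc]
  rw [← mul_assoc W W', hWW, one_mul, ← mul_assoc W W', hWW, one_mul]

lemma inv_mem_ktSpace {p : ℝ} {n : ℕ} {f : SL2C → ℂ} (hf : f ∈ ktSpace p n) :
    (fun g => f g⁻¹) ∈ ktSpace p n := by
  induction hf using Submodule.span_induction with
  | mem x hx =>
    obtain ⟨⟨a, b⟩, rfl⟩ := hx
    have h : (fun g : SL2C => psMatrix p n g⁻¹ a b) = ∑ d, ∑ c,
        (psMatrix p n (weyl⁻¹ : SU2) a c * psMatrix p n weyl d b) •
          fun g : SL2C => psMatrix p n g d c := by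
      ext g
      rw [psMatrix_inv_eq_transpose, Matrix.mul_apply, Finset.sum_apply]
      refine Finset.sum_congr rfl fun d _ => ?_
      rw [Matrix.mul_apply, Finset.sum_mul, Finset.sum_apply]
      refine Finset.sum_congr rfl fun c _ => ?_
      rw [Matrix.transpose_apply, Pi.smul_apply, smul_eq_mul]
      ring
    rw [h]
    exact Submodule.sum_mem _ fun d _ => Submodule.sum_mem _ fun c _ =>
      Submodule.smul_mem _ _ (psMatrix_mem_ktSpace p n d c)
  | zero => exact Submodule.zero_mem _
  | add x y _ _ hx hy => exact Submodule.add_mem _ hx hy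
  | smul c x _ hx => exact Submodule.smul_mem _ c hx

/-! ### Finite-dimensional spaces of functions -/

/-- In a finite-dimensional space of functions, a function is recovered linearly from finitely many
of its values. -/
lemma exists_interpolation {α : Type*} (W : Submodule ℂ (α → ℂ)) [FiniteDimensional ℂ W] :
    ∃ (s : Finset α) (e : α → α → ℂ), (∀ x, e x ∈ W) ∧
      ∀ f ∈ W, ∀ y, f y = ∑ x ∈ s, f x * e x y := by
  classical
  let ev : α → Module.Dual ℂ W := fun x => (LinearMap.proj x).comp W.subtype
  have htop : Submodule.span ℂ (Set.range ev) = ⊤ := by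
    rw [← Subspace.dualCoannihilator_dualAnnihilator_eq (W := Submodule.span ℂ (Set.range ev))]
    -- A function killed by every evaluation is zero, so the evaluations span the finite-dimensional
    -- dual.
    have : (Submodule.span ℂ (Set.range ev)).dualCoannihilator = ⊥ := by
      rw [eq_bot_iff]
      intro f hf
      rw [Submodule.mem_dualCoannihilator] at hf
      apply Subtype.ext
      ext x
      exact hf (ev x) (Submodule.subset_span ⟨x, rfl⟩)
    rw [this, Submodule.dualAnnihilator_bot]
  let b := Module.finBasis ℂ W
  have hc : ∀ i, ∃ a : α →₀ ℂ, a.sum (fun x r => r • ev x) = b.coord i := fun i => by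
    have h : b.coord i ∈ Submodule.span ℂ (Set.range ev) := by rw [htop]; trivial
    exact Finsupp.mem_span_range_iff_exists_finsupp.1 h
  choose a ha using hc
  refine ⟨Finset.univ.biUnion fun i => (a i).support,
    fun x y => ∑ i, a i x * (b i : α → ℂ) y, fun x => ?_, fun f hf y => ?_⟩
  · have : (fun y => ∑ i, a i x * (b i : α → ℂ) y) = ∑ i, a i x • (b i : α → ℂ) := by
      ext y
      simp
    simp only [this]
    exact Submodule.sum_mem _ fun i _ => Submodule.smul_mem _ _ (b i).2
  · have h1 : f y = ∑ i, b.coord i ⟨f, hf⟩ * (b i : α → ℂ) y := by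
      have h2 := congrArg (fun w : W => (w : α → ℂ) y) (b.sum_repr ⟨f, hf⟩)
      simp only [Submodule.coe_sum, Submodule.coe_smul, Finset.sum_apply, Pi.smul_apply,
        smul_eq_mul] at h2
      exact h2.symm
    have h3 : ∀ i, b.coord i ⟨f, hf⟩ =
        ∑ x ∈ Finset.univ.biUnion fun i => (a i).support, a i x * f x := by
      intro i
      rw [← ha i, Finsupp.sum, LinearMap.sum_apply]
      refine (Finset.sum_subset (Finset.subset_biUnion_of_mem (fun i => (a i).support)
        (Finset.mem_univ i)) fun x _ hx => ?_)
      simp [Finsupp.notMem_support_iff.1 hx]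
    rw [h1]
    simp only [h3, Finset.sum_mul, Finset.mul_sum]
    rw [Finset.sum_comm]
    exact Finset.sum_congr rfl fun x _ => Finset.sum_congr rfl fun i _ => by ring

/-- A finite-dimensional space of functions is closed under pointwise integrals. -/
lemma integral_mem_of_finiteDimensional {α X : Type*} [MeasurableSpace X] {μ : Measure X}
    (W : Submodule ℂ (α → ℂ)) [FiniteDimensional ℂ W] {f : X → α → ℂ} (hf : ∀ x, f x ∈ W)
    (hint : ∀ y, Integrable (fun x => f x y) μ) : (fun y => ∫ x, f x y ∂μ) ∈ W := by
  obtain ⟨s, e, he, hs⟩ := exists_interpolation W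
  have h : (fun y => ∫ x, f x y ∂μ) = ∑ z ∈ s, (∫ x, f x z ∂μ) • e z := by
    ext y
    rw [Finset.sum_apply]
    simp only [Pi.smul_apply, smul_eq_mul]
    simp_rw [hs _ (hf _) y, ← integral_mul_const]
    exact integral_finsetSum _ fun z _ => (hint z).mul_const _
  rw [h]
  exact Submodule.sum_mem _ fun z _ => Submodule.smul_mem _ _ (he z)

/-- A function of several variables that lies in finite-dimensional spaces in each variable
separately is a linear combination of products. -/
lemma mem_span_prod_of_forall_update {L α : Type*} [Fintype L] [DecidableEq L]
    (W : L → Submodule ℂ (α → ℂ)) [∀ l, FiniteDimensional ℂ (W l)] {B : (L → α) → ℂ}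
    (hB : ∀ l g, (fun x => B (Function.update g l x)) ∈ W l) :
    B ∈ Submodule.span ℂ {P : (L → α) → ℂ | ∃ e : L → α → ℂ, (∀ l, e l ∈ W l) ∧
      P = fun g => ∏ l, e l (g l)} := by
  have key : ∀ (S : Finset L) (g₀ : L → α), (fun g => B (S.piecewise g g₀)) ∈
      Submodule.span ℂ {P : (L → α) → ℂ | ∃ e : L → α → ℂ, (∀ l, e l ∈ W l) ∧
        P = fun g => ∏ l ∈ S, e l (g l)} := by
    intro S
    induction S using Finset.induction_on with
    | empty =>
      intro g₀
      have : (fun g : L → α => B ((∅ : Finset L).piecewise g g₀)) =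
          B g₀ • fun g : L → α => ∏ l ∈ (∅ : Finset L), (0 : α → ℂ) (g l) := by
        ext g
        simp
      rw [this]
      exact Submodule.smul_mem _ _ (Submodule.subset_span
        ⟨fun _ => 0, fun l => Submodule.zero_mem _, rfl⟩)
    | insert l S hl ih =>
      intro g₀
      -- Interpolation in the variable l replaces it by finitely many sample points x, absorbed into
      -- the base point.
      obtain ⟨s, e, he, hs⟩ := exists_interpolation (W l)
      have h1 : (fun g : L → α => B ((insert l S).piecewise g g₀)) =
          ∑ x ∈ s, fun g => e x (g l) * B (S.piecewise g (Function.update g₀ l x)) := by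
        ext g
        rw [Finset.piecewise_insert, hs _ (hB l (S.piecewise g g₀)) (g l), Finset.sum_apply]
        refine Finset.sum_congr rfl fun x _ => ?_
        rw [mul_comm, Finset.update_piecewise_of_notMem (hi := hl)]
      rw [h1]
      refine Submodule.sum_mem _ fun x _ => ?_
      generalize hF : (fun g => B (S.piecewise g (Function.update g₀ l x))) = F
      have hF' : F ∈ _ := hF ▸ ih (Function.update g₀ l x)
      have h2 : (fun g => e x (g l) * B (S.piecewise g (Function.update g₀ l x))) =
          fun g => e x (g l) * F g := by rw [← hF]
      rw [h2]
      clear h2 hF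
      induction hF' using Submodule.span_induction with
      | mem P hP =>
        obtain ⟨e', he', rfl⟩ := hP
        refine Submodule.subset_span ⟨Function.update e' l (e x), fun l' => ?_, ?_⟩
        · by_cases h : l' = l
          · subst h
            simpa using he x
          · simpa [h] using he' l'
        · ext g
          rw [Finset.prod_insert hl, Function.update_self]
          congr 1
          refine Finset.prod_congr rfl fun l' hl' => ?_
          rw [Function.update_of_ne (by rintro rfl; exact hl hl')]
      | zero =>
        have : (fun g : L → α => e x (g l) * (0 : (L → α) → ℂ) g) = 0 := by
          ext g; simp
        rw [this]
        exact Submodule.zero_mem _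
      | add P Q _ _ hP hQ =>
        have : (fun g : L → α => e x (g l) * (P + Q) g) =
            (fun g => e x (g l) * P g) + fun g => e x (g l) * Q g := by
          ext g; simp [mul_add]
        rw [this]
        exact Submodule.add_mem _ hP hQ
      | smul c P _ hP =>
        have : (fun g : L → α => e x (g l) * (c • P) g) = c • fun g => e x (g l) * P g := by
          ext g; simp [mul_left_comm]
        rw [this]
        exact Submodule.smul_mem _ c hP
  by_cases hα : Nonempty (L → α)
  · obtain ⟨g₀⟩ := hα
    simpa using key Finset.univ g₀
  · have : B = 0 := by
      ext g
      exact absurd ⟨g⟩ hα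
    rw [this]
    exact Submodule.zero_mem _

/-! ### Products of averaged operators -/

lemma measurable_ofFn_prod {m : ℕ} {G : Fin m → SU2 → SL2C} (hG : ∀ i, Measurable (G i)) :
    Measurable fun h : Fin m → SU2 => (List.ofFn fun i => G i (h i)).prod := by
  induction m with
  | zero => simp
  | succ m ih =>
    simp only [List.ofFn_succ, List.prod_cons]
    have h1 : Measurable fun h : Fin (m + 1) → SU2 => fun i : Fin m => h i.succ :=
      measurable_pi_lambda _ fun i => measurable_pi_apply _
    exact ((hG 0).comp (measurable_pi_apply 0)).mul ((ih fun i => hG i.succ).comp h1)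

lemma integrable_prod_mul_inner_ps (p : ℝ) (n : ℕ) {m : ℕ} {w : Fin m → SU2 → ℂ}
    {G : Fin m → SU2 → SL2C} (hw : ∀ i, Continuous (w i)) (hG : ∀ i, Measurable (G i))
    (φ ψ : L2C) :
    Integrable (fun h : Fin m → SU2 => (∏ i, w i (h i)) *
      inner ℂ ψ (ps p n (List.ofFn fun i => G i (h i)).prod φ))
      (Measure.pi fun _ : Fin m => haarSU2) := by
  choose B hB using fun i => exists_bound_continuous_SU2 (hw i)
  refine Integrable.of_bound (Measurable.aestronglyMeasurable ?_) ((∏ i, B i) * (‖ψ‖ * ‖φ‖))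
    (Filter.Eventually.of_forall fun h => ?_)
  · exact (Finset.measurable_prod _ fun i _ => (hw i).measurable.comp (measurable_pi_apply i)).mul
      ((measurable_inner_ps p n ψ φ).comp (measurable_ofFn_prod hG))
  · rw [norm_mul, norm_prod]
    exact mul_le_mul (Finset.prod_le_prod (fun i _ => norm_nonneg _) fun i _ => hB i _)
      (norm_inner_ps_le _ _ _ _ _) (norm_nonneg _)
      (Finset.prod_nonneg fun i _ => (norm_nonneg _).trans (hB i 1))

/-- The average of a product over independent variables is the product of the averages. -/
lemma integral_prod_mul_inner_ps (p : ℝ) (n : ℕ) {m : ℕ} {w : Fin m → SU2 → ℂ}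
    {G : Fin m → SU2 → SL2C} {R : Fin m → L2C →L[ℂ] L2C} (hw : ∀ i, Continuous (w i))
    (hG : ∀ i, Measurable (G i))
    (hR : ∀ i φ ψ, ∫ k, w i k * inner ℂ ψ (ps p n (G i k) φ) ∂haarSU2 = inner ℂ ψ (R i φ))
    (φ ψ : L2C) :
    ∫ h : Fin m → SU2, (∏ i, w i (h i)) *
      inner ℂ ψ (ps p n (List.ofFn fun i => G i (h i)).prod φ)
      ∂(Measure.pi fun _ : Fin m => haarSU2) = inner ℂ ψ ((List.ofFn R).prod φ) := by
  induction m generalizing ψ with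
  | zero => simp
  | succ m ih =>
    have mp := (measurePreserving_piFinSuccAbove (fun _ : Fin (m + 1) => haarSU2) 0).symm
    have hint := mp.integrable_comp_of_integrable (integrable_prod_mul_inner_ps p n hw hG φ ψ)
    rw [← mp.integral_comp']
    refine (integral_prod _ hint).trans ?_
    have e0 : ∀ (x : SU2) (y : Fin m → SU2),
        (MeasurableEquiv.piFinSuccAbove (fun _ : Fin (m + 1) => SU2) 0).symm (x, y) 0 = x :=
      fun x y => rfl
    have e1 : ∀ (x : SU2) (y : Fin m → SU2) (i : Fin m),
        (MeasurableEquiv.piFinSuccAbove (fun _ : Fin (m + 1) => SU2) 0).symm (x, y) i.succ = y i :=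
      fun x y i => rfl
    have h1 : ∀ x : SU2, ∫ y : Fin m → SU2,
        (∏ i, w i ((MeasurableEquiv.piFinSuccAbove (fun _ : Fin (m + 1) => SU2) 0).symm (x, y) i)) *
        inner ℂ ψ (ps p n (List.ofFn fun i => G i
          ((MeasurableEquiv.piFinSuccAbove (fun _ : Fin (m + 1) => SU2) 0).symm (x, y) i)).prod φ)
          ∂(Measure.pi fun _ : Fin m => haarSU2) =
        w 0 x * inner ℂ ψ (ps p n (G 0 x) ((List.ofFn fun i : Fin m => R i.succ).prod φ)) := by
      intro x
      simp only [Fin.prod_univ_succ, List.ofFn_succ, List.prod_cons, e0, e1, ps_mul_apply,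
        mul_assoc]
      rw [integral_const_mul]
      congr 1
      -- The first factor is moved to the other side of the inner product, which is why the
      -- induction keeps ψ general.
      rw [inner_ps_right, ← ih (fun i => hw i.succ) (fun i => hG i.succ) (fun i => hR i.succ)]
      congr 1
      ext y
      rw [inner_ps_right p n (G 0 x)]
    rw [List.ofFn_succ, List.prod_cons]
    change _ = inner ℂ ψ (R 0 ((List.ofFn fun i : Fin m => R i.succ).prod φ))
    rw [← hR 0]
    exact integral_congr_ae (Filter.Eventually.of_forall h1)

/-- Splitting a cyclic product at one factor whose two neighbours absorb an element `P`. -/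
lemma exists_split_ofFn {M : Type*} [Monoid M] {m : ℕ} (Y : Fin m → M) (P : M) (i₀ : Fin m)
    (hne : finRotate m i₀ ≠ i₀) (hnext : P * Y (finRotate m i₀) = Y (finRotate m i₀))
    (hprev : ∀ i, finRotate m i = i₀ → Y i * P = Y i) :
    ∃ A C : M, (∀ Z, (List.ofFn (Function.update Y i₀ Z)).prod = A * Z * C) ∧
      C * A * P = C * A ∧ (P * C = C ∨ (C = 1 ∧ P * A = A)) := by
  obtain ⟨m, rfl⟩ : ∃ k, m = k + 1 := ⟨m - 1, by have := i₀.2; omega⟩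
  -- A cycle of length one would make the factor its own neighbour.
  have hm : 0 < m := by
    rcases Nat.eq_zero_or_pos m with rfl | h
    · exact absurd (Subsingleton.elim (α := Fin 1) _ _) hne
    · exact h
  set l := List.ofFn Y with hl
  have hlen : l.length = m + 1 := by simp [hl]
  have hget : ∀ (i : ℕ) (h : i < l.length), l[i] = Y ⟨i, hlen ▸ h⟩ := by
    intro i h
    exact List.getElem_ofFn (f := Y) _
  refine ⟨(l.take i₀).prod, (l.drop (i₀ + 1)).prod, fun Z => ?_, ?_, ?_⟩
  · have : List.ofFn (Function.update Y i₀ Z) = l.set i₀ Z := by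
      apply List.ext_getElem
      · simp [hl]
      · intro i h1 h2
        rw [List.getElem_set]
        by_cases h : (i₀ : ℕ) = i
        · subst h
          rw [if_pos rfl, List.getElem_ofFn]
          exact Function.update_self _ _ _
        · rw [if_neg h, hget, List.getElem_ofFn, Function.update_of_ne]
          intro h'
          exact h (congrArg Fin.val h').symm
    rw [this, List.prod_set, if_pos (by rw [hlen]; exact i₀.2)]
  -- The last factor of C A is the cyclic predecessor of i₀: it ends C if i₀ = 0, and A otherwise.
  · rcases Nat.eq_zero_or_pos (i₀ : ℕ) with h0 | h0
    · rw [h0, List.take_zero, List.prod_nil, mul_one]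
      have hnil : l.drop (0 + 1) ≠ [] := by
        rw [ne_eq, List.drop_eq_nil_iff, hlen]
        omega
      rw [← List.dropLast_concat_getLast hnil, List.prod_append, List.prod_singleton,
        List.getLast_drop, List.getLast_eq_getElem, hget, mul_assoc, hprev]
      apply Fin.ext
      rw [h0]
      have : (⟨l.length - 1, by omega⟩ : Fin (m + 1)) = Fin.last m := by
        apply Fin.ext; simp [hlen]
      rw [this, finRotate_last]
      rfl
    · have h1 : (i₀ : ℕ) = (i₀ - 1 : ℕ) + 1 := by omega
      have h2 : (i₀ - 1 : ℕ) < l.length := by have := i₀.2; omega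
      have h3 : (l.take i₀).prod = (l.take (i₀ - 1 : ℕ)).prod * l[(i₀ - 1 : ℕ)] := by
        conv_lhs => rw [h1]
        exact List.prod_take_succ _ _ h2
      rw [h3, hget, mul_assoc, mul_assoc, hprev]
      apply Fin.ext
      rw [coe_finRotate_of_ne_last]
      · exact h1.symm
      · intro h
        have := congrArg Fin.val h
        simp only [Fin.val_last] at this
        have := i₀.2
        omega
  -- The cyclic successor of i₀ heads C, unless i₀ is last; then C = 1 and the successor heads A.
  · by_cases hlast : i₀ = Fin.last m
    · right
      refine ⟨?_, ?_⟩
      · rw [List.drop_eq_nil_of_le, List.prod_nil]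
        rw [hlen, hlast, Fin.val_last]
      · have h1 : l = l[0]'(by omega) :: l.drop 1 := by
          have := List.drop_eq_getElem_cons (i := 0) (l := l) (by omega)
          simpa using this
        have h2 : l.take i₀ = l[0]'(by omega) :: (l.drop 1).take (i₀ - 1 : ℕ) := by
          have h3 : (i₀ : ℕ) = (i₀ - 1 : ℕ) + 1 := by
            rw [hlast, Fin.val_last]; omega
          conv_lhs => rw [h1, h3]
          rw [List.take_succ_cons]
        rw [h2, List.prod_cons, ← mul_assoc, hget]
        congr 1
        rw [hlast, finRotate_last] at hnext
        exact hnext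
    · left
      have h1 : (i₀ : ℕ) + 1 < l.length := by
        have := Fin.val_lt_last hlast
        omega
      rw [List.drop_eq_getElem_cons h1, List.prod_cons, ← mul_assoc, hget]
      congr 1
      have : (⟨(i₀ : ℕ) + 1, by omega⟩ : Fin (m + 1)) = finRotate (m + 1) i₀ := by
        apply Fin.ext
        rw [coe_finRotate_of_ne_last hlast]
      rw [this, hnext]

/-- The trace of a cyclic product, as a function of one factor. -/
lemma exists_opTrace_ofFn (p : ℝ) (n : ℕ) {m : ℕ} (Y : Fin m → L2C →L[ℂ] L2C) (i₀ : Fin m)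
    (hne : finRotate m i₀ ≠ i₀)
    (hnext : ktProj p n * Y (finRotate m i₀) = Y (finRotate m i₀))
    (hprev : ∀ i, finRotate m i = i₀ → Y i * ktProj p n = Y i) :
    ∃ x : Fin (n + 1) → Fin (n + 1) → ℂ, ∀ g : SL2C,
      opTrace (List.ofFn (Function.update Y i₀ (ps p n g))).prod =
        ∑ i, ∑ c, x i c * psMatrix p n g c i := by
  obtain ⟨A, C, h1, h2, h3⟩ := exists_split_ofFn Y (ktProj p n) i₀ hne hnext hprev
  refine ⟨fun i c => inner ℂ (ktONB p n i) ((C * A) (ktONB p n c)), fun g => ?_⟩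
  have h4 : opTrace (A * ps p n g * C) =
      ∑ i, inner ℂ (ktONB p n i) ((C * A) (ps p n g (ktONB p n i))) := by
    -- The trace can be expanded only at a P inside the product. It is taken from the head of C, or
    -- from the head of A when C = 1; both give the same finite sum.
    rcases h3 with h3 | ⟨rfl, h3⟩
    · rw [← h3, ← mul_assoc, opTrace_mul_ktProj_mul]
      simp only [h3]
      rfl
    · rw [← h3, mul_one, mul_assoc, ← one_mul (ktProj p n), mul_assoc, ← mul_assoc,
        opTrace_mul_ktProj_mul]
      simp only [one_mul, h3]
      rfl
  rw [h1, h4]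
  refine Finset.sum_congr rfl fun i _ => ?_
  -- Since C A = C A P, a second P stands to the left of D(g), and only its compression enters.
  rw [← h2]
  change inner ℂ _ ((C * A) (ktProj p n (ps p n g (ktONB p n i)))) = _
  rw [ktProj_apply, map_sum, inner_sum]
  refine Finset.sum_congr rfl fun c _ => ?_
  rw [map_smul, inner_smul_right, h2, mul_comm]
  rfl

/-! ### Face factors as traces -/

namespace TwoComplex

variable {V N E L F : Type*} {C : TwoComplex V N E L F}

/-- The group element of a side, with its sign, as a function of the variable `h_{ef}`. -/
def signedSide (φ : C.GaugeFixing) (x : φ.Free → SL2C) (g : L → SL2C) (f : F)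
    (i : Fin (C.len f)) (k : SU2) : SL2C :=
  if (C.side f i).2 then
    Sum.elim (fun e => φ.value x (e, false) * (k : SL2C) * (φ.value x (e, true))⁻¹) g (C.side f i).1
  else
    (Sum.elim (fun e => φ.value x (e, false) * (k : SL2C) * (φ.value x (e, true))⁻¹) g
      (C.side f i).1)⁻¹

/-- The weight of a side in the face integral. -/
def sideWeight (C : TwoComplex V N E L F) (f : F) (n : ℕ) (i : Fin (C.len f)) (k : SU2) : ℂ :=
  if (C.side f i).1.isLeft = true then chiSU2 n k else 1

/-- The operator obtained by integrating out the variable `h_{ef}` of a side. -/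
def sideOp (p : ℝ) (n : ℕ) (φ : C.GaugeFixing) (x : φ.Free → SL2C) (g : L → SL2C) (f : F)
    (i : Fin (C.len f)) : L2C →L[ℂ] L2C :=
  Sum.elim
    (fun e => ((n : ℂ) + 1)⁻¹ • (ps p n (φ.value x (e, !(C.side f i).2)) * ktProj p n *
      ps p n (φ.value x (e, (C.side f i).2))⁻¹))
    (fun l => ps p n (if (C.side f i).2 then g l else (g l)⁻¹)) (C.side f i).1

lemma continuous_sideWeight (f : F) (n : ℕ) (i : Fin (C.len f)) :
    Continuous (C.sideWeight f n i) := by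
  unfold sideWeight
  split_ifs
  · exact continuous_chiSU2 n
  · exact continuous_const

lemma measurable_signedSide (φ : C.GaugeFixing) (x : φ.Free → SL2C) (g : L → SL2C) (f : F)
    (i : Fin (C.len f)) : Measurable (signedSide φ x g f i) := by
  have h : Continuous fun k : SU2 => (Sum.elim (fun e => φ.value x (e, false) * (k : SL2C) *
      (φ.value x (e, true))⁻¹) g (C.side f i).1 : SL2C) := by
    rcases (C.side f i).1 with e | l
    · exact (continuous_const.mul continuous_subtype_val).mul continuous_const
    · exact continuous_const
  unfold signedSide
  split_ifs
  · exact h.measurable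
  · exact h.inv.measurable

lemma integral_chiSU2_ps_mul (p : ℝ) (n : ℕ) (a b : SL2C) (η ψ : L2C) :
    ∫ k : SU2, chiSU2 n k * inner ℂ ψ (ps p n (a * k * b) η) ∂haarSU2 =
      inner ℂ ψ ((((n : ℂ) + 1)⁻¹ • (ps p n a * ktProj p n * ps p n b)) η) := by
  have hn : (n : ℂ) + 1 ≠ 0 := by exact_mod_cast Nat.succ_ne_zero n
  simp only [ps_mul_apply]
  have h1 : ∀ k : SU2, inner ℂ ψ (ps p n a (ps p n k (ps p n b η))) =
      inner ℂ (ps p n a⁻¹ ψ) (ps p n k (ps p n b η)) := fun k => inner_ps_right _ _ _ _ _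
  simp only [h1]
  change _ = inner ℂ ψ (((n : ℂ) + 1)⁻¹ • ps p n a (ktProj p n (ps p n b η)))
  rw [inner_smul_right, inner_ps_right p n a, ← integral_chiSU2_ps, inv_mul_cancel_left₀ hn]

lemma integral_sideWeight (p : ℝ) (n : ℕ) (φ : C.GaugeFixing) (x : φ.Free → SL2C) (g : L → SL2C)
    (f : F) (i : Fin (C.len f)) (η ψ : L2C) :
    ∫ k, C.sideWeight f n i k * inner ℂ ψ (ps p n (signedSide φ x g f i k) η) ∂haarSU2 =
      inner ℂ ψ (sideOp p n φ x g f i η) := by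
  unfold sideWeight signedSide sideOp
  rcases (C.side f i) with ⟨e | l, ε⟩
  · cases ε
    · simp only [Sum.isLeft_inl, Bool.false_eq_true, if_true, if_false, Sum.elim_inl, Bool.not_false,
        mul_inv_rev, inv_inv]
      -- On a reversed side h_{ef}⁻¹ appears; inversion preserves both Haar measure and the
      -- character.
      rw [← integral_inv_eq_self]
      simp only [chiSU2_inv, Subgroup.coe_inv, inv_inv, ← mul_assoc]
      exact integral_chiSU2_ps_mul p n _ _ η ψ
    · simp only [Sum.isLeft_inl, if_true, Sum.elim_inl, Bool.not_true]
      exact integral_chiSU2_ps_mul p n _ _ η ψ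
  · simp

lemma faceHolonomy_eq (φ : C.GaugeFixing) (x : φ.Free → SL2C) (g : L → SL2C) (f : F)
    (h : Fin (C.len f) → SU2) :
    faceHolonomy φ x g f (fun i => h i.1) =
      (List.ofFn fun i => signedSide φ x g f i (h i)).prod := by
  unfold faceHolonomy
  congr 2
  ext1 i
  have hs : sideElement φ x g f (fun i => h i.1) i = Sum.elim (fun e => φ.value x (e, false) *
      (h i : SL2C) * (φ.value x (e, true))⁻¹) g (C.side f i).1 := by
    unfold sideElement
    split <;> rename_i hs
    · exact (congrArg (Sum.elim (fun e => φ.value x (e, false) * (h i : SL2C) *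
        (φ.value x (e, true))⁻¹) g) hs).symm
    · exact (congrArg (Sum.elim (fun e => φ.value x (e, false) * (h i : SL2C) *
        (φ.value x (e, true))⁻¹) g) hs).symm
  rw [hs]
  rfl

lemma prod_sideWeight (f : F) (n : ℕ) (h : Fin (C.len f) → SU2) :
    ∏ i : C.BulkSide f, chiSU2 n (h i.1) = ∏ i, C.sideWeight f n i (h i) := by
  unfold sideWeight
  rw [Finset.prod_ite, Finset.prod_const_one, mul_one]
  exact (Finset.prod_subtype _ (fun i => by simp) (fun i => chiSU2 n (h i))).symm

/-- Every link side receives a dummy variable, integrated with total mass 1, so that all sides of a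
face can be treated alike. -/
lemma integral_bulkSide (f : F) (G : (C.BulkSide f → SU2) → ℂ) :
    ∫ h, G h ∂(Measure.pi fun _ : C.BulkSide f => haarSU2) =
      ∫ h : Fin (C.len f) → SU2, G (fun i => h i.1)
        ∂(Measure.pi fun _ : Fin (C.len f) => haarSU2) := by
  have mp := measurePreserving_piEquivPiSubtypeProd (fun _ : Fin (C.len f) => haarSU2)
    (fun i => (C.side f i).1.isLeft = true)
  have h1 := integral_fun_fst (μ := Measure.pi fun _ : C.BulkSide f => haarSU2)
    (ν := Measure.pi fun _ : {i : Fin (C.len f) // ¬ (C.side f i).1.isLeft = true} => haarSU2) G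
  rw [probReal_univ, one_smul] at h1
  exact h1.symm.trans (mp.integral_comp' _).symm

lemma faceFactor_eq (γ : ℝ) (φ : C.GaugeFixing) (x : φ.Free → SL2C) (g : L → SL2C) (f : F)
    (n : ℕ) : faceFactor γ φ x g f n = ((n : ℂ) + 1) *
      opTrace (List.ofFn (sideOp (γ * ((n : ℝ) / 2)) n φ x g f)).prod := by
  unfold faceFactor characterIntegral opTrace
  congr 1
  refine tsum_congr fun b => ?_
  rw [integral_bulkSide]
  simp only [prod_sideWeight, faceHolonomy_eq, matrixElement_eq_inner]
  exact integral_prod_mul_inner_ps _ n (continuous_sideWeight f n)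
    (measurable_signedSide φ x g f) (integral_sideWeight _ n φ x g f) _ _

lemma value_eq_one {φ : C.GaugeFixing} (x : φ.Free → SL2C) {q : E × Bool} {m : N}
    (hq : C.endpoint q = Sum.inr m) : φ.value x q = 1 := by
  unfold GaugeFixing.value
  rw [dif_neg]
  rintro ⟨⟨v, hv⟩, -⟩
  rw [hq] at hv
  exact absurd hv (by simp)

/-- The side after a boundary link starts with the projection. -/
lemma ktProj_mul_sideOp (p : ℝ) (n : ℕ) (φ : C.GaugeFixing) (x : φ.Free → SL2C) (g : L → SL2C)
    (f : F) (i : Fin (C.len f)) {l : L} (hl : (C.side f i).1 = Sum.inr l) :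
    ktProj p n * sideOp p n φ x g f (finRotate _ i) = sideOp p n φ x g f (finRotate _ i) := by
  have hcl := C.closed f i
  have hnl := C.not_link_link f i
  unfold sideOp
  rcases hs : C.side f i with ⟨s, ε⟩
  rw [hs] at hcl hnl hl
  rcases hs' : C.side f (finRotate _ i) with ⟨e | l', ε'⟩
  · rw [hs'] at hcl
    simp only at hl
    subst hl
    -- The link ends at a node and the face is closed, so the next side starts there, where the
    -- half-edge carries the identity. The operator of that side thus begins with P, and P² = P.
    have hv : φ.value x (e, !ε') = 1 := by
      obtain ⟨m, hm⟩ : ∃ m : N, (if ε then Sum.elim C.tgt (fun l => Sum.inr (C.linkTgt l))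
          (Sum.inr l) else Sum.elim C.src (fun l => Sum.inr (C.linkSrc l)) (Sum.inr l)) =
            (Sum.inr m : V ⊕ N) := by
        cases ε
        · exact ⟨_, rfl⟩
        · exact ⟨_, rfl⟩
      refine value_eq_one x (m := m) ?_
      rw [← hm]
      refine Eq.trans ?_ hcl.symm
      cases ε' <;> rfl
    simp only [Sum.elim_inl, hv, map_one, one_mul]
    rw [mul_smul_comm, ← mul_assoc, ktProj_mul_self]
  · rw [hs'] at hnl
    simp only at hl
    subst hl
    simp at hnl

/-- The side before a boundary link ends with the projection. -/
lemma sideOp_mul_ktProj (p : ℝ) (n : ℕ) (φ : C.GaugeFixing) (x : φ.Free → SL2C) (g : L → SL2C)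
    (f : F) (i : Fin (C.len f)) {l : L} (hl : (C.side f (finRotate _ i)).1 = Sum.inr l) :
    sideOp p n φ x g f i * ktProj p n = sideOp p n φ x g f i := by
  have hcl := C.closed f i
  have hnl := C.not_link_link f i
  unfold sideOp
  rcases hs : C.side f (finRotate _ i) with ⟨s, ε⟩
  rw [hs] at hcl hnl hl
  rcases hs' : C.side f i with ⟨e | l', ε'⟩
  · rw [hs'] at hcl
    simp only at hl
    subst hl
    -- Likewise the preceding side ends at the node where the link is entered.
    have hv : φ.value x (e, ε') = 1 := by
      obtain ⟨m, hm⟩ : ∃ m : N, (if ε then Sum.elim C.src (fun l => Sum.inr (C.linkSrc l))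
          (Sum.inr l) else Sum.elim C.tgt (fun l => Sum.inr (C.linkTgt l)) (Sum.inr l)) =
            (Sum.inr m : V ⊕ N) := by
        cases ε
        · exact ⟨_, rfl⟩
        · exact ⟨_, rfl⟩
      refine value_eq_one x (m := m) ?_
      rw [← hm]
      refine Eq.trans ?_ hcl
      cases ε' <;> rfl
    simp only [Sum.elim_inl, hv, inv_one, map_one, mul_one]
    rw [smul_mul_assoc, mul_assoc, ktProj_mul_self]
  · rw [hs'] at hnl
    simp only at hl
    subst hl
    simp at hnl

lemma sideOp_update_of_ne [DecidableEq L] (p : ℝ) (n : ℕ) (φ : C.GaugeFixing) (x : φ.Free → SL2C)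
    (g : L → SL2C) (l : L) (y : SL2C) (f : F) (i : Fin (C.len f))
    (hi : (C.side f i).1 ≠ Sum.inr l) :
    sideOp p n φ x (Function.update g l y) f i = sideOp p n φ x g f i := by
  unfold sideOp
  rcases hs : (C.side f i).1 with e | l'
  · rw [Sum.elim_inl, Sum.elim_inl]
  · have : l' ≠ l := fun h => hi (by rw [hs, h])
    rw [Sum.elim_inr, Sum.elim_inr, Function.update_of_ne this]

/-- The face factor of the face at a boundary link is a matrix coefficient in the link variable. -/
lemma faceFactor_update_mem [DecidableEq L] (γ : ℝ) (φ : C.GaugeFixing) (x : φ.Free → SL2C)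
    (g : L → SL2C) (l : L) (f : F) (i : Fin (C.len f)) (hi : (C.side f i).1 = Sum.inr l) (n : ℕ) :
    (fun y => faceFactor γ φ x (Function.update g l y) f n) ∈ ktSpace (γ * ((n : ℝ) / 2)) n := by
  set p := γ * ((n : ℝ) / 2) with hp
  have huniq : ∀ i', i' ≠ i → (C.side f i').1 ≠ Sum.inr l := by
    intro i' hne h
    obtain ⟨q, -, hq⟩ := C.link_unique l
    have h1 := (hq ⟨f, i'⟩ h).trans (hq ⟨f, i⟩ hi).symm
    simp only [Sigma.mk.injEq, heq_eq_eq, true_and] at h1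
    exact hne h1
  -- A face whose only side is a link would have a link following a link.
  have hne : finRotate _ i ≠ i := by
    intro h
    have := C.not_link_link f i
    rw [h, hi] at this
    simp at this
  obtain ⟨c, hc⟩ := exists_opTrace_ofFn p n (sideOp p n φ x g f) i hne
    (ktProj_mul_sideOp p n φ x g f i hi)
    (fun i' hi' => sideOp_mul_ktProj p n φ x g f i' (hi' ▸ hi))
  have hop : ∀ y, sideOp p n φ x (Function.update g l y) f = Function.update
      (sideOp p n φ x g f) i (ps p n (if (C.side f i).2 then y else y⁻¹)) := by
    intro y
    ext1 i'
    by_cases h : i' = i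
    · subst h
      rw [Function.update_self]
      unfold sideOp
      rw [hi]
      simp
    · rw [Function.update_of_ne h, sideOp_update_of_ne _ _ _ _ _ _ _ _ _ (huniq i' h)]
  have hfun : (fun y => ((n : ℂ) + 1) * ∑ i, ∑ d, c i d * psMatrix p n y d i) ∈ ktSpace p n := by
    have : (fun y => ((n : ℂ) + 1) * ∑ i, ∑ d, c i d * psMatrix p n y d i) =
        ((n : ℂ) + 1) • ∑ i, ∑ d, c i d • fun y => psMatrix p n y d i := by
      ext y
      simp [Finset.sum_apply]
    rw [this]
    exact Submodule.smul_mem _ _ (Submodule.sum_mem _ fun i _ => Submodule.sum_mem _ fun d _ =>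
      Submodule.smul_mem _ _ (psMatrix_mem_ktSpace p n d i))
  have heq : ∀ y, faceFactor γ φ x (Function.update g l y) f n = ((n : ℂ) + 1) *
      ∑ i', ∑ d, c i' d * psMatrix p n (if (C.side f i).2 then y else y⁻¹) d i' := by
    intro y
    rw [faceFactor_eq, hop, hc]
  simp only [heq]
  by_cases h : (C.side f i).2 = true
  · simpa only [h, if_true] using hfun
  · simpa only [if_neg h] using inv_mem_ktSpace hfun

lemma faceFactor_update_of_ne [DecidableEq L] (γ : ℝ) (φ : C.GaugeFixing) (x : φ.Free → SL2C)
    (g : L → SL2C) (l : L) (y : SL2C) (f : F) (hf : ∀ i, (C.side f i).1 ≠ Sum.inr l) (n : ℕ) :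
    faceFactor γ φ x (Function.update g l y) f n = faceFactor γ φ x g f n := by
  rw [faceFactor_eq, faceFactor_eq]
  congr 4
  ext1 i
  exact sideOp_update_of_ne _ _ _ _ _ _ _ _ _ (hf i)

/-- The face of a boundary link. -/
def linkFace (C : TwoComplex V N E L F) (l : L) : F := (C.link_unique l).choose.1

lemma exists_side_linkFace (l : L) : ∃ i, (C.side (C.linkFace l) i).1 = Sum.inr l :=
  ⟨_, (C.link_unique l).choose_spec.1⟩

lemma side_ne_of_ne_linkFace {l : L} {f : F} (hf : f ≠ C.linkFace l) (i : Fin (C.len f)) :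
    (C.side f i).1 ≠ Sum.inr l := by
  intro h
  have h1 := (C.link_unique l).choose_spec.2 ⟨f, i⟩ h
  exact hf (congrArg Sigma.fst h1)

/-- Only the face of l sees the variable on l; the other factors are constants. -/
lemma prod_faceFactor_update_mem [Fintype F] [DecidableEq L] (γ : ℝ) (φ : C.GaugeFixing)
    (x : φ.Free → SL2C) (g : L → SL2C) (l : L) (j : F → ℕ) :
    (fun y => ∏ f, faceFactor γ φ x (Function.update g l y) f (j f)) ∈
      ktSpace (γ * ((j (C.linkFace l) : ℝ) / 2)) (j (C.linkFace l)) := by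
  classical
  obtain ⟨i, hi⟩ := exists_side_linkFace (C := C) l
  have h : (fun y => ∏ f, faceFactor γ φ x (Function.update g l y) f (j f)) =
      (∏ f ∈ Finset.univ.erase (C.linkFace l), faceFactor γ φ x g f (j f)) •
        fun y => faceFactor γ φ x (Function.update g l y) (C.linkFace l) (j (C.linkFace l)) := by
    ext y
    rw [← Finset.prod_erase_mul _ _ (Finset.mem_univ (C.linkFace l)), Pi.smul_apply, smul_eq_mul,
      Finset.prod_congr rfl fun f hf => ?_]
    exact faceFactor_update_of_ne γ φ x g l y f
      (side_ne_of_ne_linkFace (Finset.ne_of_mem_erase hf)) (j f)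
  rw [h]
  exact Submodule.smul_mem _ _ (faceFactor_update_mem γ φ x g l _ i hi _)

/-- The spin terms of the amplitude are matrix coefficients in each link variable. -/
lemma spinTerm_update_mem [Fintype E] [Fintype F] [Fintype L] [DecidableEq L] {γ : ℝ}
    {ν : Measure SL2C} {φ : C.GaugeFixing} (hconv : Converges γ ν φ) (g : L → SL2C) (l : L)
    (j : F → ℕ) : (fun y => spinTerm γ ν φ j (Function.update g l y)) ∈
      ktSpace (γ * ((j (C.linkFace l) : ℝ) / 2)) (j (C.linkFace l)) :=
  integral_mem_of_finiteDimensional _ (fun x => prod_faceFactor_update_mem γ φ x g l j)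
    fun y => hconv.integrable j (Function.update g l y)

end TwoComplex

/-! ### Exchange of sums and integrals -/

/-- By Tonelli the sum of norms is finite almost everywhere, which also yields measurability of the
sum as an almost everywhere limit. -/
lemma integrable_tsum_of_lintegral {X ι : Type*} [MeasurableSpace X] {μ : Measure X} [Countable ι]
    {a : ι → X → ℂ} (ha : ∀ j, AEStronglyMeasurable (a j) μ)
    (hsum : ∑' j, ∫⁻ x, ‖a j x‖ₑ ∂μ < ⊤) : Integrable (fun x => ∑' j, a j x) μ := by
  have hsum' : ∫⁻ x, ∑' j, ‖a j x‖ₑ ∂μ < ⊤ := by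
    rwa [lintegral_tsum fun j => (ha j).enorm]
  have hae : ∀ᵐ x ∂μ, Summable fun j => a j x := by
    filter_upwards [ae_lt_top' (AEMeasurable.tsum fun j => (ha j).enorm) hsum'.ne] with x hx
    exact Summable.of_enorm hx.ne
  refine ⟨?_, ?_⟩
  · refine aestronglyMeasurable_of_tendsto_ae (Filter.atTop : Filter (Finset ι))
      (f := fun s x => ∑ j ∈ s, a j x)
      (fun s => Finset.aestronglyMeasurable_fun_sum s fun j _ => ha j) ?_
    filter_upwards [hae] with x hx
    exact hx.hasSum
  · rw [hasFiniteIntegral_iff_enorm]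
    exact (lintegral_mono fun x => enorm_tsum_le_tsum_enorm).trans_lt hsum'

lemma hasSum_integral_mul_tsum {X ι : Type*} [MeasurableSpace X] {μ : Measure X} [Countable ι]
    {a : ι → X → ℂ} (ha : ∀ j, AEStronglyMeasurable (a j) μ)
    (hsum : ∑' j, ∫⁻ x, ‖a j x‖ₑ ∂μ < ⊤) {K : X → ℂ} (hK : AEStronglyMeasurable K μ) {B : ℝ}
    (hB : ∀ x, ‖K x‖ ≤ B) :
    HasSum (fun j => ∫ x, K x * a j x ∂μ) (∫ x, K x * ∑' j, a j x ∂μ) := by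
  have hint : ∀ j, Integrable (a j) μ := fun j =>
    ⟨ha j, by
      rw [hasFiniteIntegral_iff_enorm]
      exact (ENNReal.le_tsum j).trans_lt hsum⟩
  have hnorm : Summable fun j => ∫ x, ‖a j x‖ ∂μ := by
    have h := ENNReal.summable_toReal hsum.ne
    refine h.congr fun j => ?_
    rw [integral_norm_eq_lintegral_enorm (ha j)]
  simp only [← tsum_mul_left]
  refine hasSum_integral_of_summable_integral_norm
    (fun j => (hint j).bdd_mul hK (Filter.Eventually.of_forall hB)) ?_
  refine Summable.of_nonneg_of_le (fun j => integral_nonneg fun x => norm_nonneg _) (fun j => ?_)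
    (hnorm.mul_left B)
  rw [← integral_const_mul]
  refine integral_mono_of_nonneg (Filter.Eventually.of_forall fun x => norm_nonneg _)
    ((hint j).norm.const_mul B) (Filter.Eventually.of_forall fun x => ?_)
  change ‖K x * a j x‖ ≤ B * ‖a j x‖
  rw [norm_mul]
  exact mul_le_mul_of_nonneg_right (hB x) (norm_nonneg _)

lemma hasSum_of_forall_eq {ι : Type*} {a b : ι → ℂ} {s : ℂ} (h : HasSum a s)
    (hab : ∀ j, b j = a j) : HasSum b s :=
  funext hab ▸ h

/-- Summation over the fibers of a map. -/
lemma hasSum_of_fiberwise {I J : Type*} [DecidableEq I] (q : J → I) {A : J → ℂ} {a : ℂ}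
    (hA : HasSum A a) {T : I → ℂ}
    (hT : ∀ i, HasSum (fun j => if i = q j then A j else 0) (T i)) : HasSum T a := by
  have hinj : Function.Injective fun j => (q j, j) := fun j j' h => congrArg Prod.snd h
  -- The family lives on the graph of `q` in I × J; summing the product over J first gives the fibre
  -- sums.
  have h1 : HasSum (fun x : I × J => if x.1 = q x.2 then A x.2 else 0) a := by
    rw [← hinj.hasSum_iff]
    · simpa [Function.comp_def] using hA
    · rintro ⟨i, j⟩ hij
      refine if_neg fun h => hij ⟨j, ?_⟩
      change i = q j at h
      rw [h]
  exact h1.prod_fiberwise hT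

/-! ### The kernel acting on all links -/

instance : SecondCountableTopology SU2 := TopologicalSpace.Subtype.secondCountableTopology _

lemma continuous_prod_kernelTerm {L : Type*} [Fintype L] (p : ℕ → ℝ) (g : L → SL2C) (i : L → ℕ) :
    Continuous fun h : L → SU2 => ∏ l, kernelTerm p (i l) (g l) (h l) :=
  continuous_finsetProd _ fun l _ => (continuous_kernelTerm p (i l) (g l)).comp
    (continuous_apply l)

lemma exists_bound_prod_kernelTerm {L : Type*} [Fintype L] (p : ℕ → ℝ) (g : L → SL2C) (i : L → ℕ) :
    ∃ B : ℝ, ∀ h : L → SU2, ‖∏ l, kernelTerm p (i l) (g l) (h l)‖ ≤ B := by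
  obtain ⟨B, hB⟩ := isCompact_univ.exists_bound_of_continuousOn
    (continuous_prod_kernelTerm p g i).continuousOn
  exact ⟨B, fun h => hB h (Set.mem_univ h)⟩

/-- The Dupuis–Livine kernel on all links reproduces matrix coefficients. -/
lemma integral_prod_kernelTerm_mul {L : Type*} [Fintype L] [DecidableEq L] (p : ℕ → ℝ)
    (m i : L → ℕ) {B : (L → SL2C) → ℂ}
    (hB : ∀ l g, (fun x => B (Function.update g l x)) ∈ ktSpace (p (m l)) (m l)) (g : L → SL2C) :
    (Continuous fun h : L → SU2 => B fun l => (h l : SL2C)) ∧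
    ∫ h : L → SU2, (∏ l, kernelTerm p (i l) (g l) (h l)) * B (fun l => (h l : SL2C))
      ∂(Measure.pi fun _ : L => haarSU2) = if i = m then B g else 0 := by
  have hK := continuous_prod_kernelTerm p g i
  have hint : ∀ {f : (L → SU2) → ℂ}, Continuous f →
      Integrable f (Measure.pi fun _ : L => haarSU2) := fun hf =>
    hf.integrable_of_hasCompactSupport (HasCompactSupport.of_compactSpace _)
  have hmem := mem_span_prod_of_forall_update (fun l => ktSpace (p (m l)) (m l)) hB
  clear hB
  induction hmem using Submodule.span_induction with
  | mem P hP =>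
    obtain ⟨e, he, rfl⟩ := hP
    refine ⟨continuous_finsetProd _ fun l _ => (continuous_of_mem_ktSpace (he l)).comp
      (continuous_apply l), ?_⟩
    simp only [← Finset.prod_mul_distrib]
    rw [integral_fintype_prod_eq_prod (fun l (h : SU2) => kernelTerm p (i l) (g l) h * e l h)]
    simp only [integral_kernelTerm_mul p _ _ (he _)]
    -- Each link contributes a Kronecker delta; their product requires all link spins to agree.
    rw [Fintype.prod_ite_zero]
    simp only [funext_iff]
  | zero => exact ⟨continuous_const, by simp⟩
  | add P Q _ _ hP hQ =>
    refine ⟨hP.1.add hQ.1, ?_⟩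
    simp only [Pi.add_apply, mul_add]
    have hintP : Integrable (fun h : L → SU2 => (∏ l, kernelTerm p (i l) (g l) (h l)) *
      P fun l => (h l : SL2C)) (Measure.pi fun _ : L => haarSU2) := hint (hK.mul hP.1)
    have hintQ : Integrable (fun h : L → SU2 => (∏ l, kernelTerm p (i l) (g l) (h l)) *
      Q fun l => (h l : SL2C)) (Measure.pi fun _ : L => haarSU2) := hint (hK.mul hQ.1)
    rw [integral_add hintP hintQ, hP.2, hQ.2]
    split_ifs <;> simp
  | smul c P _ hP =>
    refine ⟨continuous_const.mul hP.1, ?_⟩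
    simp only [Pi.smul_apply, smul_eq_mul, mul_left_comm _ c]
    rw [integral_const_mul, hP.2]
    split_ifs <;> simp

/-! ### The Dupuis–Livine map on the amplitude -/

namespace TwoComplex

variable {V N E L F : Type*} {C : TwoComplex V N E L F} [Fintype E] [Fintype F] [Fintype L]
  {γ : ℝ} {ν : Measure SL2C} {φ : C.GaugeFixing}

lemma hasSum_spinTerm (hconv : Converges γ ν φ) (g : L → SL2C) :
    HasSum (fun j : F → ℕ => spinTerm γ ν φ j g) (amplitudeSL2C γ ν φ g) := by
  -- With no entry integrated, the integrand is constant on a probability space, and the hypothesis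
  -- becomes pointwise summability.
  have h := hconv.summable g ∅
  simp only [Set.mem_empty_iff_false, if_false, lintegral_const, measure_univ, mul_one] at h
  exact (Summable.of_enorm h.ne).hasSum

lemma tsum_lintegral_spinTerm (hconv : Converges γ ν φ) :
    ∑' j : F → ℕ, ∫⁻ h : L → SU2, ‖spinTerm γ ν φ j fun l => (h l : SL2C)‖ₑ
      ∂(Measure.pi fun _ : L => haarSU2) < ⊤ := by
  simpa using hconv.summable 1 Set.univ

variable [DecidableEq L]

lemma continuous_spinTerm_update (hconv : Converges γ ν φ) (g : L → SL2C) (l : L) (j : F → ℕ) :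
    Continuous fun h : SU2 => spinTerm γ ν φ j (Function.update g l (h : SL2C)) :=
  continuous_of_mem_ktSpace (spinTerm_update_mem hconv g l j)

lemma tsum_lintegral_spinTerm_update (hconv : Converges γ ν φ) (g : L → SL2C) (l : L) :
    ∑' j : F → ℕ, ∫⁻ h : SU2, ‖spinTerm γ ν φ j (Function.update g l (h : SL2C))‖ₑ ∂haarSU2
      < ⊤ := by
  have h := hconv.summable g {l}
  refine lt_of_eq_of_lt (tsum_congr fun j => ?_) h
  -- The integrand depends only on the coordinate l, whose projection preserves the measure.
  rw [← (measurePreserving_eval (fun _ : L => haarSU2) l).lintegral_comp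
    (continuous_spinTerm_update hconv g l j).measurable.enorm]
  refine lintegral_congr fun h => ?_
  congr 2
  ext1 l'
  by_cases hl : l' = l
  · subst hl
    simp
  · simp [hl]

/-- The amplitude is a projected function of each of its entries. -/
theorem isProjected_amplitude (hconv : Converges γ ν φ) (l : L) (g : L → SL2C) :
    IsProjected (fun n => γ * ((n : ℝ) / 2))
      (fun x => amplitudeSL2C γ ν φ (Function.update g l x)) := by
  intro y
  have hm : ∀ j : F → ℕ, AEStronglyMeasurable (fun h : SU2 =>
      spinTerm γ ν φ j (Function.update g l (h : SL2C))) haarSU2 := fun j =>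
    (continuous_spinTerm_update hconv g l j).aestronglyMeasurable
  have hs := tsum_lintegral_spinTerm_update hconv g l
  have hK := continuous_kernelTerm (fun n => γ * ((n : ℝ) / 2))
  refine ⟨fun n => integrable_continuous_mul_SU2 (hK n y) (integrable_tsum_of_lintegral hm hs), ?_⟩
  -- Term n of the kernel selects the assignments j that put spin n/2 on the face of l.
  refine hasSum_of_fiberwise (fun j : F → ℕ => j (C.linkFace l))
    (hasSum_spinTerm hconv (Function.update g l y)) fun n => ?_
  obtain ⟨B, hB⟩ := exists_bound_continuous_SU2 (hK n y)
  have h := hasSum_integral_mul_tsum hm hs (hK n y).aestronglyMeasurable hB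
  refine hasSum_of_forall_eq h fun j => ?_
  exact (integral_kernelTerm_mul (fun n => γ * ((n : ℝ) / 2)) (j (C.linkFace l)) n
    (spinTerm_update_mem hconv g l j) y).symm

lemma continuous_spinTerm (hconv : Converges γ ν φ) (j : F → ℕ) :
    Continuous fun h : L → SU2 => spinTerm γ ν φ j fun l => (h l : SL2C) :=
  -- Only the continuity half is used; the values 0 and 1 are placeholders.
  (integral_prod_kernelTerm_mul (fun n => γ * ((n : ℝ) / 2)) (fun l => j (C.linkFace l)) 0
    (fun l g => spinTerm_update_mem hconv g l j) 1).1

lemma aestronglyMeasurable_spinTerm (hconv : Converges γ ν φ) (j : F → ℕ) :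
    AEStronglyMeasurable (fun h : L → SU2 => spinTerm γ ν φ j fun l => (h l : SL2C))
      (Measure.pi fun _ : L => haarSU2) :=
  (continuous_spinTerm hconv j).aestronglyMeasurable

lemma integrable_amplitude (hconv : Converges γ ν φ) :
    Integrable (amplitude γ ν φ) (Measure.pi fun _ : L => haarSU2) :=
  integrable_tsum_of_lintegral (aestronglyMeasurable_spinTerm hconv)
    (tsum_lintegral_spinTerm hconv)

lemma integrable_prod_kernelTerm_mul_amplitude (hconv : Converges γ ν φ) (p : ℕ → ℝ)
    (g : L → SL2C) (i : L → ℕ) :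
    Integrable (fun h : L → SU2 => (∏ l, kernelTerm p (i l) (g l) (h l)) * amplitude γ ν φ h)
      (Measure.pi fun _ : L => haarSU2) := by
  obtain ⟨B, hB⟩ := exists_bound_prod_kernelTerm p g i
  exact (integrable_amplitude hconv).bdd_mul
    (continuous_prod_kernelTerm p g i).aestronglyMeasurable (Filter.Eventually.of_forall hB)

lemma hasSum_ite_spinTerm (hconv : Converges γ ν φ) (g : L → SL2C) (i : L → ℕ) :
    HasSum (fun j : F → ℕ => if i = fun l => j (C.linkFace l) then spinTerm γ ν φ j g else 0)
      (dupuisLivineTerm (fun n => γ * ((n : ℝ) / 2)) (amplitude γ ν φ) g i) := by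
  obtain ⟨B, hB⟩ := exists_bound_prod_kernelTerm (fun n => γ * ((n : ℝ) / 2)) g i
  have h := hasSum_integral_mul_tsum (aestronglyMeasurable_spinTerm hconv)
    (tsum_lintegral_spinTerm hconv)
    (continuous_prod_kernelTerm (fun n => γ * ((n : ℝ) / 2)) g i).aestronglyMeasurable hB
  refine hasSum_of_forall_eq h fun j => ?_
  exact (integral_prod_kernelTerm_mul (fun n => γ * ((n : ℝ) / 2)) (fun l => j (C.linkFace l)) i
    (fun l g => spinTerm_update_mem hconv g l j) g).2.symm

/-- The sum over spins in the Dupuis–Livine map of the amplitude. -/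
theorem hasSum_dupuisLivineTerm (hconv : Converges γ ν φ) (g : L → SL2C) :
    HasSum (dupuisLivineTerm (fun n => γ * ((n : ℝ) / 2)) (amplitude γ ν φ) g)
      (amplitudeSL2C γ ν φ g) :=
  hasSum_of_fiberwise (fun (j : F → ℕ) l => j (C.linkFace l)) (hasSum_spinTerm hconv g)
    fun i => hasSum_ite_spinTerm hconv g i

end TwoComplex

end Spinfoam

end

open Spinfoam Spinfoam.TwoComplex MeasureTheory in
theorem theorem1 {V N E L F : Type*} [Fintype E] [Fintype L] [DecidableEq L] [Fintype F]
    (C : TwoComplex V N E L F) (φ : C.GaugeFixing)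
    (ν : Measure SL2C) [ν.IsHaarMeasure] (γ : ℝ) (hγ : 0 < γ)
    (hconv : Converges γ ν φ) :
    (∀ (l : L) (g : L → SL2C),
      IsProjected (fun n => γ * ((n : ℝ) / 2))
        (fun x => amplitudeSL2C γ ν φ (Function.update g l x))) ∧
    (∀ g : L → SL2C,
      DupuisLivineConverges (fun n => γ * ((n : ℝ) / 2)) (amplitude γ ν φ) g) ∧
    dupuisLivine (fun n => γ * ((n : ℝ) / 2)) (amplitude γ ν φ) = amplitudeSL2C γ ν φ := by
  refine ⟨isProjected_amplitude hconv, fun g =>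
    ⟨integrable_prod_kernelTerm_mul_amplitude hconv _ g, (hasSum_dupuisLivineTerm hconv g).summable⟩,
    ?_⟩
  ext g
  exact (hasSum_dupuisLivineTerm hconv g).tsum_eq
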